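/- **Conventions.** Radii are reals $0<r\le 1$; norm degrees are integers $k\ge 0$. *SCI-space $\mathcal H$*: real vector spaces $\mathcal H_r$ with norms $\|\cdot\|_{k,r}$ and linear restriction maps $\mathcal H_r\to\mathcal H_{r'}$ ($r'\le r$; the identity if $r'=r$), compatible with composition and suppressed in the notation, such that: $\|f\|_{k',r'}\le\|f\|_{k,r}$ for $k'\le k$, $r'\le r$; a sequence in $\mathcal H_r$ that is Cauchy in every norm converges in every norm to an element of $\mathcal H_r$; and there are linear smoothing operators $S_r(t):\mathcal H_r\to\mathcal H_r$ ($t>1$) with $\|S_r(t)f\|_{p,r}\le C_{r,p,q}t^{p-q}\|f\|_{q,r}$ and $\|f-S_r(t)f\|_{q,r}\le C_{r,p,q}t^{q-p}\|f\|_{p,r}$ for all integers $p>q\ge 1$, with $C_{r,p,q}>0$ continuous in $r$. An *SCI-subspace* is a family of linear subspaces that is itself an SCI-space under the induced norms, restrictions and smoothing operators; an *SCI-subset* is a family of subsets invariant under restriction. *Polynomial bounds.* $\mathrm{Poly}(x_1,\dots,x_n)$ denotes a polynomial whose coefficients are nonnegative continuous functions of the radii on the two sides of the inequality; it may depend on $k$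 but not on the elements being estimated. For expressions $A_i(j)$ in the norms of degree $j$, $$\mathfrak L(A_1(k_1),\dots,A_n(k_n))=\Big(\sum_i A_i(k_i)\prod_{j\ne i}A_j(\lfloor k_j/2\rfloor+1)\Big)\,\mathrm{Poly}\big(A_1(\lfloor k_1/2\rfloor+1),\dots,A_n(\lfloor k_n/2\rfloor+1)\big).$$ In an estimate whose left side involves the result of a product, inverse or action, the left side is taken at any radius $r'$ at which the result is defined, and the right side at the radius $r$ of the operands; otherwise both sides are at the same radius. Equations are required at all radii at which both sides are defined. "For large $k$" means: for all $k\ge k_0$, with $k_0$ independent of radii and elements. *SCI-group $\mathcal G$ modelled on an SCI-space $\mathcal W$*: $\mathcal G_r=\{\mathrm{Id}+\chi:\chi\in\mathcal W_r\}$, with a constant $c>1$ such that for $\varphi,\psi\in\mathcal G_r$ the product $\psi\cdot\varphi$ and the inverse $\varphi^{-1}$ are defined at every radius $r'\le r(1-c\|\varphi-\mathrm{Id}\|_{1,r})$. The product commutes with restriction and is associative; restricting $\varphi^{-1}$ to a smaller radius gives the inverse at that radius; $\varphi^{-1}\cdot\varphi=\varphi\cdot\varphi^{-1}=\mathrm{Id}$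 at radii $r''\le r'(1-c\|\varphi-\mathrm{Id}\|_{1,r})$ where the product is defined; and for every $k\ge1$ $$\|\psi^{-1}-\varphi^{-1}\|_k\le\mathfrak L(\|\psi-\varphi\|_k,1+\|\varphi-\mathrm{Id}\|_k),\quad \|\varphi\cdot\psi-\varphi\|_k\le\mathfrak L(\|\psi-\mathrm{Id}\|_k,1+\|\varphi-\mathrm{Id}\|_{k+1}),$$ $$\|\varphi\cdot\psi-\mathrm{Id}\|_k\le\mathfrak L(\|\psi-\mathrm{Id}\|_k+\|\varphi-\mathrm{Id}\|_k).$$ A *closed subgroup* of $\mathcal G$ is an SCI-subset that contains $\mathrm{Id}$ and is closed under products and inverses wherever these are defined, and under limits (in all norms) at each radius. *SCI-action of $\mathcal G$ on $\mathcal H$* (left or right): an operation $(\varphi,f)\mapsto\varphi\cdot f\in\mathcal H_{r'}$ for $\varphi\in\mathcal G_r$, $f\in\mathcal H_r$, $r'\le r(1-c'\|\varphi-\mathrm{Id}\|_{1,r})$, with a constant $c'>1$, that commutes with restriction, satisfies $\mathrm{Id}\cdot f=f$ and the left (resp. right) action law, and for which there is $s'\in\mathbb N$ with, for large $k$, $$\|\varphi\cdot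 f-\varphi\cdot g\|_k\le\mathfrak L(\|f-g\|_k,1+\|\varphi-\mathrm{Id}\|_{k+s'}),$$ $$\|\psi\cdot f-\varphi\cdot f\|_k\le\mathfrak L(1+\|f\|_{k+s'},\|\psi-\varphi\|_{k+s'},1+\|\varphi-\mathrm{Id}\|_{k+s'}).$$ **Theorem.** Let $\mathcal T$ be an SCI-space, $\mathcal F$ an SCI-subspace of $\mathcal T$, and $\mathcal I$ an SCI-subset of $\mathcal T$ containing $0$ at every radius. Put $\mathcal N=\mathcal F\cap\mathcal I$. Let $\pi:\mathcal T\to\mathcal F$ be a linear projection commuting with restriction, $\zeta=\mathrm{Id}-\pi$, and suppose that for all $\varepsilon\in\mathcal T$ and large $k$ $$\|\zeta(\varepsilon)\|_k\le\mathfrak L(\|\varepsilon\|_k).$$ Let $\mathcal G$ be an SCI-group with an SCI-action on $\mathcal T$, and let $\mathcal G^0$ be a closed subgroup of $\mathcal G$ preserving $\mathcal I$ (that is, $\varphi\cdot\varepsilon\in\mathcal I_{r'}$ whenever $\varphi\in\mathcal G^0_r$, $\varepsilon\in\mathcal I_r$ and $\varphi\cdot\varepsilon$ is defined at $r'$). Let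 $\mathcal V$ be an SCI-space, $V_r:\mathcal I_r\to\mathcal V_r$ and $\Phi_r:\mathcal V_r\to\mathcal G^0_r$, $v\mapsto\Phi_v$, maps given for every radius $r$, and $s\in\mathbb N$, such that for all $\varepsilon\in\mathcal I$, all $v,w\in\mathcal V$ and large $k$ $$\|V(\varepsilon)\|_k\le\mathfrak L(\|\zeta(\varepsilon)\|_{k+s},1+\|\varepsilon\|_{k+s}),\qquad \|\Phi_v-\mathrm{Id}\|_k\le\mathfrak L(\|v\|_{k+s}),$$ $$\|\Phi_v\cdot\varepsilon-\Phi_w\cdot\varepsilon\|_k\le\mathfrak L(\|v-w\|_{k+s},1+\|v\|_{k+s}+\|w\|_{k+s}+\|\varepsilon\|_{k+s})+\mathfrak L((\|v\|_{k+s}+\|w\|_{k+s})^2,1+\|\varepsilon\|_{k+s}).$$ Suppose finally that there is $\delta>0$ such that for all $\varepsilon\in\mathcal I$ and large $k$ $$\|\zeta(\Phi_{V(\varepsilon)}\cdot\varepsilon)\|_k\le\|\zeta(\varepsilon)\|_{k+s}^{1+\delta}\,\mathrm{Poly}(\|\varepsilon\|_{k+s},\|\Phi_{V(\varepsilon)}-\mathrm{Id}\|_{k+s},\|\zeta(\varepsilon)\|_{k+s},\|\varepsilon\|_k),$$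 where the degree of the polynomial in its first variable is bounded independently of $k$. Then there is an integer $l\ge1$ such that for every radius $R_0\in(0,1]$ there are $\alpha,\beta>0$ with the following property. If $R\in[R_0,1]$ and $\varepsilon\in\mathcal I_R$ satisfies $\|\varepsilon\|_{2l-1,R}<\alpha$ and $\|\zeta(\varepsilon)\|_{l,R}<\beta$, then there are $r\in[R/2,R]$ and $\psi\in\mathcal G^0_r$ (which restricts to an element of $\mathcal G^0_{R/2}$) with $R/2\le r(1-c'\|\psi-\mathrm{Id}\|_{1,r})$, so that $\psi\cdot\varepsilon$ is defined at radius $R/2$, and $\psi\cdot\varepsilon\in\mathcal N_{R/2}$. -/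

import Mathlib

open Filter Topology

universe u v w

/-- Radii `0 < r ≤ 1`. -/
abbrev Radius : Type := Set.Ioc (0 : ℝ) 1

/-- The radius `R / 2`. -/
noncomputable def Radius.half (R : Radius) : Radius :=
  ⟨(R : ℝ) / 2, by
    have h0 : (0 : ℝ) < R := R.2.1
    have h1 : (R : ℝ) ≤ 1 := R.2.2
    constructor <;> linarith⟩

/-- `r' ≤ r (1 - c x)`: the radii `r'` at which an operation applied at radius `r` is defined,
where `x` is the degree-one norm which controls the shrinking. As `0 < r'`, this forces
`c x < 1`, and, for `c, x ≥ 0`, also `r' ≤ r`. -/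
def Radius.Shrink (c x : ℝ) (r r' : Radius) : Prop :=
  (r' : ℝ) ≤ (r : ℝ) * (1 - c * x)

/-- A scaled `C^∞` space: spaces `H r` with norms `‖·‖_{k,r}`, restriction maps (with the
convention that restriction from `r` to `r` is the identity), completeness, and smoothing
operators. -/
structure SCISpace where
  carrier : Radius → Type u
  [addCommGroup : ∀ r, AddCommGroup (carrier r)]
  [module : ∀ r, Module ℝ (carrier r)]
  /-- `nrm k r f` is `‖f‖_{k,r}`. -/
  nrm : ℕ → ∀ r, Seminorm ℝ (carrier r)
  eq_zero_of_nrm : ∀ k r (f : carrier r), nrm k r f = 0 → f = 0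
  res : ∀ {r r' : Radius}, r' ≤ r → (carrier r →ₗ[ℝ] carrier r')
  res_refl : ∀ {r : Radius} (h : r ≤ r) (f : carrier r), res h f = f
  res_res : ∀ {r r' r'' : Radius} (h : r' ≤ r) (h' : r'' ≤ r') (f : carrier r),
    res h' (res h f) = res (h'.trans h) f
  nrm_mono : ∀ {k k' : ℕ} {r r' : Radius} (_ : k' ≤ k) (h : r' ≤ r) (f : carrier r),
    nrm k' r' (res h f) ≤ nrm k r f
  complete : ∀ (r : Radius) (f : ℕ → carrier r),
    (∀ k : ℕ, ∀ η > (0 : ℝ), ∃ N, ∀ m ≥ N, ∀ n ≥ N, nrm k r (f m - f n) < η) →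
    ∃ g : carrier r, ∀ k : ℕ, Tendsto (fun n => nrm k r (f n - g)) atTop (𝓝 0)
  /-- The smoothing operators `S_r(t)`; only the values at `t > 1` matter. -/
  smooth : ∀ r, ℝ → (carrier r →ₗ[ℝ] carrier r)
  smooth_bound : ∀ p q : ℕ, 0 < q → q < p → ∃ C : C(Radius, ℝ), (∀ r, 0 < C r) ∧
    ∀ (r : Radius) (t : ℝ), 1 < t → ∀ f : carrier r,
      nrm p r (smooth r t f) ≤ C r * t ^ (p - q) * nrm q r f ∧
      nrm q r (f - smooth r t f) ≤ C r * (t ^ (p - q))⁻¹ * nrm p r f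

attribute [instance] SCISpace.addCommGroup SCISpace.module

/-- Subspaces which form an SCI-space under the induced norms, restriction maps and smoothing
operators. -/
structure SCISubspace (H : SCISpace.{u}) where
  carrier : ∀ r, Submodule ℝ (H.carrier r)
  res_mem : ∀ {r r' : Radius} (h : r' ≤ r) (f : H.carrier r), f ∈ carrier r →
    H.res h f ∈ carrier r'
  smooth_mem : ∀ (r : Radius) (t : ℝ), 1 < t → ∀ f ∈ carrier r, H.smooth r t f ∈ carrier r
  complete : ∀ (r : Radius) (f : ℕ → H.carrier r), (∀ n, f n ∈ carrier r) →
    (∀ k : ℕ, ∀ η > (0 : ℝ), ∃ N, ∀ m ≥ N, ∀ n ≥ N, H.nrm k r (f m - f n) < η) →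
    ∃ g ∈ carrier r, ∀ k : ℕ, Tendsto (fun n => H.nrm k r (f n - g)) atTop (𝓝 0)

/-- A collection of subsets invariant under the restriction maps. -/
def IsSCISubset (H : SCISpace.{u}) (S : ∀ r, Set (H.carrier r)) : Prop :=
  ∀ {r r' : Radius} (h : r' ≤ r) (f : H.carrier r), f ∈ S r → H.res h f ∈ S r'

/-- A (linear) projection onto an SCI-subspace, commuting with restriction. -/
structure SCIProjection {T : SCISpace.{u}} (F : SCISubspace T) where
  proj : ∀ r, T.carrier r →ₗ[ℝ] F.carrier r
  proj_of_mem : ∀ (r : Radius) (f : F.carrier r), proj r (f : T.carrier r) = f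
  proj_res : ∀ {r r' : Radius} (h : r' ≤ r) (f : T.carrier r),
    (proj r' (T.res h f) : T.carrier r') = T.res h (proj r f : T.carrier r)

/-- `ζ = Id - π`. -/
def SCIProjection.zeta {T : SCISpace.{u}} {F : SCISubspace T} (π : SCIProjection F)
    (r : Radius) (ε : T.carrier r) : T.carrier r :=
  ε - (π.proj r ε : T.carrier r)

/-- A polynomial in `n` variables whose coefficients are nonnegative continuous functions of the
radius. Both the radius of the lesser side and the radius of the greater side of the inequality
in which the polynomial occurs are allowed to enter. -/
structure RadPoly (n : ℕ) where
  poly : MvPolynomial (Fin n) C(Radius × Radius, ℝ)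
  coeff_nonneg : ∀ (m : Fin n →₀ ℕ) (ρ : Radius × Radius), 0 ≤ poly.coeff m ρ

/-- The value at `x` of the polynomial, at radii `r'` (lesser side) and `r` (greater side). -/
noncomputable def RadPoly.eval {n : ℕ} (P : RadPoly n) (r' r : Radius) (x : Fin n → ℝ) : ℝ :=
  ∑ m ∈ P.poly.support, P.poly.coeff m (r', r) * ∏ i, x i ^ m i

/-- The Leibniz polynomial with entries `A i`, in degrees `k i`. An entry `A i` is given as a
function of the norm degree. Every summand has one entry in its large degree `k i`, all other
factors are entries in their small degree `⌊k j / 2⌋ + 1`. -/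
noncomputable def leibniz {n : ℕ} (P : RadPoly n) (r' r : Radius) (k : Fin n → ℕ)
    (A : Fin n → ℕ → ℝ) : ℝ :=
  (∑ i, A i (k i) * ∏ j ∈ Finset.univ.erase i, A j (k j / 2 + 1)) *
    P.eval r' r (fun i => A i (k i / 2 + 1))

/-- An SCI-group modelled on `W`. The elements at radius `r` are the formal sums `Id + χ`,
`χ ∈ W r`, and are represented by `χ`: thus `φ : W.carrier r` stands for the element `φ` with
`φ - Id` in `W r`, the identity is `0`, and differences of elements are differences in `W r`.
`mul r r' ψ φ` is the product `ψ · φ` of elements at radius `r`, taken at radius `r'`, and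
`inv r r' φ` is the inverse at radius `r'`; both matter only if `r' ≤ r (1 - c ‖φ - Id‖_{1,r})`.
Equations are required at all radii at which both sides are defined. -/
structure SCIGroup (W : SCISpace.{u}) where
  c : ℝ
  one_lt_c : 1 < c
  mul : ∀ r r' : Radius, W.carrier r → W.carrier r → W.carrier r'
  inv : ∀ r r' : Radius, W.carrier r → W.carrier r'
  res_mul : ∀ {r r' r'' : Radius} (h : r'' ≤ r') (ψ φ : W.carrier r),
    Radius.Shrink c (W.nrm 1 r φ) r r' → W.res h (mul r r' ψ φ) = mul r r'' ψ φ
  mul_res : ∀ {r s r' : Radius} (h : s ≤ r) (ψ φ : W.carrier r),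
    Radius.Shrink c (W.nrm 1 r φ) r r' → Radius.Shrink c (W.nrm 1 s (W.res h φ)) s r' →
    mul s r' (W.res h ψ) (W.res h φ) = mul r r' ψ φ
  mul_assoc : ∀ {r r₁ r₂ r' : Radius} (h₁ : r₁ ≤ r) (h₂ : r₂ ≤ r) (χ ψ φ : W.carrier r),
    Radius.Shrink c (W.nrm 1 r ψ) r r₁ →
    Radius.Shrink c (W.nrm 1 r₁ (W.res h₁ φ)) r₁ r' →
    Radius.Shrink c (W.nrm 1 r φ) r r₂ →
    Radius.Shrink c (W.nrm 1 r₂ (mul r r₂ ψ φ)) r₂ r' →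
    mul r₁ r' (mul r r₁ χ ψ) (W.res h₁ φ) = mul r₂ r' (W.res h₂ χ) (mul r r₂ ψ φ)
  res_inv : ∀ {r r' r'' : Radius} (h : r'' ≤ r') (φ : W.carrier r),
    Radius.Shrink c (W.nrm 1 r φ) r r' → W.res h (inv r r' φ) = inv r r'' φ
  inv_mul : ∀ {r r' r'' : Radius} (h : r' ≤ r) (φ : W.carrier r),
    Radius.Shrink c (W.nrm 1 r φ) r r' → Radius.Shrink c (W.nrm 1 r φ) r' r'' →
    mul r' r'' (inv r r' φ) (W.res h φ) = 0
  mul_inv : ∀ {r r' r'' : Radius} (h : r' ≤ r) (φ : W.carrier r),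
    Radius.Shrink c (W.nrm 1 r φ) r r' → Radius.Shrink c (W.nrm 1 r φ) r' r'' →
    Radius.Shrink c (W.nrm 1 r' (inv r r' φ)) r' r'' →
    mul r' r'' (W.res h φ) (inv r r' φ) = 0
  /-- `‖ψ⁻¹ - φ⁻¹‖_k ≤ 𝔏(‖ψ - φ‖_k, 1 + ‖φ - Id‖_k)` -/
  inv_sub_inv : ∀ k : ℕ, 1 ≤ k → ∃ P : RadPoly 2, ∀ (r r' : Radius) (ψ φ : W.carrier r),
    Radius.Shrink c (W.nrm 1 r ψ) r r' → Radius.Shrink c (W.nrm 1 r φ) r r' →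
    W.nrm k r' (inv r r' ψ - inv r r' φ) ≤
      leibniz P r' r ![k, k] ![fun j => W.nrm j r (ψ - φ), fun j => 1 + W.nrm j r φ]
  /-- `‖φ · ψ - φ‖_k ≤ 𝔏(‖ψ - Id‖_k, 1 + ‖φ - Id‖_{k+1})` -/
  mul_sub : ∀ k : ℕ, 1 ≤ k → ∃ P : RadPoly 2, ∀ (r r' : Radius) (h : r' ≤ r)
    (φ ψ : W.carrier r), Radius.Shrink c (W.nrm 1 r ψ) r r' →
    W.nrm k r' (mul r r' φ ψ - W.res h φ) ≤
      leibniz P r' r ![k, k + 1] ![fun j => W.nrm j r ψ, fun j => 1 + W.nrm j r φ]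
  /-- `‖φ · ψ - Id‖_k ≤ 𝔏(‖ψ - Id‖_k + ‖φ - Id‖_k)` -/
  mul_bound : ∀ k : ℕ, 1 ≤ k → ∃ P : RadPoly 1, ∀ (r r' : Radius) (φ ψ : W.carrier r),
    Radius.Shrink c (W.nrm 1 r ψ) r r' →
    W.nrm k r' (mul r r' φ ψ) ≤
      leibniz P r' r ![k] ![fun j => W.nrm j r ψ + W.nrm j r φ]

/-- A closed subgroup: invariant under restriction, the group operations (wherever they are
defined) and limits at each radius. -/
structure SCIGroup.IsClosedSubgroup {W : SCISpace.{u}} (G : SCIGroup W)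
    (S : ∀ r, Set (W.carrier r)) : Prop where
  res_mem : IsSCISubset W S
  one_mem : ∀ r, (0 : W.carrier r) ∈ S r
  mul_mem : ∀ {r r' : Radius} (ψ φ : W.carrier r), ψ ∈ S r → φ ∈ S r →
    Radius.Shrink G.c (W.nrm 1 r φ) r r' → G.mul r r' ψ φ ∈ S r'
  inv_mem : ∀ {r r' : Radius} (φ : W.carrier r), φ ∈ S r →
    Radius.Shrink G.c (W.nrm 1 r φ) r r' → G.inv r r' φ ∈ S r'
  closed : ∀ (r : Radius) (f : ℕ → W.carrier r) (g : W.carrier r), (∀ n, f n ∈ S r) →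
    (∀ k : ℕ, Tendsto (fun n => W.nrm k r (f n - g)) atTop (𝓝 0)) → g ∈ S r

/-- A (left or right) SCI-action of `G` on `H`. `act r r' φ f` is `φ · f` for `φ` and `f` at
radius `r`, taken at radius `r'`; it matters only if `r' ≤ r (1 - c ‖φ - Id‖_{1,r})`. -/
structure SCIAction {W : SCISpace.{u}} (G : SCIGroup W) (H : SCISpace.{v}) where
  c : ℝ
  one_lt_c : 1 < c
  act : ∀ r r' : Radius, W.carrier r → H.carrier r → H.carrier r'
  res_act : ∀ {r r' r'' : Radius} (h : r'' ≤ r') (φ : W.carrier r) (f : H.carrier r),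
    Radius.Shrink c (W.nrm 1 r φ) r r' → H.res h (act r r' φ f) = act r r'' φ f
  act_res : ∀ {r s r' : Radius} (h : s ≤ r) (φ : W.carrier r) (f : H.carrier r),
    Radius.Shrink c (W.nrm 1 r φ) r r' → Radius.Shrink c (W.nrm 1 s (W.res h φ)) s r' →
    act s r' (W.res h φ) (H.res h f) = act r r' φ f
  one_act : ∀ {r r' : Radius} (h : r' ≤ r) (f : H.carrier r), act r r' 0 f = H.res h f
  /-- Either the left law `ψ · (φ · f) = (ψ · φ) · f` or the right law
  `φ · (ψ · f) = (ψ · φ) · f`, at all radii at which both sides are defined. -/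
  act_mul :
    (∀ {r r₁ r₂ r' : Radius} (h₁ : r₁ ≤ r) (h₂ : r₂ ≤ r) (ψ φ : W.carrier r) (f : H.carrier r),
      Radius.Shrink c (W.nrm 1 r φ) r r₁ →
      Radius.Shrink c (W.nrm 1 r₁ (W.res h₁ ψ)) r₁ r' →
      Radius.Shrink G.c (W.nrm 1 r φ) r r₂ →
      Radius.Shrink c (W.nrm 1 r₂ (G.mul r r₂ ψ φ)) r₂ r' →
      act r₁ r' (W.res h₁ ψ) (act r r₁ φ f) = act r₂ r' (G.mul r r₂ ψ φ) (H.res h₂ f)) ∨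
    (∀ {r r₁ r₂ r' : Radius} (h₁ : r₁ ≤ r) (h₂ : r₂ ≤ r) (ψ φ : W.carrier r) (f : H.carrier r),
      Radius.Shrink c (W.nrm 1 r ψ) r r₁ →
      Radius.Shrink c (W.nrm 1 r₁ (W.res h₁ φ)) r₁ r' →
      Radius.Shrink G.c (W.nrm 1 r φ) r r₂ →
      Radius.Shrink c (W.nrm 1 r₂ (G.mul r r₂ ψ φ)) r₂ r' →
      act r₁ r' (W.res h₁ φ) (act r r₁ ψ f) = act r₂ r' (G.mul r r₂ ψ φ) (H.res h₂ f))
  /-- There is a derivative loss `s` such that, for large `k`,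
  `‖φ · f - φ · g‖_k ≤ 𝔏(‖f - g‖_k, 1 + ‖φ - Id‖_{k+s})` and
  `‖ψ · f - φ · f‖_k ≤ 𝔏(1 + ‖f‖_{k+s}, ‖ψ - φ‖_{k+s}, 1 + ‖φ - Id‖_{k+s})`. -/
  bounds : ∃ s : ℕ, ∀ᶠ k : ℕ in atTop,
    (∃ P : RadPoly 2, ∀ (r r' : Radius) (φ : W.carrier r) (f g : H.carrier r),
      Radius.Shrink c (W.nrm 1 r φ) r r' →
      H.nrm k r' (act r r' φ f - act r r' φ g) ≤
        leibniz P r' r ![k, k + s] ![fun j => H.nrm j r (f - g), fun j => 1 + W.nrm j r φ]) ∧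
    (∃ P : RadPoly 3, ∀ (r r' : Radius) (ψ φ : W.carrier r) (f : H.carrier r),
      Radius.Shrink c (W.nrm 1 r ψ) r r' → Radius.Shrink c (W.nrm 1 r φ) r r' →
      H.nrm k r' (act r r' ψ f - act r r' φ f) ≤
        leibniz P r' r ![k + s, k + s, k + s]
          ![fun j => 1 + H.nrm j r f, fun j => W.nrm j r (ψ - φ), fun j => 1 + W.nrm j r φ])

/-!
The proof is a Newton iteration with smoothing, in the style of Nash and Moser. Starting from `ε`,
put `v = V ε`, smooth it to `w = S(t) v`, and replace `ε` by `Φ_w · ε`, then repeat with the larger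
smoothing parameter `t ^ (1 + κ)`, where `κ` is half the minimum of `δ` and `1`, on slightly smaller
radii. All radii stay above `R₀ / 2`, so that compactness turns every Leibniz polynomial into a
plain inequality with uniform constants (`TameEstimates`, `exists_tameEstimates`).

The heart of the matter is one step (`TameEstimates.exists_step_bound`). Suppose that in degree `k`
the element `ε` is bounded and its error `ζ ε` is at most of size `t⁻¹`, while in a degree
`K`, a fixed amount below `2 k`, `ε` is of size `t ^ a`. Interpolation shows that going a bounded
number of degrees above `k` costs only a factor `t ^ ν` with `ν` as small as one likes, provided
that `k` is large.
Hence the losses of derivatives are harmless: the error of `Φ_v · ε` is of size `t ^ (-(1 + δ))`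
up to such factors, and this is where the degree in the first variable of the polynomial has to be
bounded independently of `k`. Replacing `v` by its smoothing `w` changes `Φ_v · ε` by `t ^ (-2)` up
to such factors: the linear term is small because `v - w` gains the whole gap between `k` and `K`,
and the other term is quadratic in `v` and `w`. So the new error is smaller than `t ^ (-(1 + κ))`.
The norm in degree `K` grows by a fixed power `t ^ b` only (`TameEstimates.exists_high_bound`),
because the action loses derivatives on the group element but not on the element acted on; with
`κ a = b + 1` the bound `t ^ a` is reproduced by the step. This gives the iteration
(`exists_iterates`). Once it runs in one degree, the same step estimates push the control up degree
by degree (`exists_bound_of_iterates`), so that the group elements `φ d` tend to the identity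
superexponentially in every norm.

It remains to pass to the limit of the products of the `φ d`. The group axioms control `ψ · θ - ψ`
only for a small factor `θ` on the right (`SCIGroup.exists_partialProduct_bound`). For a right
action the products `φ 0 · φ 1 ⋯` have this form. For a left action the inverses
`(φ 0)⁻¹ · (φ 1)⁻¹ ⋯` have it; they carry the iterates back to `ε`, and the inverse of their limit
is taken at the end (`SCIAction.exists_limit_right`, `SCIAction.exists_limit_left`). The limit lies
in `G₀`, which is closed, hence moves `ε` within `I`, although `I` itself need not be closed; and by
continuity of the action its result is annihilated by `ζ` (`TameEstimates.act_mem_of_tendsto`).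
-/

/-! ### Polynomials in the norms, uniformly in the radii -/

theorem Radius.isCompact_ge (ρ : Radius) : IsCompact {r : Radius | ρ ≤ r} := by
  rw [Subtype.isCompact_iff]
  have : (Subtype.val '' {r : Radius | ρ ≤ r} : Set ℝ) = Set.Icc (ρ : ℝ) 1 := by
    ext x
    constructor
    · rintro ⟨r, hr, rfl⟩
      exact ⟨hr, r.2.2⟩
    · rintro ⟨h1, h2⟩
      exact ⟨⟨x, lt_of_lt_of_le ρ.2.1 h1, h2⟩, h1, rfl⟩
  rw [this]
  exact isCompact_Icc

/-- A continuous function of two radii is bounded as long as the radii stay away from `0`. -/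
theorem Radius.exists_le_of_continuous (f : C(Radius × Radius, ℝ)) (ρ : Radius) :
    ∃ C : ℝ, 0 ≤ C ∧ ∀ r' r : Radius, ρ ≤ r' → ρ ≤ r → f (r', r) ≤ C := by
  have hcpt := (Radius.isCompact_ge ρ).prod (Radius.isCompact_ge ρ)
  obtain ⟨C, hC⟩ := hcpt.exists_bound_of_continuousOn f.continuous.continuousOn
  refine ⟨max C 0, le_max_right _ _, fun r' r h' h => ?_⟩
  exact (le_abs_self _).trans ((hC (r', r) ⟨h', h⟩).trans (le_max_left _ _))

/-- If every monomial of `P` is bounded by a multiple of `g x`, then so is `P`, uniformly over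
radii which stay away from `0`. -/
theorem RadPoly.exists_eval_le_mul {n : ℕ} (P : RadPoly n) (ρ : Radius) (S : Set (Fin n → ℝ))
    (g : (Fin n → ℝ) → ℝ) (hg : ∀ x ∈ S, 0 ≤ g x)
    (h : ∀ m ∈ P.poly.support, ∃ D : ℝ, 0 ≤ D ∧ ∀ x ∈ S, ∏ i, x i ^ m i ≤ D * g x) :
    ∃ C : ℝ, 0 ≤ C ∧ ∀ r' r : Radius, ρ ≤ r' → ρ ≤ r → ∀ x ∈ S, P.eval r' r x ≤ C * g x := by
  choose B hB0 hB using fun m => Radius.exists_le_of_continuous (P.poly.coeff m) ρ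
  choose! D hD0 hD using h
  refine ⟨∑ m ∈ P.poly.support, B m * D m,
    Finset.sum_nonneg fun m hm => mul_nonneg (hB0 m) (hD0 m hm), fun r' r h' h x hx => ?_⟩
  rw [Finset.sum_mul]
  refine Finset.sum_le_sum fun m hm => ?_
  calc P.poly.coeff m (r', r) * ∏ i, x i ^ m i
      ≤ P.poly.coeff m (r', r) * (D m * g x) :=
        mul_le_mul_of_nonneg_left (hD m hm x hx) (P.coeff_nonneg m _)
    _ ≤ B m * (D m * g x) :=
        mul_le_mul_of_nonneg_right (hB m r' r h' h) (mul_nonneg (hD0 m hm) (hg x hx))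
    _ = B m * D m * g x := by ring

theorem RadPoly.exists_eval_le {n : ℕ} (P : RadPoly n) (ρ : Radius) (M : ℝ) :
    ∃ C : ℝ, 0 ≤ C ∧ ∀ r' r : Radius, ρ ≤ r' → ρ ≤ r → ∀ x : Fin n → ℝ,
      (∀ i, 0 ≤ x i ∧ x i ≤ M) → P.eval r' r x ≤ C := by
  obtain ⟨C, hC0, hC⟩ := P.exists_eval_le_mul ρ {x | ∀ i, 0 ≤ x i ∧ x i ≤ M} (fun _ => 1)
    (fun _ _ => zero_le_one) fun m _ => ⟨∏ i, |M| ^ m i, by positivity, fun x hx => by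
      rw [mul_one]
      exact Finset.prod_le_prod (fun i _ => pow_nonneg (hx i).1 _) fun i _ =>
        pow_le_pow_left₀ (hx i).1 ((hx i).2.trans (le_abs_self M)) _⟩
  exact ⟨C, hC0, fun r' r h' h x hx => by simpa using hC r' r h' h x hx⟩

/-- A polynomial of degree at most `d` in its first variable grows at most like the `d`-th power
of this variable while the other variables stay bounded. -/
theorem RadPoly.exists_eval_le_pow {n : ℕ} (P : RadPoly (n + 1)) (ρ : Radius) (M : ℝ) {d : ℕ}
    (hd : P.poly.degreeOf 0 ≤ d) :
    ∃ C : ℝ, 0 ≤ C ∧ ∀ r' r : Radius, ρ ≤ r' → ρ ≤ r → ∀ x : Fin (n + 1) → ℝ,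
      0 ≤ x 0 → (∀ i : Fin n, 0 ≤ x i.succ ∧ x i.succ ≤ M) →
      P.eval r' r x ≤ C * (1 + x 0) ^ d := by
  obtain ⟨C, hC0, hC⟩ := P.exists_eval_le_mul ρ
    {x | 0 ≤ x 0 ∧ ∀ i : Fin n, 0 ≤ x i.succ ∧ x i.succ ≤ M} (fun x => (1 + x 0) ^ d)
    (fun x hx => pow_nonneg (by linarith [hx.1]) _)
    fun m hm => ⟨∏ i : Fin n, |M| ^ m i.succ, by positivity, fun x hx => by
      rw [Fin.prod_univ_succ, mul_comm]
      refine mul_le_mul ?_ ?_ (pow_nonneg hx.1 _) (by positivity)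
      · exact Finset.prod_le_prod (fun i _ => pow_nonneg (hx.2 i).1 _) fun i _ =>
          pow_le_pow_left₀ (hx.2 i).1 ((hx.2 i).2.trans (le_abs_self M)) _
      · have h0 : m 0 ≤ d := (MvPolynomial.degreeOf_le_iff.1 hd) m hm
        calc x 0 ^ m 0 ≤ (1 + x 0) ^ m 0 := pow_le_pow_left₀ hx.1 (by linarith) _
          _ ≤ (1 + x 0) ^ d := pow_le_pow_right₀ (by linarith [hx.1]) h0⟩
  exact ⟨C, hC0, fun r' r h' h x h0 hx => hC r' r h' h x ⟨h0, hx⟩⟩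

theorem exists_leibniz_one_le (P : RadPoly 1) (ρ : Radius) (M : ℝ) :
    ∃ C : ℝ, 0 ≤ C ∧ ∀ r' r : Radius, ρ ≤ r' → ρ ≤ r → ∀ (k : ℕ) (a : ℕ → ℝ),
      (∀ j, 0 ≤ a j) → a (k / 2 + 1) ≤ M → leibniz P r' r ![k] ![a] ≤ C * a k := by
  obtain ⟨C, hC0, hC⟩ := P.exists_eval_le ρ M
  refine ⟨C, hC0, fun r' r h' h k a ha haM => ?_⟩
  have key := hC r' r h' h (fun i => (![a] : Fin 1 → ℕ → ℝ) i ((![k] : Fin 1 → ℕ) i / 2 + 1))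
    (by intro i; fin_cases i; exact ⟨ha _, haM⟩)
  have e : (∑ i, (![a] : Fin 1 → ℕ → ℝ) i ((![k] : Fin 1 → ℕ) i) *
      ∏ j ∈ Finset.univ.erase i, (![a] : Fin 1 → ℕ → ℝ) j ((![k] : Fin 1 → ℕ) j / 2 + 1)) = a k := by
    simp
  rw [leibniz, e, mul_comm]
  exact mul_le_mul_of_nonneg_right key (ha k)

theorem exists_leibniz_two_le (P : RadPoly 2) (ρ : Radius) (M : ℝ) :
    ∃ C : ℝ, 0 ≤ C ∧ ∀ r' r : Radius, ρ ≤ r' → ρ ≤ r → ∀ (k l : ℕ) (a b : ℕ → ℝ),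
      (∀ j, 0 ≤ a j) → (∀ j, 0 ≤ b j) → a (k / 2 + 1) ≤ M → b (l / 2 + 1) ≤ M →
      leibniz P r' r ![k, l] ![a, b] ≤ C * (a k * b (l / 2 + 1) + b l * a (k / 2 + 1)) := by
  obtain ⟨C, hC0, hC⟩ := P.exists_eval_le ρ M
  refine ⟨C, hC0, fun r' r h' h k l a b ha hb haM hbM => ?_⟩
  have key := hC r' r h' h
    (fun i => (![a, b] : Fin 2 → ℕ → ℝ) i ((![k, l] : Fin 2 → ℕ) i / 2 + 1))
    (by intro i; fin_cases i; exacts [⟨ha _, haM⟩, ⟨hb _, hbM⟩])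
  have e : (∑ i, (![a, b] : Fin 2 → ℕ → ℝ) i ((![k, l] : Fin 2 → ℕ) i) *
      ∏ j ∈ Finset.univ.erase i, (![a, b] : Fin 2 → ℕ → ℝ) j ((![k, l] : Fin 2 → ℕ) j / 2 + 1)) =
      a k * b (l / 2 + 1) + b l * a (k / 2 + 1) := by
    have h0 : (Finset.univ.erase (0 : Fin 2)) = {1} := by decide
    have h1 : (Finset.univ.erase (1 : Fin 2)) = {0} := by decide
    simp [Fin.sum_univ_two, h0, h1]
  rw [leibniz, e, mul_comm]
  exact mul_le_mul_of_nonneg_right key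
    (add_nonneg (mul_nonneg (ha _) (hb _)) (mul_nonneg (hb _) (ha _)))

theorem exists_leibniz_three_le (P : RadPoly 3) (ρ : Radius) (M : ℝ) :
    ∃ C : ℝ, 0 ≤ C ∧ ∀ r' r : Radius, ρ ≤ r' → ρ ≤ r → ∀ (k l m : ℕ) (a b c : ℕ → ℝ),
      (∀ j, 0 ≤ a j) → (∀ j, 0 ≤ b j) → (∀ j, 0 ≤ c j) →
      a (k / 2 + 1) ≤ M → b (l / 2 + 1) ≤ M → c (m / 2 + 1) ≤ M →
      leibniz P r' r ![k, l, m] ![a, b, c] ≤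
        C * (a k * (b (l / 2 + 1) * c (m / 2 + 1)) + b l * (a (k / 2 + 1) * c (m / 2 + 1)) +
          c m * (a (k / 2 + 1) * b (l / 2 + 1))) := by
  obtain ⟨C, hC0, hC⟩ := P.exists_eval_le ρ M
  refine ⟨C, hC0, fun r' r h' h k l m a b c ha hb hc haM hbM hcM => ?_⟩
  have key := hC r' r h' h
    (fun i => (![a, b, c] : Fin 3 → ℕ → ℝ) i ((![k, l, m] : Fin 3 → ℕ) i / 2 + 1))
    (by intro i; fin_cases i; exacts [⟨ha _, haM⟩, ⟨hb _, hbM⟩, ⟨hc _, hcM⟩])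
  have e : (∑ i, (![a, b, c] : Fin 3 → ℕ → ℝ) i ((![k, l, m] : Fin 3 → ℕ) i) *
      ∏ j ∈ Finset.univ.erase i,
        (![a, b, c] : Fin 3 → ℕ → ℝ) j ((![k, l, m] : Fin 3 → ℕ) j / 2 + 1)) =
      a k * (b (l / 2 + 1) * c (m / 2 + 1)) + b l * (a (k / 2 + 1) * c (m / 2 + 1)) +
          c m * (a (k / 2 + 1) * b (l / 2 + 1)) := by
    have h0 : (Finset.univ.erase (0 : Fin 3)) = {1, 2} := by decide
    have h1 : (Finset.univ.erase (1 : Fin 3)) = {0, 2} := by decide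
    have h2 : (Finset.univ.erase (2 : Fin 3)) = {0, 1} := by decide
    simp [Fin.sum_univ_three, h0, h1, h2]
  rw [leibniz, e, mul_comm]
  have ha1 := ha k; have ha2 := ha (k / 2 + 1); have hb1 := hb l; have hb2 := hb (l / 2 + 1)
  have hc1 := hc m; have hc2 := hc (m / 2 + 1)
  exact mul_le_mul_of_nonneg_right key (by positivity)

/-! ### Norms on scaled spaces -/

namespace SCISpace

variable (H : SCISpace.{u})

theorem nrm_nonneg (k : ℕ) (r : Radius) (f : H.carrier r) : 0 ≤ H.nrm k r f :=
  apply_nonneg _ _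

theorem nrm_le_nrm {k k' : ℕ} (h : k' ≤ k) (r : Radius) (f : H.carrier r) :
    H.nrm k' r f ≤ H.nrm k r f := by
  have := H.nrm_mono h (le_refl r) f
  rwa [H.res_refl] at this

theorem nrm_res_le (k : ℕ) {r r' : Radius} (h : r' ≤ r) (f : H.carrier r) :
    H.nrm k r' (H.res h f) ≤ H.nrm k r f :=
  H.nrm_mono le_rfl h f

/-- The smoothing estimates hold with a constant that is uniform over the radii which stay away
from `0`. -/
theorem exists_smooth_bound (ρ : Radius) {p q : ℕ} (hq : 0 < q) (hqp : q < p) :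
    ∃ C : ℝ, 0 ≤ C ∧ ∀ r : Radius, ρ ≤ r → ∀ t : ℝ, 1 < t → ∀ f : H.carrier r,
      H.nrm p r (H.smooth r t f) ≤ C * t ^ (p - q) * H.nrm q r f ∧
      H.nrm q r (f - H.smooth r t f) ≤ C * (t ^ (p - q))⁻¹ * H.nrm p r f := by
  obtain ⟨C, hC0, hC⟩ := H.smooth_bound p q hq hqp
  obtain ⟨D, hD⟩ := (Radius.isCompact_ge ρ).exists_bound_of_continuousOn C.continuous.continuousOn
  have hle : ∀ r : Radius, ρ ≤ r → C r ≤ |D| := fun r hr =>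
    (le_abs_self _).trans ((hD r hr).trans (le_abs_self D))
  refine ⟨|D|, abs_nonneg D, fun r hr t ht f => ⟨?_, ?_⟩⟩
  · refine (hC r t ht f).1.trans ?_
    have h1 : 0 < t := by linarith
    have := H.nrm_nonneg q r f
    gcongr
    exact hle r hr
  · refine (hC r t ht f).2.trans ?_
    have h1 : 0 < t := by linarith
    have := H.nrm_nonneg p r f
    gcongr
    exact hle r hr

/-- Additive form of the interpolation inequality between the degrees `q < m < p`. -/
theorem exists_interpolation (ρ : Radius) {p m q : ℕ} (hq : 0 < q) (hqm : q < m) (hmp : m < p) :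
    ∃ C : ℝ, 0 ≤ C ∧ ∀ r : Radius, ρ ≤ r → ∀ t : ℝ, 1 < t → ∀ f : H.carrier r,
      H.nrm m r f ≤ C * ((t ^ (p - m))⁻¹ * H.nrm p r f + t ^ (m - q) * H.nrm q r f) := by
  obtain ⟨C, hC0, hC⟩ := H.exists_smooth_bound ρ (hq.trans hqm) hmp
  obtain ⟨D, hD0, hD⟩ := H.exists_smooth_bound ρ hq hqm
  refine ⟨C + D, by positivity, fun r hr t ht f => ?_⟩
  have h1 := (hC r hr t ht f).2
  have h2 := (hD r hr t ht f).1
  have h3 : H.nrm m r f ≤ H.nrm m r (f - H.smooth r t f) + H.nrm m r (H.smooth r t f) := by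
    simpa using map_add_le_add (H.nrm m r) (f - H.smooth r t f) (H.smooth r t f)
  have h0 : 0 < t := by linarith
  have e1 : 0 ≤ (t ^ (p - m))⁻¹ * H.nrm p r f := mul_nonneg (by positivity) (H.nrm_nonneg _ _ _)
  have e2 : 0 ≤ t ^ (m - q) * H.nrm q r f := mul_nonneg (by positivity) (H.nrm_nonneg _ _ _)
  nlinarith [mul_nonneg hC0 e2, mul_nonneg hD0 e1]

end SCISpace

theorem exists_leibniz_two_le_mul (P : RadPoly 2) (ρ : Radius) (M : ℝ) :
    ∃ C : ℝ, 0 ≤ C ∧ ∀ r' r : Radius, ρ ≤ r' → ρ ≤ r → ∀ (k l : ℕ) (a b : ℕ → ℝ), 1 ≤ k → 1 ≤ l →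
      (∀ j, 0 ≤ a j) → (∀ j, 0 ≤ b j) → Monotone a → Monotone b →
      a (k / 2 + 1) ≤ M → b (l / 2 + 1) ≤ M →
      leibniz P r' r ![k, l] ![a, b] ≤ C * (a k * b l) := by
  obtain ⟨C, hC0, hC⟩ := exists_leibniz_two_le P ρ M
  refine ⟨2 * C, by positivity, fun r' r h' h k l a b hk hl ha hb ma mb haM hbM => ?_⟩
  refine (hC r' r h' h k l a b ha hb haM hbM).trans ?_
  have h1 : a (k / 2 + 1) ≤ a k := ma (by omega)
  have h2 : b (l / 2 + 1) ≤ b l := mb (by omega)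
  have h3 := mul_le_mul_of_nonneg_left h2 (ha k)
  have h4 := mul_le_mul_of_nonneg_left h1 (hb l)
  nlinarith [mul_le_mul_of_nonneg_left (add_le_add h3 h4) hC0]

theorem exists_leibniz_three_le_mul (P : RadPoly 3) (ρ : Radius) (M : ℝ) :
    ∃ C : ℝ, 0 ≤ C ∧ ∀ r' r : Radius, ρ ≤ r' → ρ ≤ r → ∀ (k l m : ℕ) (a b c : ℕ → ℝ),
      1 ≤ k → 1 ≤ l → 1 ≤ m → (∀ j, 0 ≤ a j) → (∀ j, 0 ≤ b j) → (∀ j, 0 ≤ c j) →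
      Monotone a → Monotone b → Monotone c →
      a (k / 2 + 1) ≤ M → b (l / 2 + 1) ≤ M → c (m / 2 + 1) ≤ M →
      leibniz P r' r ![k, l, m] ![a, b, c] ≤ C * (a k * b l * c m) := by
  obtain ⟨C, hC0, hC⟩ := exists_leibniz_three_le P ρ M
  refine ⟨3 * C, by positivity,
    fun r' r h' h k l m a b c hk hl hm ha hb hc ma mb mc haM hbM hcM => ?_⟩
  refine (hC r' r h' h k l m a b c ha hb hc haM hbM hcM).trans ?_
  have h1 : a (k / 2 + 1) ≤ a k := ma (by omega)
  have h2 : b (l / 2 + 1) ≤ b l := mb (by omega)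
  have h3 : c (m / 2 + 1) ≤ c m := mc (by omega)
  have e1 : a k * (b (l / 2 + 1) * c (m / 2 + 1)) ≤ a k * (b l * c m) :=
    mul_le_mul_of_nonneg_left (mul_le_mul h2 h3 (hc _) (hb _)) (ha _)
  have e2 : b l * (a (k / 2 + 1) * c (m / 2 + 1)) ≤ b l * (a k * c m) :=
    mul_le_mul_of_nonneg_left (mul_le_mul h1 h3 (hc _) (ha _)) (hb _)
  have e3 : c m * (a (k / 2 + 1) * b (l / 2 + 1)) ≤ c m * (a k * b l) :=
    mul_le_mul_of_nonneg_left (mul_le_mul h1 h2 (hb _) (ha _)) (hc _)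
  nlinarith [mul_le_mul_of_nonneg_left (add_le_add (add_le_add e1 e2) e3) hC0]

theorem SCISpace.nrm_monotone (H : SCISpace.{u}) (r : Radius) (f : H.carrier r) :
    Monotone fun j => H.nrm j r f := fun _ _ h => H.nrm_le_nrm h r f

/-! ### The estimates at radii away from zero -/

/-- The estimates of the normal form theorem with the Leibniz polynomials evaluated: the radii stay
above `ρ`, and the constants depend only on the degree `k` and on a bound `M` for the norms of low
degree `j`, or, in `quad`, for those arguments of the polynomial whose degree is unrestricted. The derivative losses are `s` and, for the action, `s'`. -/
structure TameEstimates {T : SCISpace.{u}} {F : SCISubspace T} (π : SCIProjection F)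
    (I : ∀ r, Set (T.carrier r)) {W : SCISpace.{v}} {G : SCIGroup W} (A : SCIAction G T)
    {G₀ : ∀ r, Set (W.carrier r)} {E : SCISpace.{w}} (V : ∀ r, I r → E.carrier r)
    (Φ : ∀ r, E.carrier r → G₀ r) (s s' m k₁ : ℕ) (δ : ℝ) (ρ : Radius) : Prop where
  zeta_le : ∀ k, k₁ ≤ k → ∀ M : ℝ, ∃ C : ℝ, 0 ≤ C ∧ ∀ j, k / 2 + 1 ≤ j → ∀ r, ρ ≤ r →
    ∀ ε : T.carrier r, T.nrm j r ε ≤ M → T.nrm k r (π.zeta r ε) ≤ C * T.nrm k r ε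
  V_le : ∀ k, k₁ ≤ k → ∀ M : ℝ, ∃ C : ℝ, 0 ≤ C ∧ ∀ j, (k + s) / 2 + 1 ≤ j → ∀ r, ρ ≤ r →
    ∀ ε : I r, T.nrm j r (π.zeta r ε) ≤ M → T.nrm j r (ε : T.carrier r) ≤ M →
    E.nrm k r (V r ε) ≤ C * (T.nrm (k + s) r (π.zeta r ε) +
      (1 + T.nrm (k + s) r (ε : T.carrier r)) * T.nrm j r (π.zeta r ε))
  Phi_le : ∀ k, k₁ ≤ k → ∀ M : ℝ, ∃ C : ℝ, 0 ≤ C ∧ ∀ j, (k + s) / 2 + 1 ≤ j → ∀ r, ρ ≤ r →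
    ∀ v : E.carrier r, E.nrm j r v ≤ M →
    W.nrm k r (Φ r v : W.carrier r) ≤ C * E.nrm (k + s) r v
  act_Phi_le : ∀ k, k₁ ≤ k → ∀ M : ℝ, ∃ C : ℝ, 0 ≤ C ∧ ∀ j, (k + s) / 2 + 1 ≤ j →
    ∀ r r', ρ ≤ r → ρ ≤ r' → ∀ (ε : I r) (v w : E.carrier r),
    Radius.Shrink A.c (W.nrm 1 r (Φ r v : W.carrier r)) r r' →
    Radius.Shrink A.c (W.nrm 1 r (Φ r w : W.carrier r)) r r' →
    E.nrm j r v ≤ M → E.nrm j r w ≤ M → T.nrm j r (ε : T.carrier r) ≤ M →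
    T.nrm k r' (A.act r r' (Φ r v) ε - A.act r r' (Φ r w) ε) ≤
      C * (E.nrm (k + s) r (v - w) * (1 + E.nrm (k + s) r v + E.nrm (k + s) r w +
        T.nrm (k + s) r (ε : T.carrier r)) +
        (E.nrm (k + s) r v + E.nrm (k + s) r w) ^ 2 * (1 + T.nrm (k + s) r (ε : T.carrier r)))
  act_sub_le : ∀ k, k₁ ≤ k → ∀ M : ℝ, ∃ C : ℝ, 0 ≤ C ∧ ∀ j, (k + s') / 2 + 1 ≤ j →
    ∀ r r', ρ ≤ r → ρ ≤ r' → ∀ (φ : W.carrier r) (f g : T.carrier r),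
    Radius.Shrink A.c (W.nrm 1 r φ) r r' → T.nrm j r (f - g) ≤ M → W.nrm j r φ ≤ M →
    T.nrm k r' (A.act r r' φ f - A.act r r' φ g) ≤
      C * (T.nrm k r (f - g) + (1 + W.nrm (k + s') r φ) * T.nrm j r (f - g))
  sub_act_le : ∀ k, k₁ ≤ k → ∀ M : ℝ, ∃ C : ℝ, 0 ≤ C ∧ ∀ j, (k + s') / 2 + 1 ≤ j →
    ∀ r r', ρ ≤ r → ρ ≤ r' → ∀ (ψ φ : W.carrier r) (f : T.carrier r),
    Radius.Shrink A.c (W.nrm 1 r ψ) r r' → Radius.Shrink A.c (W.nrm 1 r φ) r r' →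
    T.nrm j r f ≤ M → W.nrm j r (ψ - φ) ≤ M → W.nrm j r φ ≤ M →
    T.nrm k r' (A.act r r' ψ f - A.act r r' φ f) ≤
      C * ((1 + T.nrm (k + s') r f) * W.nrm (k + s') r (ψ - φ) * (1 + W.nrm (k + s') r φ))
  quad : ∀ k, k₁ ≤ k → ∀ M : ℝ, ∃ C : ℝ, 0 ≤ C ∧ ∀ r r', ρ ≤ r → ρ ≤ r' → ∀ ε : I r,
    Radius.Shrink A.c (W.nrm 1 r (Φ r (V r ε) : W.carrier r)) r r' →
    T.nrm k r (ε : T.carrier r) ≤ M → W.nrm (k + s) r (Φ r (V r ε) : W.carrier r) ≤ M →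
    T.nrm (k + s) r (π.zeta r ε) ≤ M →
    T.nrm k r' (π.zeta r' (A.act r r' (Φ r (V r ε)) ε)) ≤
      C * (T.nrm (k + s) r (π.zeta r ε) ^ (1 + δ) *
        (1 + T.nrm (k + s) r (ε : T.carrier r)) ^ m)

theorem exists_tameEstimates
    (T : SCISpace.{u}) (F : SCISubspace T)
    (I : ∀ r, Set (T.carrier r))
    (π : SCIProjection F)
    (h_zeta : ∀ᶠ k : ℕ in atTop, ∃ P : RadPoly 1, ∀ (r : Radius) (ε : T.carrier r),
      T.nrm k r (π.zeta r ε) ≤ leibniz P r r ![k] ![fun j => T.nrm j r ε])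
    (W : SCISpace.{v}) (G : SCIGroup W) (A : SCIAction G T)
    (G₀ : ∀ r, Set (W.carrier r))
    (E : SCISpace.{w})
    (V : ∀ r, I r → E.carrier r) (Φ : ∀ r, E.carrier r → G₀ r) (s : ℕ)
    (h_V : ∀ᶠ k : ℕ in atTop, ∃ P : RadPoly 2, ∀ (r : Radius) (ε : I r),
      E.nrm k r (V r ε) ≤ leibniz P r r ![k + s, k + s]
        ![fun j => T.nrm j r (π.zeta r ε), fun j => 1 + T.nrm j r (ε : T.carrier r)])
    (h_Phi : ∀ᶠ k : ℕ in atTop, ∃ P : RadPoly 1, ∀ (r : Radius) (v : E.carrier r),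
      W.nrm k r (Φ r v : W.carrier r) ≤ leibniz P r r ![k + s] ![fun j => E.nrm j r v])
    (h_act : ∀ᶠ k : ℕ in atTop, ∃ P Q : RadPoly 2, ∀ (r r' : Radius) (ε : I r)
      (v w : E.carrier r),
      Radius.Shrink A.c (W.nrm 1 r (Φ r v : W.carrier r)) r r' →
      Radius.Shrink A.c (W.nrm 1 r (Φ r w : W.carrier r)) r r' →
      T.nrm k r' (A.act r r' (Φ r v) ε - A.act r r' (Φ r w) ε) ≤
        leibniz P r' r ![k + s, k + s] ![fun j => E.nrm j r (v - w),
          fun j => 1 + E.nrm j r v + E.nrm j r w + T.nrm j r (ε : T.carrier r)] +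
        leibniz Q r' r ![k + s, k + s] ![fun j => (E.nrm j r v + E.nrm j r w) ^ 2,
          fun j => 1 + T.nrm j r (ε : T.carrier r)])
    (δ : ℝ)
    (h_quad : ∃ m : ℕ, ∀ᶠ k : ℕ in atTop, ∃ P : RadPoly 4, P.poly.degreeOf 0 ≤ m ∧
      ∀ (r r' : Radius) (ε : I r),
        Radius.Shrink A.c (W.nrm 1 r (Φ r (V r ε) : W.carrier r)) r r' →
        T.nrm k r' (π.zeta r' (A.act r r' (Φ r (V r ε)) ε)) ≤
          T.nrm (k + s) r (π.zeta r ε) ^ (1 + δ) *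
            P.eval r' r ![T.nrm (k + s) r (ε : T.carrier r),
              W.nrm (k + s) r (Φ r (V r ε) : W.carrier r),
              T.nrm (k + s) r (π.zeta r ε), T.nrm k r (ε : T.carrier r)]) :
    ∃ s' m k₁ : ℕ, 1 ≤ k₁ ∧ ∀ ρ : Radius, TameEstimates π I A V Φ s s' m k₁ δ ρ := by
  obtain ⟨s', h_bounds⟩ := A.bounds
  obtain ⟨m, h_quad⟩ := h_quad
  obtain ⟨k₁, hk₁⟩ := eventually_atTop.1 (h_zeta.and (h_V.and (h_Phi.and (h_act.and
    (h_bounds.and (h_quad.and (eventually_ge_atTop 1)))))))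
  refine ⟨s', m, k₁, (hk₁ k₁ le_rfl).2.2.2.2.2.2, fun ρ => ⟨?_, ?_, ?_, ?_, ?_, ?_, ?_⟩⟩
  · intro k hk M
    obtain ⟨P, hP⟩ := (hk₁ k hk).1
    obtain ⟨C, hC0, hC⟩ := exists_leibniz_one_le P ρ M
    refine ⟨C, hC0, fun j hj r hr ε hε => (hP r ε).trans ?_⟩
    exact hC r r hr hr k _ (fun j => T.nrm_nonneg j r ε) ((T.nrm_le_nrm hj r ε).trans hε)
  · intro k hk M
    obtain ⟨P, hP⟩ := (hk₁ k hk).2.1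
    obtain ⟨C, hC0, hC⟩ := exists_leibniz_two_le P ρ (1 + |M|)
    refine ⟨C * (1 + |M|), by positivity, fun j hj r hr ε hz hε => (hP r ε).trans ?_⟩
    have hM := le_abs_self M
    have hM' := abs_nonneg M
    have hz' := T.nrm_le_nrm hj r (π.zeta r ε)
    have hx' := T.nrm_le_nrm hj r (ε : T.carrier r)
    refine (hC r r hr hr (k + s) (k + s) _ _ (fun j => T.nrm_nonneg j r _)
      (fun j => add_nonneg zero_le_one (T.nrm_nonneg j r _)) ?_ ?_).trans ?_
    · show T.nrm _ _ _ ≤ _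
      linarith
    · show 1 + T.nrm _ _ _ ≤ _
      linarith
    · show C * (T.nrm (k + s) r (π.zeta r ε) * (1 + T.nrm ((k + s) / 2 + 1) r (ε : T.carrier r)) +
        (1 + T.nrm (k + s) r (ε : T.carrier r)) * T.nrm ((k + s) / 2 + 1) r (π.zeta r ε)) ≤ _
      have h1 := T.nrm_nonneg (k + s) r (π.zeta r ε)
      have h2 := T.nrm_nonneg (k + s) r (ε : T.carrier r)
      have h3 := T.nrm_nonneg j r (π.zeta r ε)
      rw [mul_assoc]
      refine mul_le_mul_of_nonneg_left ?_ hC0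
      rw [mul_add (1 + |M|)]
      refine add_le_add ?_ ?_
      · rw [mul_comm (1 + |M|)]
        exact mul_le_mul_of_nonneg_left (by linarith) h1
      · calc _ ≤ (1 + T.nrm (k + s) r (ε : T.carrier r)) * T.nrm j r (π.zeta r ε) :=
              mul_le_mul_of_nonneg_left hz' (by linarith)
          _ ≤ _ := le_mul_of_one_le_left (by positivity) (by linarith)
  · intro k hk M
    obtain ⟨P, hP⟩ := (hk₁ k hk).2.2.1
    obtain ⟨C, hC0, hC⟩ := exists_leibniz_one_le P ρ M
    refine ⟨C, hC0, fun j hj r hr v hv => (hP r v).trans ?_⟩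
    exact hC r r hr hr (k + s) _ (fun j => E.nrm_nonneg j r v) ((E.nrm_le_nrm hj r v).trans hv)
  · intro k hk M
    have hk0 : 1 ≤ k := (hk₁ k hk).2.2.2.2.2.2
    obtain ⟨P, Q, hPQ⟩ := (hk₁ k hk).2.2.2.1
    obtain ⟨C, hC0, hC⟩ := exists_leibniz_two_le_mul P ρ (1 + 3 * |M|)
    obtain ⟨D, hD0, hD⟩ := exists_leibniz_two_le_mul Q ρ (1 + |M| + (2 * |M|) ^ 2)
    refine ⟨C + D, by positivity,
      fun j hj r r' hr hr' ε v w hv hw hvM hwM hεM => (hPQ r r' ε v w hv hw).trans ?_⟩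
    have hM := le_abs_self M
    have hM' := abs_nonneg M
    have nv := fun j => E.nrm_nonneg j r v
    have nw := fun j => E.nrm_nonneg j r w
    have nvw := fun j => E.nrm_nonneg j r (v - w)
    have nε := fun j => T.nrm_nonneg j r (ε : T.carrier r)
    have mv := E.nrm_monotone r v
    have mw := E.nrm_monotone r w
    have mε := T.nrm_monotone r (ε : T.carrier r)
    have lv : E.nrm ((k + s) / 2 + 1) r v ≤ |M| := (mv hj).trans (hvM.trans hM)
    have lw : E.nrm ((k + s) / 2 + 1) r w ≤ |M| := (mw hj).trans (hwM.trans hM)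
    have lε : T.nrm ((k + s) / 2 + 1) r (ε : T.carrier r) ≤ |M| := (mε hj).trans (hεM.trans hM)
    have b1 := hC r' r hr' hr (k + s) (k + s) (fun j => E.nrm j r (v - w))
      (fun j => 1 + E.nrm j r v + E.nrm j r w + T.nrm j r (ε : T.carrier r))
      (by omega) (by omega) nvw (fun j => by linarith [nv j, nw j, nε j])
      (E.nrm_monotone r (v - w))
      (fun a b hab => by
        have h1 := mv hab; have h2 := mw hab; have h3 := mε hab
        simp only at h1 h2 h3 ⊢
        linarith)
      (by
        have := map_sub_le_add (E.nrm ((k + s) / 2 + 1) r) v w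
        show E.nrm ((k + s) / 2 + 1) r (v - w) ≤ _
        linarith)
      (by linarith)
    have b2 := hD r' r hr' hr (k + s) (k + s) (fun j => (E.nrm j r v + E.nrm j r w) ^ 2)
      (fun j => 1 + T.nrm j r (ε : T.carrier r))
      (by omega) (by omega) (fun j => sq_nonneg _) (fun j => by linarith [nε j])
      (fun a b hab => pow_le_pow_left₀ (add_nonneg (nv a) (nw a)) (add_le_add (mv hab) (mw hab)) 2)
      (fun a b hab => by
        have h3 := mε hab
        simp only at h3 ⊢
        linarith)
      (by
        have := pow_le_pow_left₀ (add_nonneg (nv ((k + s) / 2 + 1)) (nw ((k + s) / 2 + 1)))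
          (show _ ≤ 2 * |M| by linarith) 2
        linarith)
      (by
        have := sq_nonneg (2 * |M|)
        linarith)
    have p1 : 0 ≤ E.nrm (k + s) r (v - w) * (1 + E.nrm (k + s) r v + E.nrm (k + s) r w +
        T.nrm (k + s) r (ε : T.carrier r)) :=
      mul_nonneg (nvw _) (by linarith [nv (k + s), nw (k + s), nε (k + s)])
    have p2 : 0 ≤ (E.nrm (k + s) r v + E.nrm (k + s) r w) ^ 2 *
        (1 + T.nrm (k + s) r (ε : T.carrier r)) :=
      mul_nonneg (sq_nonneg _) (by linarith [nε (k + s)])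
    linarith [mul_nonneg hC0 p2, mul_nonneg hD0 p1]
  · intro k hk M
    obtain ⟨P, hP⟩ := (hk₁ k hk).2.2.2.2.1.1
    obtain ⟨C, hC0, hC⟩ := exists_leibniz_two_le P ρ (1 + |M|)
    refine ⟨C * (1 + |M|), by positivity,
      fun j hj r r' hr hr' φ f g hφ hf hφM => (hP r r' φ f g hφ).trans ?_⟩
    have hM := le_abs_self M
    have hM' := abs_nonneg M
    have hf' := T.nrm_le_nrm (show k / 2 + 1 ≤ j by omega) r (f - g)
    have hφ' := W.nrm_le_nrm hj r φ
    refine (hC r' r hr' hr k (k + s') _ _ (fun j => T.nrm_nonneg j r _)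
      (fun j => add_nonneg zero_le_one (W.nrm_nonneg j r _)) ?_ ?_).trans ?_
    · show T.nrm _ _ _ ≤ _
      linarith
    · show 1 + W.nrm _ _ _ ≤ _
      linarith
    · show C * (T.nrm k r (f - g) * (1 + W.nrm ((k + s') / 2 + 1) r φ) +
        (1 + W.nrm (k + s') r φ) * T.nrm (k / 2 + 1) r (f - g)) ≤ _
      have h1 := T.nrm_nonneg k r (f - g)
      have h2 := W.nrm_nonneg (k + s') r φ
      have h3 := T.nrm_nonneg j r (f - g)
      rw [mul_assoc]
      refine mul_le_mul_of_nonneg_left ?_ hC0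
      rw [mul_add (1 + |M|)]
      refine add_le_add ?_ ?_
      · rw [mul_comm (1 + |M|)]
        exact mul_le_mul_of_nonneg_left (by linarith) h1
      · calc _ ≤ (1 + W.nrm (k + s') r φ) * T.nrm j r (f - g) :=
              mul_le_mul_of_nonneg_left hf' (by linarith)
          _ ≤ _ := le_mul_of_one_le_left (by positivity) (by linarith)
  · intro k hk M
    have hk0 : 1 ≤ k := (hk₁ k hk).2.2.2.2.2.2
    obtain ⟨P, hP⟩ := (hk₁ k hk).2.2.2.2.1.2
    obtain ⟨C, hC0, hC⟩ := exists_leibniz_three_le_mul P ρ (1 + |M|)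
    refine ⟨C, hC0, fun j hj r r' hr hr' ψ φ f hψ hφ hfM hdM hφM =>
      (hP r r' ψ φ f hψ hφ).trans ?_⟩
    have hM := le_abs_self M
    have hM' := abs_nonneg M
    have mf := T.nrm_monotone r f
    have mφ := W.nrm_monotone r φ
    have md := W.nrm_monotone r (ψ - φ)
    have lf := mf hj; have lφ := mφ hj; have ld := md hj
    simp only at lf lφ ld
    exact hC r' r hr' hr (k + s') (k + s') (k + s') (fun j => 1 + T.nrm j r f)
      (fun j => W.nrm j r (ψ - φ)) (fun j => 1 + W.nrm j r φ) (by omega) (by omega) (by omega)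
      (fun j => add_nonneg zero_le_one (T.nrm_nonneg _ _ _)) (fun j => W.nrm_nonneg _ _ _)
      (fun j => add_nonneg zero_le_one (W.nrm_nonneg _ _ _))
      (fun a b hab => add_le_add le_rfl (mf hab)) md (fun a b hab => add_le_add le_rfl (mφ hab))
      (by linarith) (by linarith) (by linarith)
  · intro k hk M
    obtain ⟨P, hPm, hP⟩ := (hk₁ k hk).2.2.2.2.2.1
    obtain ⟨C, hC0, hC⟩ := P.exists_eval_le_pow ρ M hPm
    refine ⟨C, hC0, fun r r' hr hr' ε hΦ hεM hΦM hzM => (hP r r' ε hΦ).trans ?_⟩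
    have key := hC r' r hr' hr ![T.nrm (k + s) r (ε : T.carrier r),
              W.nrm (k + s) r (Φ r (V r ε) : W.carrier r),
              T.nrm (k + s) r (π.zeta r ε), T.nrm k r (ε : T.carrier r)]
      (T.nrm_nonneg _ _ _) (by
        intro i
        fin_cases i
        exacts [⟨W.nrm_nonneg _ _ _, hΦM⟩, ⟨T.nrm_nonneg _ _ _, hzM⟩, ⟨T.nrm_nonneg _ _ _, hεM⟩])
    refine (mul_le_mul_of_nonneg_left key (Real.rpow_nonneg (T.nrm_nonneg _ _ _) _)).trans
      (le_of_eq ?_)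
    simp only [Matrix.cons_val_zero]
    ring

/-! ### One step of the iteration -/

theorem Radius.le_of_shrink {c x : ℝ} (hc : 0 ≤ c) (hx : 0 ≤ x) {r r' : Radius}
    (h : Radius.Shrink c x r r') : r' ≤ r := by
  have h1 : (r' : ℝ) ≤ (r : ℝ) * (1 - c * x) := h
  have h2 : 0 ≤ (r : ℝ) * (c * x) := mul_nonneg r.2.1.le (mul_nonneg hc hx)
  have h3 : (r' : ℝ) ≤ r := by linarith
  exact h3

theorem Radius.shrink_zero (c : ℝ) {r r' : Radius} (h : r' ≤ r) : Radius.Shrink c 0 r r' := by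
  have h3 : (r' : ℝ) ≤ r := h
  show (r' : ℝ) ≤ (r : ℝ) * (1 - c * 0)
  simpa using h3

namespace SCISpace

/-- Interpolation between a low degree `k`, in which `f` is of size `t ^ (-b)`, and a much higher
degree `K`, in which `f` is of size `t ^ a`: raising the degree `k` by a fixed amount `j` costs
only a small power of `t`. -/
theorem exists_nrm_add_le (H : SCISpace.{u}) (ρ : Radius) {k j K : ℕ} {a ν : ℝ} (hk : 0 < k)
    (hj : 0 < j) (hK : k + j < K) (hν : 0 < ν)
    (hgap : (a + 2) * j ≤ ν * ((K - (k + j) : ℕ) : ℝ)) :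
    ∃ C : ℝ, 0 ≤ C ∧ ∀ r, ρ ≤ r → ∀ t : ℝ, 1 < t → ∀ b : ℝ, b ≤ 2 → ∀ (M : ℝ) (f : H.carrier r),
      0 ≤ M → H.nrm k r f ≤ M * t ^ (-b) → H.nrm K r f ≤ M * t ^ a →
      H.nrm (k + j) r f ≤ C * M * t ^ (ν - b) := by
  obtain ⟨C, hC0, hC⟩ := H.exists_interpolation ρ hk (show k < k + j by omega) hK
  refine ⟨C * 2, by positivity, fun r hr t ht b hb M f hM h1 h2 => ?_⟩
  have ht0 : 0 < t := by linarith
  have hj0 : (0 : ℝ) < j := by exact_mod_cast hj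
  -- the interpolation parameter `τ` is chosen with `τ ^ j = t ^ ν`
  set τ : ℝ := t ^ (ν / j) with hτ
  have hτ1 : 1 < τ := Real.one_lt_rpow ht (by positivity)
  have hτ0 : 0 < τ := by linarith
  have e1 : τ ^ (k + j - k) = t ^ ν := by
    rw [Nat.add_sub_cancel_left, hτ, ← Real.rpow_natCast, ← Real.rpow_mul ht0.le,
      div_mul_cancel₀ _ hj0.ne']
  have e2 : (τ ^ (K - (k + j)))⁻¹ ≤ t ^ (-(a + 2)) := by
    rw [hτ, ← Real.rpow_natCast, ← Real.rpow_mul ht0.le, ← Real.rpow_neg ht0.le]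
    refine Real.rpow_le_rpow_of_exponent_le ht.le (neg_le_neg ?_)
    rw [div_mul_eq_mul_div, le_div_iff₀ hj0]
    exact hgap
  refine (hC r hr τ hτ1 f).trans ?_
  rw [mul_assoc C, mul_assoc C]
  refine mul_le_mul_of_nonneg_left ?_ hC0
  have p1 : (τ ^ (K - (k + j)))⁻¹ * H.nrm K r f ≤ t ^ (-(a + 2)) * (M * t ^ a) :=
    mul_le_mul e2 h2 (H.nrm_nonneg _ _ _) (by positivity)
  have p2 : t ^ (-(a + 2)) * (M * t ^ a) ≤ M * t ^ (ν - b) := by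
    have : t ^ (-(a + 2)) * (M * t ^ a) = M * t ^ (-2 : ℝ) := by
      rw [mul_left_comm, ← Real.rpow_add ht0]; ring_nf
    rw [this]
    exact mul_le_mul_of_nonneg_left
      (Real.rpow_le_rpow_of_exponent_le ht.le (by linarith)) hM
  have p3 : τ ^ (k + j - k) * H.nrm k r f ≤ M * t ^ (ν - b) := by
    rw [e1]
    calc t ^ ν * H.nrm k r f ≤ t ^ ν * (M * t ^ (-b)) := by gcongr
      _ = M * t ^ (ν - b) := by rw [mul_left_comm, ← Real.rpow_add ht0]; ring_nf
  linarith

end SCISpace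

namespace TameEstimates

variable {T : SCISpace.{u}} {F : SCISubspace T} {π : SCIProjection F}
    {I : ∀ r, Set (T.carrier r)} {W : SCISpace.{v}} {G : SCIGroup W} {A : SCIAction G T}
    {G₀ : ∀ r, Set (W.carrier r)} {E : SCISpace.{w}} {V : ∀ r, I r → E.carrier r}
    {Φ : ∀ r, E.carrier r → G₀ r} {s s' m k₁ : ℕ} {δ : ℝ} {ρ : Radius}

/-- At the price of `2 s + 1` degrees, bounds on `ε` and on its error bound the smoothed correction
and its group element independently of `t`; no interpolation is needed. -/
theorem exists_low_bound (H : TameEstimates π I A V Φ s s' m k₁ δ ρ) {n : ℕ} (hn : k₁ ≤ n)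
    (hn1 : 1 ≤ n) (M : ℝ) :
    ∃ C : ℝ, 0 ≤ C ∧ ∀ r, ρ ≤ r → ∀ t : ℝ, 1 < t → ∀ ε : I r,
      T.nrm (n + 2 * s + 1) r (ε : T.carrier r) ≤ M →
      T.nrm (n + 2 * s + 1) r (π.zeta r ε) ≤ M →
      E.nrm (n + s) r (E.smooth r t (V r ε)) ≤ C ∧
      W.nrm n r (Φ r (E.smooth r t (V r ε)) : W.carrier r) ≤ C := by
  obtain ⟨C₁, hC₁0, hC₁⟩ := H.V_le (n + s + 1) (by omega) M
  obtain ⟨C₂, hC₂0, hC₂⟩ := E.exists_smooth_bound ρ (show 0 < n + s by omega)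
    (show n + s < n + s + 1 by omega)
  set D₁ : ℝ := C₁ * (|M| + (1 + |M|) * |M|) with hD₁
  have hD₁0 : 0 ≤ D₁ := by positivity
  set D₂ : ℝ := D₁ + C₂ * D₁ with hD₂
  have hD₂0 : 0 ≤ D₂ := by positivity
  obtain ⟨C₃, hC₃0, hC₃⟩ := H.Phi_le n hn D₂
  refine ⟨D₂ + C₃ * D₂, by positivity, fun r hr t ht ε hx hz => ?_⟩
  have hM := le_abs_self M
  have hv : E.nrm (n + s + 1) r (V r ε) ≤ D₁ := by
    have e : n + s + 1 + s = n + 2 * s + 1 := by ring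
    have := hC₁ (n + 2 * s + 1) (by omega) r hr ε hz hx
    rw [e] at this
    refine this.trans (mul_le_mul_of_nonneg_left ?_ hC₁0)
    have hz0 := T.nrm_nonneg (n + 2 * s + 1) r (π.zeta r ε)
    refine add_le_add (hz.trans hM) (mul_le_mul ?_ (hz.trans hM) hz0 (by positivity))
    linarith
  have hw : E.nrm (n + s) r (E.smooth r t (V r ε)) ≤ D₂ := by
    have h1 := (hC₂ r hr t ht (V r ε)).2
    have h2 : (t ^ (n + s + 1 - (n + s)))⁻¹ ≤ 1 := inv_le_one_of_one_le₀ (one_le_pow₀ ht.le)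
    have h3 : E.nrm (n + s) r (E.smooth r t (V r ε)) ≤ E.nrm (n + s) r (V r ε) +
        E.nrm (n + s) r (V r ε - E.smooth r t (V r ε)) := by
      simpa using map_sub_le_add (E.nrm (n + s) r) (V r ε) (V r ε - E.smooth r t (V r ε))
    have h4 := E.nrm_le_nrm (show n + s ≤ n + s + 1 by omega) r (V r ε)
    have h5 : C₂ * (t ^ (n + s + 1 - (n + s)))⁻¹ * E.nrm (n + s + 1) r (V r ε) ≤ C₂ * 1 * D₁ := by
      gcongr
    linarith
  have hφ := hC₃ (n + s) (by omega) r hr _ hw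
  have := mul_le_mul_of_nonneg_left hw hC₃0
  constructor
  · linarith [mul_nonneg hC₃0 hD₂0]
  · linarith

/-- In a fixed high degree `K = N + s` the norm grows in one step at most by a factor which is a
fixed power of the smoothing parameter. -/
theorem exists_high_bound (H : TameEstimates π I A V Φ s s' m k₁ δ ρ) {n N : ℕ} (hn : k₁ ≤ n)
    (hn1 : 1 ≤ n) (hN : k₁ ≤ N) (hN1 : 1 ≤ N) (hNn : (N + s + s' + s) / 2 + 1 ≤ n) (M : ℝ) :
    ∃ C : ℝ, 0 ≤ C ∧ ∀ r r', ρ ≤ r → ρ ≤ r' → ∀ t : ℝ, 1 < t → ∀ ε : I r,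
      T.nrm (n + 2 * s + 1) r (ε : T.carrier r) ≤ M →
      T.nrm (n + 2 * s + 1) r (π.zeta r ε) ≤ M →
      Radius.Shrink A.c (W.nrm 1 r (Φ r (E.smooth r t (V r ε)) : W.carrier r)) r r' →
      1 + T.nrm (N + s) r' (A.act r r' (Φ r (E.smooth r t (V r ε))) ε) ≤
        C * t ^ (2 * s + s' + 1) * (1 + T.nrm (N + s) r (ε : T.carrier r)) := by
  obtain ⟨L, hL0, hL⟩ := H.exists_low_bound hn hn1 M
  obtain ⟨C₀, hC₀0, hC₀⟩ := H.zeta_le (N + s) (by omega) M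
  obtain ⟨C₁, hC₁0, hC₁⟩ := H.V_le N hN M
  obtain ⟨C₂, hC₂0, hC₂⟩ := E.exists_smooth_bound ρ (show 0 < N by omega)
    (show N < N + (2 * s + s' + 1) by omega)
  obtain ⟨C₃, hC₃0, hC₃⟩ := H.Phi_le (N + s + s') (by omega) L
  obtain ⟨C₄, hC₄0, hC₄⟩ := H.act_sub_le (N + s) (by omega) (max M L)
  obtain ⟨C₅, hC₅0, hC₅⟩ := H.sub_act_le (N + s) (by omega) L
  set D₁ : ℝ := C₁ * (C₀ + |M|)
  have hD₁0 : 0 ≤ D₁ := by positivity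
  set D₃ : ℝ := C₃ * (C₂ * D₁)
  have hD₃0 : 0 ≤ D₃ := by positivity
  refine ⟨1 + C₄ * (1 + (1 + D₃) * |M|) + C₅ * D₃, by positivity,
    fun r r' hr hr' t ht ε hx hz hsh => ?_⟩
  have hM := le_abs_self M
  have ht0 : 0 < t := by linarith
  obtain ⟨hwL, hφL⟩ := hL r hr t ht ε hx hz
  set w := E.smooth r t (V r ε) with hw
  set φ : W.carrier r := (Φ r w : W.carrier r) with hφ
  set X := T.nrm (N + s) r (ε : T.carrier r) with hX
  have hX0 : 0 ≤ X := T.nrm_nonneg _ _ _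
  set S : ℝ := t ^ (2 * s + s' + 1) with hS
  have hS1 : 1 ≤ S := one_le_pow₀ ht.le
  have hzK : T.nrm (N + s) r (π.zeta r ε) ≤ C₀ * X := hC₀ (n + 2 * s + 1) (by omega) r hr ε hx
  have hv : E.nrm N r (V r ε) ≤ D₁ * (1 + X) := by
    refine (hC₁ (n + 2 * s + 1) (by omega) r hr ε hz hx).trans ?_
    rw [show D₁ * (1 + X) = C₁ * ((C₀ + |M|) * (1 + X)) by simp only [D₁]; ring]
    refine mul_le_mul_of_nonneg_left ?_ hC₁0
    have h1 : (1 + X) * T.nrm (n + 2 * s + 1) r (π.zeta r ε) ≤ (1 + X) * |M| := by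
      gcongr; exact hz.trans hM
    linarith
  have hwK : E.nrm (N + s + s' + s) r w ≤ C₂ * S * (D₁ * (1 + X)) := by
    have h1 := (hC₂ r hr t ht (V r ε)).1
    rw [Nat.add_sub_cancel_left] at h1
    refine (E.nrm_le_nrm (by omega) r w).trans (h1.trans ?_)
    gcongr
  have hφK : W.nrm (N + s + s') r φ ≤ D₃ * (S * (1 + X)) := by
    refine (hC₃ (n + s) (by omega) r hr w hwL).trans ?_
    rw [show D₃ * (S * (1 + X)) = C₃ * (C₂ * S * (D₁ * (1 + X))) by simp only [D₃]; ring]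
    exact mul_le_mul_of_nonneg_left hwK hC₃0
  have hP : 1 + X ≤ S * (1 + X) := le_mul_of_one_le_left (by linarith) hS1
  have hxn : T.nrm n r (ε : T.carrier r) ≤ M := (T.nrm_le_nrm (by omega) r _).trans hx
  -- the action need not fix `0`, so `φ · ε` is compared with `φ · 0`, and `φ · 0` with `Id · 0`
  have h4 : T.nrm (N + s) r' (A.act r r' φ ε - A.act r r' φ 0) ≤
      C₄ * (1 + (1 + D₃) * |M|) * (S * (1 + X)) := by
    have h := hC₄ n (by omega) r r' hr hr' φ ε 0 hsh
      (by rw [sub_zero]; exact hxn.trans (le_max_left _ _)) (hφL.trans (le_max_right _ _))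
    rw [sub_zero] at h
    refine h.trans ?_
    rw [mul_assoc]
    refine mul_le_mul_of_nonneg_left ?_ hC₄0
    have h1 : (1 + W.nrm (N + s + s') r φ) * T.nrm n r (ε : T.carrier r) ≤
        (S * (1 + X) + D₃ * (S * (1 + X))) * |M| := by
      refine mul_le_mul (by linarith) (hxn.trans hM) (T.nrm_nonneg _ _ _) (by positivity)
    linarith
  have hr'r : r' ≤ r := Radius.le_of_shrink (by linarith [A.one_lt_c]) (W.nrm_nonneg _ _ _) hsh
  have h5 : T.nrm (N + s) r' (A.act r r' φ 0) ≤ C₅ * D₃ * (S * (1 + X)) := by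
    have h := hC₅ n (by omega) r r' hr hr' φ 0 0 hsh
      (by rw [map_zero]; exact Radius.shrink_zero _ hr'r)
      (by rw [map_zero]; exact hL0) (by rw [sub_zero]; exact hφL) (by rw [map_zero]; exact hL0)
    rw [A.one_act hr'r, map_zero, sub_zero, sub_zero, map_zero, map_zero] at h
    refine h.trans ?_
    rw [mul_assoc C₅ D₃]
    refine mul_le_mul_of_nonneg_left ?_ hC₅0
    linarith
  have h6 : T.nrm (N + s) r' (A.act r r' φ ε) ≤
      T.nrm (N + s) r' (A.act r r' φ ε - A.act r r' φ 0) + T.nrm (N + s) r' (A.act r r' φ 0) := by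
    simpa using map_add_le_add (T.nrm (N + s) r') (A.act r r' φ ε - A.act r r' φ 0)
      (A.act r r' φ 0)
  nlinarith

end TameEstimates

namespace TameEstimates

variable {T : SCISpace.{u}} {F : SCISubspace T} {π : SCIProjection F}
    {I : ∀ r, Set (T.carrier r)} {W : SCISpace.{v}} {G : SCIGroup W} {A : SCIAction G T}
    {G₀ : ∀ r, Set (W.carrier r)} {E : SCISpace.{w}} {V : ∀ r, I r → E.carrier r}
    {Φ : ∀ r, E.carrier r → G₀ r} {s s' m k₁ : ℕ} {δ : ℝ} {ρ : Radius}

/-- Consequences of interpolation: in degrees slightly above `k`, the element `ε` is of size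
`t ^ ν`, its error `ζ ε` and the correction `V ε` are of size `t ^ (ν - 1)`, and smoothing changes
the correction by `t ^ (-2)` only. -/
theorem exists_interpolated_bound (H : TameEstimates π I A V Φ s s' m k₁ δ ρ) {k q N : ℕ}
    {a ν : ℝ} (hk : k₁ ≤ k) (hq1 : 1 ≤ q) (hkq : k < q + s) (hq : k₁ ≤ q)
    (hqN : q < N) (hqk : (q + s) / 2 + 1 ≤ k) (hNk : (N + s) / 2 + 1 ≤ k) (ha : 0 ≤ a)
    (hν : 0 < ν) (hν1 : ν ≤ 1)
    (hgap : (a + 2) * ((q + s - k : ℕ) : ℝ) ≤ ν * ((N - q : ℕ) : ℝ)) (M : ℝ) :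
    ∃ C : ℝ, 0 ≤ C ∧ ∀ r, ρ ≤ r → ∀ t : ℝ, 1 < t → ∀ ε : I r,
      T.nrm k r (ε : T.carrier r) ≤ M → T.nrm k r (π.zeta r ε) ≤ M * t⁻¹ →
      1 + T.nrm (N + s) r (ε : T.carrier r) ≤ M * t ^ a →
      T.nrm (q + s) r (ε : T.carrier r) ≤ C * t ^ ν ∧
      T.nrm (q + s) r (π.zeta r ε) ≤ C * t ^ (ν - 1) ∧
      E.nrm q r (V r ε) ≤ C * t ^ (ν - 1) ∧
      E.nrm q r (V r ε - E.smooth r t (V r ε)) ≤ C * t ^ (-2 : ℝ) := by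
  have hgapN : a + 2 ≤ ((N - q : ℕ) : ℝ) := by
    have h1 : (1 : ℝ) ≤ ((q + s - k : ℕ) : ℝ) := by exact_mod_cast (by omega : 1 ≤ q + s - k)
    have h2 : (0 : ℝ) ≤ ((N - q : ℕ) : ℝ) := by positivity
    nlinarith
  obtain ⟨Ci, hCi0, hCi⟩ := T.exists_nrm_add_le ρ (k := k) (j := q + s - k) (K := N + s)
    (a := a) (ν := ν) (by omega) (by omega) (by omega) hν
    (by rw [show N + s - (k + (q + s - k)) = N - q by omega]; exact hgap)
  rw [show k + (q + s - k) = q + s by omega] at hCi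
  obtain ⟨C₀, hC₀0, hC₀⟩ := H.zeta_le (N + s) (by omega) M
  obtain ⟨C₁, hC₁0, hC₁⟩ := H.V_le q hq M
  obtain ⟨C₂, hC₂0, hC₂⟩ := H.V_le N (by omega) M
  obtain ⟨C₃, hC₃0, hC₃⟩ := E.exists_smooth_bound ρ (show 0 < q by omega) hqN
  set M' : ℝ := |M| * (1 + C₀)
  have hM'0 : 0 ≤ M' := by positivity
  set X : ℝ := Ci * M'
  have hX0 : 0 ≤ X := by positivity
  set D₁ : ℝ := C₁ * (X + (1 + X) * |M|)
  set D₂ : ℝ := C₃ * (C₂ * (C₀ * |M| + |M| * |M|))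
  have hD₁0 : 0 ≤ D₁ := by positivity
  have hD₂0 : 0 ≤ D₂ := by positivity
  refine ⟨X + D₁ + D₂, by positivity, fun r hr t ht ε hx hz hK => ?_⟩
  have ht0 : 0 < t := by linarith
  have hM := le_abs_self M
  have hMM' : |M| ≤ M' := le_mul_of_one_le_right (abs_nonneg M) (by linarith)
  have hM0 : 0 ≤ M := (T.nrm_nonneg _ _ _).trans hx
  have hti : t⁻¹ ≤ 1 := inv_le_one_of_one_le₀ ht.le
  have hzM : T.nrm k r (π.zeta r ε) ≤ M := hz.trans (mul_le_of_le_one_right hM0 hti)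
  have hta : 0 < t ^ a := by positivity
  have hxK : T.nrm (N + s) r (ε : T.carrier r) ≤ |M| * t ^ a := by
    have := mul_le_mul_of_nonneg_right hM hta.le
    linarith
  have hzK : T.nrm (N + s) r (π.zeta r ε) ≤ C₀ * (|M| * t ^ a) :=
    (hC₀ k hNk r hr ε hx).trans (mul_le_mul_of_nonneg_left hxK hC₀0)
  have hx1 : T.nrm (q + s) r (ε : T.carrier r) ≤ X * t ^ ν := by
    have := hCi r hr t ht 0 (by norm_num) M' ε hM'0
      (by rw [neg_zero, Real.rpow_zero, mul_one]; linarith)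
      (hxK.trans (mul_le_mul_of_nonneg_right hMM' hta.le))
    rwa [sub_zero] at this
  have hz1 : T.nrm (q + s) r (π.zeta r ε) ≤ X * t ^ (ν - 1) := by
    refine hCi r hr t ht 1 (by norm_num) M' _ hM'0 ?_ ?_
    · rw [Real.rpow_neg_one]
      exact hz.trans (mul_le_mul_of_nonneg_right (hM.trans hMM') (by positivity))
    · refine hzK.trans ?_
      rw [← mul_assoc]
      refine mul_le_mul_of_nonneg_right ?_ hta.le
      simp only [M']
      nlinarith [abs_nonneg M]
  have hν1' : t ^ ν * t⁻¹ = t ^ (ν - 1) := by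
    rw [← Real.rpow_neg_one, ← Real.rpow_add ht0]; ring_nf
  have hone : 1 ≤ t ^ ν := Real.one_le_rpow ht.le hν.le
  have hv : E.nrm q r (V r ε) ≤ D₁ * t ^ (ν - 1) := by
    refine (hC₁ k hqk r hr ε hzM hx).trans ?_
    rw [mul_assoc]
    refine mul_le_mul_of_nonneg_left ?_ hC₁0
    have h1 : (1 + T.nrm (q + s) r (ε : T.carrier r)) * T.nrm k r (π.zeta r ε) ≤
        ((1 + X) * t ^ ν) * (|M| * t⁻¹) := by
      refine mul_le_mul (by linarith) (hz.trans ?_) (T.nrm_nonneg _ _ _) (by positivity)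
      exact mul_le_mul_of_nonneg_right hM (by positivity)
    have h2 : ((1 + X) * t ^ ν) * (|M| * t⁻¹) = (1 + X) * |M| * t ^ (ν - 1) := by
      rw [← hν1']; ring
    linarith
  have hvN : E.nrm N r (V r ε) ≤ C₂ * (C₀ * |M| + |M| * |M|) * t ^ a := by
    refine (hC₂ k hNk r hr ε hzM hx).trans ?_
    rw [mul_assoc C₂]
    refine mul_le_mul_of_nonneg_left ?_ hC₂0
    have h1 : (1 + T.nrm (N + s) r (ε : T.carrier r)) * T.nrm k r (π.zeta r ε) ≤
        (|M| * t ^ a) * |M| := by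
      refine mul_le_mul (hK.trans (mul_le_mul_of_nonneg_right hM hta.le)) (hzM.trans hM)
        (T.nrm_nonneg _ _ _) (by positivity)
    linarith
  have hvw : E.nrm q r (V r ε - E.smooth r t (V r ε)) ≤ D₂ * t ^ (-2 : ℝ) := by
    refine (hC₃ r hr t ht (V r ε)).2.trans ?_
    have h1 : (t ^ (N - q))⁻¹ ≤ t ^ (-(a + 2)) := by
      rw [← Real.rpow_natCast, ← Real.rpow_neg ht0.le]
      exact Real.rpow_le_rpow_of_exponent_le ht.le (neg_le_neg hgapN)
    have h2 : t ^ (-(a + 2)) * t ^ a = t ^ (-2 : ℝ) := by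
      rw [← Real.rpow_add ht0]; ring_nf
    calc C₃ * (t ^ (N - q))⁻¹ * E.nrm N r (V r ε)
        ≤ C₃ * t ^ (-(a + 2)) * (C₂ * (C₀ * |M| + |M| * |M|) * t ^ a) := by
          have := E.nrm_nonneg N r (V r ε)
          gcongr
      _ = D₂ * (t ^ (-(a + 2)) * t ^ a) := by simp only [D₂]; ring
      _ = D₂ * t ^ (-2 : ℝ) := by rw [h2]
  have t1 : 0 ≤ t ^ (ν - 1) := by positivity
  have t2 : 0 ≤ t ^ (-2 : ℝ) := by positivity
  have t3 : 0 ≤ t ^ ν := by positivity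
  refine ⟨hx1.trans ?_, hz1.trans ?_, hv.trans ?_, hvw.trans ?_⟩ <;>
    refine mul_le_mul_of_nonneg_right ?_ (by assumption) <;> linarith

/-- One step of the iteration: if `ε` is bounded and its error is of size `t⁻¹`, in the degrees
`k + 1` and `k`, while a much higher norm is at most `t ^ a`, then the correction is small, and the
corrected element has an error of size `t ^ (-γ)` for some `γ > 1`. -/
theorem exists_step_bound (H : TameEstimates π I A V Φ s s' m k₁ δ ρ) {k N : ℕ}
    {a ν γ : ℝ} (hk : k₁ ≤ k) (hk₁ : 1 ≤ k₁) (hkN : k + s + s' + 2 + s < N)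
    (hNk : (N + s) / 2 + 1 ≤ k) (ha : 0 ≤ a)
    (hν : 0 < ν) (hν1 : ν ≤ 1 / 4) (hδ : 0 < δ)
    (hgap : (a + 2) * ((s + s' + 2 + s + s : ℕ) : ℝ) ≤ ν * ((N - (k + s + s' + 2 + s) : ℕ) : ℝ))
    (hγ₁ : γ ≤ (1 - ν) * (1 + δ) - ν * m) (hγ₂ : γ ≤ 2 - 3 * ν) (M : ℝ) :
    ∃ C : ℝ, 0 ≤ C ∧ ∀ r, ρ ≤ r → ∀ t : ℝ, 1 < t → ∀ ε : I r,
      T.nrm (k + 1) r (ε : T.carrier r) ≤ M → T.nrm k r (π.zeta r ε) ≤ M * t⁻¹ →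
      1 + T.nrm (N + s) r (ε : T.carrier r) ≤ M * t ^ a →
      W.nrm (k + 2) r (Φ r (E.smooth r t (V r ε)) : W.carrier r) ≤ C * t ^ (-1 / 2 : ℝ) ∧
      W.nrm (k + 2) r (Φ r (V r ε) : W.carrier r) ≤ C * t ^ (-1 / 2 : ℝ) ∧
      ∀ (r' : Radius) (h : r' ≤ r), ρ ≤ r' →
        Radius.Shrink A.c (W.nrm 1 r (Φ r (E.smooth r t (V r ε)) : W.carrier r)) r r' →
        Radius.Shrink A.c (W.nrm 1 r (Φ r (V r ε) : W.carrier r)) r r' →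
        T.nrm (k + 2) r' (A.act r r' (Φ r (E.smooth r t (V r ε))) ε - T.res h ε) ≤
          C * t ^ (-1 / 2 : ℝ) ∧
        T.nrm (k + 1) r' (π.zeta r' (A.act r r' (Φ r (E.smooth r t (V r ε))) ε)) ≤
          C * t ^ (-γ) := by
  obtain ⟨X, hX0, hX⟩ := H.exists_interpolated_bound (k := k) (q := k + s + s' + 2 + s) (N := N)
    (a := a) (ν := ν) hk (by omega) (by omega) (by omega) hkN (by omega) hNk ha hν (by linarith)
    (by rw [show k + s + s' + 2 + s + s - k = s + s' + 2 + s + s by omega]; exact hgap) M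
  obtain ⟨C₁, hC₁0, hC₁⟩ := H.Phi_le (k + s + s' + 2) (by omega) (2 * X)
  set Y : ℝ := C₁ * (2 * X)
  have hY0 : 0 ≤ Y := by positivity
  obtain ⟨C₂, hC₂0, hC₂⟩ := H.sub_act_le (k + 2) (by omega) (max M Y)
  obtain ⟨C₃, hC₃0, hC₃⟩ := H.act_Phi_le (k + 1) (by omega) (max M (2 * X))
  obtain ⟨C₄, hC₄0, hC₄⟩ := H.quad (k + 1) (by omega) (max M (max X Y))
  set D₁ : ℝ := C₂ * ((1 + X) * Y)
  set D₂ : ℝ := C₃ * (X * (1 + 4 * X) + (3 * X) ^ 2 * (1 + X))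
  have hD₁0 : 0 ≤ D₁ := by positivity
  have hD₂0 : 0 ≤ D₂ := by positivity
  obtain ⟨C₅, hC₅0, hC₅⟩ := H.zeta_le (k + 1) (by omega) D₂
  set D₃ : ℝ := C₄ * (X ^ (1 + δ) * (1 + X) ^ m)
  have hD₃0 : 0 ≤ D₃ := by positivity
  refine ⟨Y + D₁ + (D₃ + C₅ * D₂), by positivity, fun r hr t ht ε hx hz hK => ?_⟩
  have ht0 : 0 < t := by linarith
  obtain ⟨hxq, hzq, hvq, hdq⟩ := hX r hr t ht ε ((T.nrm_le_nrm (by omega) r _).trans hx) hz hK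
  set q := k + s + s' + 2 + s with hq
  set e := k + s + s' + 2 with he
  set v := V r ε with hv
  set w := E.smooth r t v with hw
  -- comparison of the powers of `t`
  have p21 : t ^ (-2 : ℝ) ≤ t ^ (ν - 1) := Real.rpow_le_rpow_of_exponent_le ht.le (by linarith)
  have p1 : t ^ (ν - 1) ≤ 1 := Real.rpow_le_one_of_one_le_of_nonpos ht.le (by linarith)
  have p1' : t ^ (ν - 1) ≤ t ^ (-1 / 2 : ℝ) :=
    Real.rpow_le_rpow_of_exponent_le ht.le (by linarith)
  have pν : 1 ≤ t ^ ν := Real.one_le_rpow ht.le hν.le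
  have pos1 : 0 < t ^ (ν - 1) := by positivity
  have pos2 : 0 < t ^ (-2 : ℝ) := by positivity
  have pos3 : 0 < t ^ ν := by positivity
  have pos4 : 0 < t ^ (-1 / 2 : ℝ) := by positivity
  have pos5 : 0 < t ^ (-γ) := by positivity
  have hwq : E.nrm q r w ≤ 2 * X * t ^ (ν - 1) := by
    have h3 : E.nrm q r w ≤ E.nrm q r v + E.nrm q r (v - w) := by
      simpa using map_sub_le_add (E.nrm q r) v (v - w)
    have := mul_le_mul_of_nonneg_left p21 hX0
    linarith
  have hvq2 : E.nrm q r v ≤ 2 * X * t ^ (ν - 1) := by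
    have := mul_nonneg hX0 pos1.le
    linarith
  have le2X : 2 * X * t ^ (ν - 1) ≤ 2 * X := mul_le_of_le_one_right (by positivity) p1
  have hΦ : ∀ y : E.carrier r, E.nrm q r y ≤ 2 * X * t ^ (ν - 1) →
      W.nrm e r (Φ r y : W.carrier r) ≤ Y * t ^ (ν - 1) := fun y hy => by
    refine (hC₁ q (by omega) r hr y (hy.trans le2X)).trans ?_
    rw [mul_assoc C₁]
    exact mul_le_mul_of_nonneg_left hy hC₁0
  have hΦw := hΦ w hwq
  have hΦv := hΦ v hvq2
  have leY : Y * t ^ (ν - 1) ≤ Y := mul_le_of_le_one_right hY0 p1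
  have leX : X * t ^ (ν - 1) ≤ X := mul_le_of_le_one_right hX0 p1
  have hfin : Y * t ^ (ν - 1) ≤ (Y + D₁ + (D₃ + C₅ * D₂)) * t ^ (-1 / 2 : ℝ) :=
    mul_le_mul (by linarith [mul_nonneg hC₅0 hD₂0]) p1' pos1.le (by positivity)
  have hek : k + 2 ≤ e := by omega
  refine ⟨(W.nrm_le_nrm hek r _).trans (hΦw.trans hfin),
    (W.nrm_le_nrm hek r _).trans (hΦv.trans hfin), fun r' h hr' hsw hsv => ⟨?_, ?_⟩⟩
  -- `Φ_w · ε` is compared with `Id · ε`, which is the restriction of `ε`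
  · have h1 := hC₂ (k + 1) (by omega) r r' hr hr' (Φ r w) 0 (ε : T.carrier r) hsw
      (by rw [map_zero]; exact Radius.shrink_zero _ h) (hx.trans (le_max_left _ _))
      (by
        rw [sub_zero]
        exact ((W.nrm_le_nrm (by omega) r _).trans (hΦw.trans leY)).trans (le_max_right _ _))
      (by rw [map_zero]; exact hY0.trans (le_max_right _ _))
    rw [A.one_act h, sub_zero, map_zero, add_zero, mul_one] at h1
    refine h1.trans ?_
    have h2 : T.nrm (k + 2 + s') r (ε : T.carrier r) ≤ X * t ^ ν :=
      (T.nrm_le_nrm (by omega) r _).trans hxq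
    have h3 : W.nrm (k + 2 + s') r (Φ r w : W.carrier r) ≤ Y * t ^ (ν - 1) :=
      (W.nrm_le_nrm (by omega) r _).trans hΦw
    have h4 : (1 + T.nrm (k + 2 + s') r (ε : T.carrier r)) *
        W.nrm (k + 2 + s') r (Φ r w : W.carrier r) ≤
        ((1 + X) * t ^ ν) * (Y * t ^ (ν - 1)) :=
      mul_le_mul (by linarith) h3 (W.nrm_nonneg _ _ _) (by positivity)
    have h5 : t ^ ν * t ^ (ν - 1) ≤ t ^ (-1 / 2 : ℝ) := by
      rw [← Real.rpow_add ht0]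
      exact Real.rpow_le_rpow_of_exponent_le ht.le (by linarith)
    calc C₂ * _ ≤ C₂ * (((1 + X) * t ^ ν) * (Y * t ^ (ν - 1))) :=
          mul_le_mul_of_nonneg_left h4 hC₂0
      _ = D₁ * (t ^ ν * t ^ (ν - 1)) := by simp only [D₁]; ring
      _ ≤ (Y + D₁ + (D₃ + C₅ * D₂)) * t ^ (-1 / 2 : ℝ) :=
        mul_le_mul (by linarith [mul_nonneg hC₅0 hD₂0]) h5 (by positivity) (by positivity)
  -- the effect of replacing `v` by its smoothing `w`
  · have hdiff : T.nrm (k + 1) r' (A.act r r' (Φ r w) ε - A.act r r' (Φ r v) ε) ≤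
        D₂ * t ^ (-γ) ∧
        T.nrm (k + 1) r' (A.act r r' (Φ r w) ε - A.act r r' (Φ r v) ε) ≤ D₂ := by
      have hlow : ∀ y : E.carrier r, E.nrm q r y ≤ 2 * X * t ^ (ν - 1) →
          E.nrm (k + 1) r y ≤ max M (2 * X) := fun y hy =>
        ((E.nrm_le_nrm (by omega) r y).trans (hy.trans le2X)).trans (le_max_right _ _)
      have h1 := hC₃ (k + 1) (by omega) r r' hr hr' ε w v hsw hsv (hlow w hwq) (hlow v hvq2)
        (hx.trans (le_max_left _ _))
      have hi : k + 1 + s ≤ q := by omega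
      have a1 : E.nrm (k + 1 + s) r (w - v) ≤ X * t ^ (-2 : ℝ) := by
        rw [map_sub_rev]
        exact (E.nrm_le_nrm hi r _).trans hdq
      have a2 : E.nrm (k + 1 + s) r w ≤ 2 * X * t ^ (ν - 1) := (E.nrm_le_nrm hi r _).trans hwq
      have a3 : E.nrm (k + 1 + s) r v ≤ X * t ^ (ν - 1) := (E.nrm_le_nrm hi r _).trans hvq
      have a4 : T.nrm (k + 1 + s) r (ε : T.carrier r) ≤ X * t ^ ν :=
        (T.nrm_le_nrm (by omega) r _).trans hxq
      have n2 := E.nrm_nonneg (k + 1 + s) r w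
      have n3 := E.nrm_nonneg (k + 1 + s) r v
      have n4 := T.nrm_nonneg (k + 1 + s) r (ε : T.carrier r)
      have b1 : E.nrm (k + 1 + s) r (w - v) * (1 + E.nrm (k + 1 + s) r w + E.nrm (k + 1 + s) r v +
          T.nrm (k + 1 + s) r (ε : T.carrier r)) ≤
          (X * t ^ (-2 : ℝ)) * ((1 + 4 * X) * t ^ ν) := by
        refine mul_le_mul a1 ?_ (by linarith) (by positivity)
        have : X * t ^ (ν - 1) ≤ X * t ^ ν := mul_le_mul_of_nonneg_left (p1.trans pν) hX0
        linarith
      have b2 : (E.nrm (k + 1 + s) r w + E.nrm (k + 1 + s) r v) ^ 2 *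
          (1 + T.nrm (k + 1 + s) r (ε : T.carrier r)) ≤
          (3 * X * t ^ (ν - 1)) ^ 2 * ((1 + X) * t ^ ν) := by
        refine mul_le_mul (pow_le_pow_left₀ (by linarith) (by linarith) 2) (by linarith)
          (by linarith) (by positivity)
      have q1 : t ^ (-2 : ℝ) * t ^ ν ≤ t ^ (3 * ν - 2) := by
        rw [← Real.rpow_add ht0]
        exact Real.rpow_le_rpow_of_exponent_le ht.le (by linarith)
      have q2 : (t ^ (ν - 1)) ^ 2 * t ^ ν = t ^ (3 * ν - 2) := by
        rw [← Real.rpow_natCast, ← Real.rpow_mul ht0.le, ← Real.rpow_add ht0]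
        push_cast
        ring_nf
      have h6 : T.nrm (k + 1) r' (A.act r r' (Φ r w) ε - A.act r r' (Φ r v) ε) ≤
          D₂ * t ^ (3 * ν - 2) := by
        refine h1.trans ?_
        simp only [D₂]
        rw [mul_assoc C₃]
        refine mul_le_mul_of_nonneg_left ((add_le_add b1 b2).trans ?_) hC₃0
        rw [add_mul (X * (1 + 4 * X))]
        refine add_le_add ?_ (le_of_eq ?_)
        · calc (X * t ^ (-2 : ℝ)) * ((1 + 4 * X) * t ^ ν)
              = X * (1 + 4 * X) * (t ^ (-2 : ℝ) * t ^ ν) := by ring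
            _ ≤ _ := mul_le_mul_of_nonneg_left q1 (by positivity)
        · rw [← q2]; ring
      refine ⟨h6.trans (mul_le_mul_of_nonneg_left ?_ hD₂0), h6.trans ?_⟩
      · exact Real.rpow_le_rpow_of_exponent_le ht.le (by linarith)
      · exact mul_le_of_le_one_right hD₂0
          (Real.rpow_le_one_of_one_le_of_nonpos ht.le (by linarith))
    have hζd := (hC₅ (k + 1) (by omega) r' hr' _ hdiff.2).trans
      (mul_le_mul_of_nonneg_left hdiff.1 hC₅0)
    -- the error of the unsmoothed step, by the superlinear estimate
    have hζv : T.nrm (k + 1) r' (π.zeta r' (A.act r r' (Φ r v) ε)) ≤ D₃ * t ^ (-γ) := by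
      have c1 : T.nrm (k + 1 + s) r (π.zeta r ε) ≤ X * t ^ (ν - 1) :=
        (T.nrm_le_nrm (by omega) r _).trans hzq
      have c2 : T.nrm (k + 1 + s) r (ε : T.carrier r) ≤ X * t ^ ν :=
        (T.nrm_le_nrm (by omega) r _).trans hxq
      have h1 := hC₄ r r' hr hr' ε hsv (hx.trans (le_max_left _ _))
        (((W.nrm_le_nrm (by omega) r _).trans (hΦv.trans leY)).trans
          ((le_max_right _ _).trans (le_max_right _ _)))
        ((c1.trans leX).trans ((le_max_left _ _).trans (le_max_right _ _)))
      refine h1.trans ?_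
      have n1 := T.nrm_nonneg (k + 1 + s) r (π.zeta r ε)
      have n2 := T.nrm_nonneg (k + 1 + s) r (ε : T.carrier r)
      have h2 : T.nrm (k + 1 + s) r (π.zeta r ε) ^ (1 + δ) *
          (1 + T.nrm (k + 1 + s) r (ε : T.carrier r)) ^ m ≤
          (X * t ^ (ν - 1)) ^ (1 + δ) * ((1 + X) * t ^ ν) ^ m :=
        mul_le_mul (Real.rpow_le_rpow n1 c1 (by linarith))
          (pow_le_pow_left₀ (by linarith) (by linarith) m) (by positivity) (by positivity)
      have h3 : (X * t ^ (ν - 1)) ^ (1 + δ) * ((1 + X) * t ^ ν) ^ m =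
          X ^ (1 + δ) * (1 + X) ^ m * t ^ ((ν - 1) * (1 + δ) + ν * m) := by
        rw [Real.mul_rpow hX0 pos1.le, mul_pow, ← Real.rpow_natCast (t ^ ν),
          ← Real.rpow_mul ht0.le, ← Real.rpow_mul ht0.le, Real.rpow_add ht0]
        ring
      have h4 : t ^ ((ν - 1) * (1 + δ) + ν * m) ≤ t ^ (-γ) :=
        Real.rpow_le_rpow_of_exponent_le ht.le (by linarith)
      calc _ ≤ C₄ * ((X * t ^ (ν - 1)) ^ (1 + δ) * ((1 + X) * t ^ ν) ^ m) :=
            mul_le_mul_of_nonneg_left h2 hC₄0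
        _ = D₃ * t ^ ((ν - 1) * (1 + δ) + ν * m) := by rw [h3]; simp only [D₃]; ring
        _ ≤ D₃ * t ^ (-γ) := mul_le_mul_of_nonneg_left h4 hD₃0
    have hsum : π.zeta r' (A.act r r' (Φ r w) ε) = π.zeta r' (A.act r r' (Φ r v) ε) +
        π.zeta r' (A.act r r' (Φ r w) ε - A.act r r' (Φ r v) ε) := by
      simp only [SCIProjection.zeta, map_sub, Submodule.coe_sub]
      abel
    rw [hsum]
    have htri := map_add_le_add (T.nrm (k + 1) r') (π.zeta r' (A.act r r' (Φ r v) ε))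
      (π.zeta r' (A.act r r' (Φ r w) ε - A.act r r' (Φ r v) ε))
    refine htri.trans ((add_le_add hζv hζd).trans ?_)
    rw [← mul_assoc, ← add_mul]
    exact mul_le_mul_of_nonneg_right (by linarith) pos5.le

end TameEstimates

/-! ### Choice of the exponents -/

/-- The estimates for one step of the iteration, with smoothing parameter `t`, at degree `k` and
high degree `K`. The exponents are such that a step `t ↦ t ^ (1 + κ)` is possible: the new error is
smaller than `t ^ (-(1 + κ))` by the margin `t ^ (-κ / 2)`. -/
structure StepEstimates {T : SCISpace.{u}} {F : SCISubspace T} (π : SCIProjection F)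
    (I : ∀ r, Set (T.carrier r)) {W : SCISpace.{v}} {G : SCIGroup W} (A : SCIAction G T)
    {G₀ : ∀ r, Set (W.carrier r)} {E : SCISpace.{w}} (V : ∀ r, I r → E.carrier r)
    (Φ : ∀ r, E.carrier r → G₀ r) (k K b : ℕ) (κ a : ℝ) (ρ : Radius) (M C : ℝ) : Prop where
  growth : ∀ r r', ρ ≤ r → ρ ≤ r' → ∀ t : ℝ, 1 < t → ∀ ε : I r,
    T.nrm (k + 1) r (ε : T.carrier r) ≤ M → T.nrm k r (π.zeta r ε) ≤ M * t⁻¹ →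
    Radius.Shrink A.c (W.nrm 1 r (Φ r (E.smooth r t (V r ε)) : W.carrier r)) r r' →
    1 + T.nrm K r' (A.act r r' (Φ r (E.smooth r t (V r ε))) ε) ≤
      C * t ^ b * (1 + T.nrm K r (ε : T.carrier r))
  small : ∀ r, ρ ≤ r → ∀ t : ℝ, 1 < t → ∀ ε : I r,
    T.nrm (k + 1) r (ε : T.carrier r) ≤ M → T.nrm k r (π.zeta r ε) ≤ M * t⁻¹ →
    1 + T.nrm K r (ε : T.carrier r) ≤ M * t ^ a →
    W.nrm (k + 2) r (Φ r (E.smooth r t (V r ε)) : W.carrier r) ≤ C * t ^ (-1 / 2 : ℝ) ∧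
    W.nrm (k + 2) r (Φ r (V r ε) : W.carrier r) ≤ C * t ^ (-1 / 2 : ℝ) ∧
    ∀ (r' : Radius) (h : r' ≤ r), ρ ≤ r' →
      Radius.Shrink A.c (W.nrm 1 r (Φ r (E.smooth r t (V r ε)) : W.carrier r)) r r' →
      Radius.Shrink A.c (W.nrm 1 r (Φ r (V r ε) : W.carrier r)) r r' →
      T.nrm (k + 2) r' (A.act r r' (Φ r (E.smooth r t (V r ε))) ε - T.res h ε) ≤
        C * t ^ (-1 / 2 : ℝ) ∧
      T.nrm (k + 1) r' (π.zeta r' (A.act r r' (Φ r (E.smooth r t (V r ε))) ε)) ≤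
        C * t ^ (-(1 + κ + κ / 2))

/-- Choice of the exponents. `κ` is half of `min δ 1`, the power `t ^ ν` lost by interpolation is
small compared with `min δ 1`, also after multiplication by the degree `m` of the polynomial in the
quadratic estimate, and `k` is so large that the gap between `k` and `K` pays for `t ^ a`. -/
theorem exists_stepEstimates {T : SCISpace.{u}} {F : SCISubspace T} {π : SCIProjection F}
    {I : ∀ r, Set (T.carrier r)} {W : SCISpace.{v}} {G : SCIGroup W} {A : SCIAction G T}
    {G₀ : ∀ r, Set (W.carrier r)} {E : SCISpace.{w}} {V : ∀ r, I r → E.carrier r}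
    {Φ : ∀ r, E.carrier r → G₀ r} {s s' m k₁ : ℕ} {δ : ℝ}
    (H : ∀ ρ, TameEstimates π I A V Φ s s' m k₁ δ ρ) (hk₁ : 1 ≤ k₁) (hδ : 0 < δ) :
    ∃ (b L : ℕ) (κ a : ℝ), 0 < κ ∧ 0 < a ∧ κ * a = b + 1 ∧ 5 ≤ L ∧ ∀ k, L ≤ k →
      ∃ K : ℕ, K + 1 ≤ 2 * k ∧ ∀ (ρ : Radius) (M : ℝ), ∃ C : ℝ, 0 ≤ C ∧
        StepEstimates π I A V Φ k K b κ a ρ M C := by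
  set d : ℝ := min δ 1 with hd
  have hd0 : 0 < d := lt_min hδ one_pos
  have hdδ : d ≤ δ := min_le_left _ _
  have hd1 : d ≤ 1 := min_le_right _ _
  set κ : ℝ := d / 2 with hκ
  set b : ℕ := 2 * s + s' + 1 with hb
  set a : ℝ := (b + 1) / κ with ha
  have hκ0 : 0 < κ := by positivity
  have ha0 : 0 < a := by positivity
  set ν : ℝ := d / (4 * (3 + δ + m)) with hν
  have hν0 : 0 < ν := by positivity
  have hνd : ν * (3 + δ + m) = d / 4 := by
    rw [hν]; field_simp
  have hm : 0 ≤ ν * m := by positivity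
  have hνδ : 0 < ν * δ := by positivity
  obtain ⟨g, hg⟩ := exists_nat_gt ((a + 2) * ((s + s' + 2 + s + s : ℕ) : ℝ) / ν)
  rw [div_lt_iff₀ hν0] at hg
  refine ⟨b, k₁ + g + 8 * s + 2 * s' + 12, κ, a, hκ0, ha0, by rw [ha]; field_simp, by omega,
    fun k hk => ?_⟩
  obtain ⟨n, rfl⟩ : ∃ n, k = n + 2 * s + 1 := ⟨k - 2 * s - 1, by omega⟩
  obtain ⟨N, hN⟩ : ∃ N, N + 2 * s + s' + 2 = 2 * n := ⟨2 * n - (2 * s + s' + 2), by omega⟩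
  refine ⟨N + s, by omega, fun ρ M => ?_⟩
  obtain ⟨C₁, hC₁0, hC₁⟩ := (H ρ).exists_high_bound (n := n) (N := N) (by omega) (by omega)
    (by omega) (by omega) (by omega) |M|
  obtain ⟨C₂, hC₂0, hC₂⟩ := (H ρ).exists_step_bound (k := n + 2 * s + 1) (N := N) (a := a) (ν := ν)
    (γ := 1 + κ + κ / 2) (by omega) hk₁ (by omega) (by omega) ha0.le hν0 (by nlinarith) hδ
    (by
      refine hg.le.trans ?_
      rw [mul_comm]
      exact mul_le_mul_of_nonneg_left (by exact_mod_cast (by omega)) hν0.le)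
    (by nlinarith) (by nlinarith) M
  refine ⟨C₁ + C₂, by positivity, ⟨?_, ?_⟩⟩
  · intro r r' hr hr' t ht ε hx hz hsh
    have hM : 0 ≤ M := (T.nrm_nonneg _ _ _).trans hx
    have h := hC₁ r r' hr hr' t ht ε
      (((T.nrm_le_nrm (by omega) r _).trans hx).trans (le_abs_self M))
      ((hz.trans (mul_le_of_le_one_right hM (inv_le_one_of_one_le₀ ht.le))).trans (le_abs_self M))
      hsh
    refine h.trans ?_
    have := T.nrm_nonneg (N + s) r (ε : T.carrier r)
    have ht0 : 0 < t := by linarith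
    gcongr
    linarith
  · intro r hr t ht ε hx hz hK
    have ht0 : 0 < t := by linarith
    obtain ⟨h1, h2, h3⟩ := hC₂ r hr t ht ε hx hz hK
    have mono : ∀ e : ℝ, C₂ * t ^ e ≤ (C₁ + C₂) * t ^ e := fun e =>
      mul_le_mul_of_nonneg_right (by linarith) (by positivity)
    refine ⟨h1.trans (mono _), h2.trans (mono _), fun r' h hr' hsw hsv => ?_⟩
    obtain ⟨h4, h5⟩ := h3 r' h hr' hsw hsv
    exact ⟨h4.trans (mono _), h5.trans (mono _)⟩

/-! ### The sequence of smoothing parameters -/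

/-- The smoothing parameters `t₀ ^ ((1 + κ) ^ d)`, each the `(1 + κ)`-th power of the one before. -/
noncomputable def smoothingParam (t₀ κ : ℝ) (d : ℕ) : ℝ := t₀ ^ ((1 + κ) ^ d)

theorem le_smoothingParam {t₀ κ : ℝ} (ht₀ : 1 < t₀) (hκ : 0 < κ) (d : ℕ) : t₀ ≤ smoothingParam t₀ κ d := by
  have h : (1 : ℝ) ≤ (1 + κ) ^ d := one_le_pow₀ (by linarith)
  simpa [smoothingParam] using Real.rpow_le_rpow_of_exponent_le ht₀.le h

theorem one_lt_smoothingParam {t₀ κ : ℝ} (ht₀ : 1 < t₀) (hκ : 0 < κ) (d : ℕ) : 1 < smoothingParam t₀ κ d :=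
  ht₀.trans_le (le_smoothingParam ht₀ hκ d)

theorem smoothingParam_succ {t₀ κ : ℝ} (ht₀ : 1 < t₀) (d : ℕ) :
    smoothingParam t₀ κ (d + 1) = smoothingParam t₀ κ d ^ (1 + κ) := by
  rw [smoothingParam, smoothingParam, ← Real.rpow_mul (by linarith), pow_succ]

theorem smoothingParam_rpow_le {t₀ κ : ℝ} (ht₀ : 1 < t₀) (hκ : 0 < κ)
    (h2 : 2 ≤ t₀ ^ (κ / 4)) (d : ℕ) :
    smoothingParam t₀ κ d ^ (-1 / 4 : ℝ) ≤ t₀ ^ (-1 / 4 : ℝ) * (1 / 2) ^ d := by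
  have ht0 : 0 < t₀ := by linarith
  have hb : 1 + (d : ℝ) * κ ≤ (1 + κ) ^ d := one_add_mul_le_pow (by linarith) d
  have h3 : t₀ ^ (-(κ / 4)) ≤ 1 / 2 := by
    rw [Real.rpow_neg ht0.le, one_div]
    exact inv_anti₀ two_pos h2
  calc smoothingParam t₀ κ d ^ (-1 / 4 : ℝ) = t₀ ^ ((1 + κ) ^ d * (-1 / 4 : ℝ)) := by
        rw [smoothingParam, ← Real.rpow_mul ht0.le]
    _ ≤ t₀ ^ ((-1 / 4 : ℝ) + -(κ / 4) * d) :=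
        Real.rpow_le_rpow_of_exponent_le ht₀.le (by linarith)
    _ = t₀ ^ (-1 / 4 : ℝ) * (t₀ ^ (-(κ / 4))) ^ d := by
        rw [Real.rpow_add ht0, Real.rpow_mul ht0.le, Real.rpow_natCast]
    _ ≤ t₀ ^ (-1 / 4 : ℝ) * (1 / 2) ^ d := by gcongr

theorem tendsto_smoothingParam {t₀ κ : ℝ} (ht₀ : 1 < t₀) (hκ : 0 < κ) : Tendsto (smoothingParam t₀ κ) atTop atTop :=
  (tendsto_rpow_atTop_of_base_gt_one t₀ ht₀).comp (tendsto_pow_atTop_atTop_of_one_lt (by linarith))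

/-- A sequence which grows in step `d` at most by a factor `C t_d ^ b` is bounded by a multiple of
`t_d ^ a`, provided that `κ a > b`. -/
theorem exists_le_smoothingParam_rpow {t₀ κ : ℝ} (ht₀ : 1 < t₀) (hκ : 0 < κ)
    {a : ℝ} {b : ℕ} (hab : b < κ * a) {C : ℝ}
    {y : ℕ → ℝ} (hy : ∀ d, 0 ≤ y d)
    (h : ∀ d, y (d + 1) ≤ C * smoothingParam t₀ κ d ^ b * y d) :
    ∃ D : ℝ, 0 ≤ D ∧ ∀ d, y d ≤ D * smoothingParam t₀ κ d ^ a := by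
  set t := smoothingParam t₀ κ with ht
  have t0 : ∀ d, 0 < t d := fun d => by linarith [one_lt_smoothingParam ht₀ hκ d]
  have hlim : Tendsto (fun d => t d ^ (κ * a - b)) atTop atTop :=
    (tendsto_rpow_atTop (by linarith)).comp (tendsto_smoothingParam ht₀ hκ)
  obtain ⟨d₀, hd₀⟩ := eventually_atTop.1 (hlim.eventually_ge_atTop C)
  set D : ℝ := ∑ i ∈ Finset.range (d₀ + 1), y i / t i ^ a with hD
  have hterm : ∀ i, 0 ≤ y i / t i ^ a := fun i => div_nonneg (hy i) (by have := t0 i; positivity)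
  refine ⟨D, Finset.sum_nonneg fun i _ => hterm i, fun d => ?_⟩
  rcases le_total d d₀ with hd | hd
  · have h1 : y d / t d ^ a ≤ D :=
      Finset.single_le_sum (f := fun i => y i / t i ^ a) (fun i _ => hterm i)
        (Finset.mem_range.2 (by omega))
    have := t0 d
    rwa [div_le_iff₀ (by positivity)] at h1
  · induction d, hd using Nat.le_induction with
    | base =>
      have h1 : y d₀ / t d₀ ^ a ≤ D :=
        Finset.single_le_sum (f := fun i => y i / t i ^ a) (fun i _ => hterm i)
          (Finset.mem_range.2 (by omega))
      have := t0 d₀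
      rwa [div_le_iff₀ (by positivity)] at h1
    | succ d hd ih =>
      have htd := t0 d
      have hD0 : 0 ≤ D := Finset.sum_nonneg fun i _ => hterm i
      have e : t (d + 1) ^ a = t d ^ (κ * a - b) * t d ^ b * t d ^ a := by
        rw [ht, smoothingParam_succ ht₀, ← ht, ← Real.rpow_mul htd.le,
          ← Real.rpow_natCast (t d) b, ← Real.rpow_add htd, ← Real.rpow_add htd]
        ring_nf
      calc y (d + 1) ≤ C * t d ^ b * y d := h d
        _ ≤ t d ^ (κ * a - b) * t d ^ b * (D * t d ^ a) := by
            have := hd₀ d hd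
            have := hy d
            gcongr
        _ = D * t (d + 1) ^ a := by rw [e]; ring

/-- Increments `≤ c 2 ^ (-d)` sum up to at most `2 c`. -/
theorem le_add_of_increment_le {x : ℕ → ℝ} {c : ℝ} (h : ∀ d, x (d + 1) ≤ x d + c * (1 / 2) ^ d)
    (d : ℕ) : x d ≤ x 0 + 2 * c * (1 - (1 / 2) ^ d) := by
  induction d with
  | zero => simp
  | succ d ih =>
    have := h d
    rw [pow_succ]
    linarith

/-- Dependent choice of a sequence in a family of types, keeping an invariant `P`. -/
theorem exists_seq_of_exists_step {X : ℕ → Type*} (P : ∀ d, X d → Prop)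
    (Q : ∀ d, X d → X (d + 1) → Prop) (x₀ : X 0) (h₀ : P 0 x₀)
    (h : ∀ d x, P d x → ∃ y, P (d + 1) y ∧ Q d x y) :
    ∃ x : ∀ d, X d, x 0 = x₀ ∧ ∀ d, P d (x d) ∧ Q d (x d) (x (d + 1)) := by
  choose f hf using h
  let x : ∀ d, {x : X d // P d x} := fun d =>
    Nat.rec ⟨x₀, h₀⟩ (fun d x => ⟨f d x.1 x.2, (hf d x.1 x.2).1⟩) d
  exact ⟨fun d => (x d).1, rfl, fun d => ⟨(x d).2, (hf d _ (x d).2).2⟩⟩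

/-! ### The shrinking radii -/

/-- The radius `R (3 / 4 + y / 4)`, where `y` is clamped to `[0, 1]`. -/
noncomputable def Radius.interp (R : Radius) (y : ℝ) : Radius :=
  ⟨(R : ℝ) * (3 / 4 + max 0 (min y 1) / 4), by
    have h1 : max 0 (min y 1) ≤ 1 := max_le zero_le_one (min_le_right _ _)
    have h2 : 0 ≤ max 0 (min y 1) := le_max_left _ _
    have h3 := R.2.1
    have h4 := R.2.2
    exact ⟨by positivity, by nlinarith⟩⟩

theorem Radius.coe_interp (R : Radius) {y : ℝ} (h0 : 0 ≤ y) (h1 : y ≤ 1) :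
    (R.interp y : ℝ) = (R : ℝ) * (3 / 4 + y / 4) := by
  show (R : ℝ) * (3 / 4 + max 0 (min y 1) / 4) = _
  rw [min_eq_left h1, max_eq_right h0]

theorem Radius.interp_mono (R : Radius) {x y : ℝ} (h : x ≤ y) : R.interp x ≤ R.interp y := by
  show (R : ℝ) * (3 / 4 + max 0 (min x 1) / 4) ≤ (R : ℝ) * (3 / 4 + max 0 (min y 1) / 4)
  have := R.2.1
  gcongr

theorem Radius.interp_le (R : Radius) (y : ℝ) : R.interp y ≤ R := by
  show (R : ℝ) * (3 / 4 + max 0 (min y 1) / 4) ≤ (R : ℝ)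
  have h1 : max 0 (min y 1) ≤ 1 := max_le zero_le_one (min_le_right _ _)
  have := R.2.1
  nlinarith

theorem Radius.half_le_interp (R : Radius) (y : ℝ) : R.half ≤ R.interp y := by
  show (R : ℝ) / 2 ≤ (R : ℝ) * (3 / 4 + max 0 (min y 1) / 4)
  have h2 : 0 ≤ max 0 (min y 1) := le_max_left _ _
  have := R.2.1
  nlinarith

theorem Radius.half_mono {R R' : Radius} (h : R ≤ R') : R.half ≤ R'.half := by
  have h' : (R : ℝ) ≤ R' := h
  show (R : ℝ) / 2 ≤ (R' : ℝ) / 2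
  linarith

theorem Radius.shrink_interp (R : Radius) {c z x y : ℝ} (h0 : 0 ≤ y) (h1 : x ≤ 1)
    (hz : c * z ≤ (x - y) / 4) (hyx : y ≤ x) : Radius.Shrink c z (R.interp x) (R.interp y) := by
  show (R.interp y : ℝ) ≤ (R.interp x : ℝ) * (1 - c * z)
  rw [R.coe_interp h0 (hyx.trans h1), R.coe_interp (h0.trans hyx) h1]
  have h2 := R.2.1
  have h3 : (R : ℝ) * (3 / 4 + x / 4) ≤ R := by nlinarith
  have h4 : 0 ≤ (R : ℝ) * (3 / 4 + x / 4) := by nlinarith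
  rcases le_total (c * z) 0 with h | h <;> nlinarith

/-! ### The iteration -/

theorem smoothingParam_neg_half_le {t₀ κ : ℝ} (ht₀ : 1 < t₀) (hκ : 0 < κ)
    (h2 : 2 ≤ t₀ ^ (κ / 4)) (d : ℕ) :
    smoothingParam t₀ κ d ^ (-1 / 2 : ℝ) ≤ t₀ ^ (-1 / 4 : ℝ) * (1 / 2) ^ d :=
  (Real.rpow_le_rpow_of_exponent_le (one_lt_smoothingParam ht₀ hκ d).le (by norm_num)).trans
    (smoothingParam_rpow_le ht₀ hκ h2 d)

/-- Once the iteration is under control in one degree, it is under control in all higher degrees: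
a bound in degree `k` gives polynomial growth in a degree `K ≈ 2 k`, and interpolation between
`k` and `K` gives the bound in degree `k + 1`. -/
theorem exists_bound_of_iterates {T : SCISpace.{u}} {F : SCISubspace T} {π : SCIProjection F}
    {I : ∀ r, Set (T.carrier r)} {W : SCISpace.{v}} {G : SCIGroup W} {A : SCIAction G T}
    {G₀ : ∀ r, Set (W.carrier r)} {E : SCISpace.{w}} {V : ∀ r, I r → E.carrier r}
    {Φ : ∀ r, E.carrier r → G₀ r} {b L : ℕ} {κ a : ℝ} (hκ : 0 < κ) (hab : κ * a = b + 1)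
    (hstep : ∀ k, L ≤ k → ∃ K : ℕ, K + 1 ≤ 2 * k ∧ ∀ (ρ : Radius) (M : ℝ), ∃ C : ℝ, 0 ≤ C ∧
        StepEstimates π I A V Φ k K b κ a ρ M C)
    {ρ : Radius} {t₀ : ℝ} (ht₀ : 1 < t₀) (h2 : 2 ≤ t₀ ^ (κ / 4))
    {r : ℕ → Radius} (hρ : ∀ d, ρ ≤ r d) (hr : ∀ d, r (d + 1) ≤ r d) {e : ∀ d, I (r d)}
    (hsw : ∀ d, Radius.Shrink A.c (W.nrm 1 (r d) (Φ (r d) (E.smooth (r d) (smoothingParam t₀ κ d)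
      (V (r d) (e d))) : W.carrier (r d))) (r d) (r (d + 1)))
    (hsv : ∀ d, Radius.Shrink A.c (W.nrm 1 (r d) (Φ (r d) (V (r d) (e d)) : W.carrier (r d)))
      (r d) (r (d + 1)))
    (he : ∀ d, (e (d + 1) : T.carrier (r (d + 1))) = A.act (r d) (r (d + 1))
      (Φ (r d) (E.smooth (r d) (smoothingParam t₀ κ d) (V (r d) (e d)))) (e d))
    {l : ℕ} (hl : L ≤ l) {M₀ : ℝ}
    (hx : ∀ d, T.nrm (l + 1) (r d) (e d : T.carrier (r d)) ≤ M₀)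
    (hz : ∀ d, T.nrm l (r d) (π.zeta (r d) (e d)) ≤ M₀ * (smoothingParam t₀ κ d)⁻¹) (k : ℕ) :
    ∃ M : ℝ, ∀ d, W.nrm k (r d) (Φ (r d) (E.smooth (r d) (smoothingParam t₀ κ d)
      (V (r d) (e d))) : W.carrier (r d)) ≤ M * smoothingParam t₀ κ d ^ (-1 / 2 : ℝ) := by
  set t := smoothingParam t₀ κ with ht
  have ht1 : ∀ d, 1 < t d := one_lt_smoothingParam ht₀ hκ
  have main : ∀ k, L ≤ k → ∀ M : ℝ, (∀ d, T.nrm (k + 1) (r d) (e d : T.carrier (r d)) ≤ M) →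
      (∀ d, T.nrm k (r d) (π.zeta (r d) (e d)) ≤ M * (t d)⁻¹) → ∃ M' : ℝ,
      (∀ d, T.nrm (k + 1 + 1) (r d) (e d : T.carrier (r d)) ≤ M') ∧
      (∀ d, T.nrm (k + 1) (r d) (π.zeta (r d) (e d)) ≤ M' * (t d)⁻¹) ∧
      (∀ d, W.nrm (k + 2) (r d) (Φ (r d) (E.smooth (r d) (t d) (V (r d) (e d))) :
        W.carrier (r d)) ≤ M' * t d ^ (-1 / 2 : ℝ)) := by
    intro k hk M hx hz
    obtain ⟨K, -, hK⟩ := hstep k hk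
    obtain ⟨C, hC0, hC⟩ := hK ρ M
    obtain ⟨D, hD0, hD⟩ := exists_le_smoothingParam_rpow (a := a) (b := b) ht₀ hκ (by linarith)
      (C := C) (y := fun d => 1 + T.nrm K (r d) (e d : T.carrier (r d)))
      (fun d => by linarith [T.nrm_nonneg K (r d) (e d : T.carrier (r d))])
      (fun d => by
        have := hC.growth (r d) (r (d + 1)) (hρ d) (hρ _) (t d) (ht1 d) (e d) (hx d) (hz d) (hsw d)
        rw [← he] at this
        exact this)
    obtain ⟨C', hC'0, hC'⟩ := hK ρ (max M D)
    have hsmall := fun d => hC'.small (r d) (hρ d) (t d) (ht1 d) (e d)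
      ((hx d).trans (le_max_left _ _))
      ((hz d).trans (mul_le_mul_of_nonneg_right (le_max_left _ _)
        (inv_nonneg.2 (by linarith [ht1 d]))))
      ((hD d).trans (mul_le_mul_of_nonneg_right (le_max_right _ _)
        (Real.rpow_nonneg (by linarith [ht1 d]) _)))
    have hnext := fun d => (hsmall d).2.2 (r (d + 1)) (hr d) (hρ _) (hsw d) (hsv d)
    set q : ℝ := t₀ ^ (-1 / 4 : ℝ) with hq
    have hq0 : 0 ≤ q := Real.rpow_nonneg (by linarith) _
    have hxs : ∀ d, T.nrm (k + 2) (r d) (e d : T.carrier (r d)) ≤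
        T.nrm (k + 2) (r 0) (e 0 : T.carrier (r 0)) + 2 * (C' * q) := by
      intro d
      have h := le_add_of_increment_le
        (x := fun d => T.nrm (k + 2) (r d) (e d : T.carrier (r d))) (c := C' * q) (fun d => by
          have h1 := (hnext d).1
          rw [← he] at h1
          have h3 := map_add_le_add (T.nrm (k + 2) (r (d + 1)))
            ((e (d + 1) : T.carrier (r (d + 1))) - T.res (hr d) (e d)) (T.res (hr d) (e d))
          rw [sub_add_cancel] at h3
          have h4 := T.nrm_res_le (k + 2) (hr d) (e d : T.carrier (r d))
          have h5 := mul_le_mul_of_nonneg_left (smoothingParam_neg_half_le ht₀ hκ h2 d) hC'0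
          rw [← ht, ← hq] at h5
          rw [mul_assoc C']
          linarith) d
      refine h.trans (add_le_add le_rfl (mul_le_of_le_one_right (by positivity) ?_))
      have : (0 : ℝ) ≤ (1 / 2) ^ d := by positivity
      linarith
    have hX0 := T.nrm_nonneg (k + 2) (r 0) (e 0 : T.carrier (r 0))
    have hZ0 := T.nrm_nonneg (k + 1) (r 0) (π.zeta (r 0) (e 0))
    have t00 : 0 ≤ T.nrm (k + 1) (r 0) (π.zeta (r 0) (e 0)) * t 0 :=
      mul_nonneg hZ0 (by linarith [ht1 0])
    have hCq : 0 ≤ C' * q := mul_nonneg hC'0 hq0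
    refine ⟨T.nrm (k + 2) (r 0) (e 0 : T.carrier (r 0)) + 2 * (C' * q) + C' +
      T.nrm (k + 1) (r 0) (π.zeta (r 0) (e 0)) * t 0, fun d => ?_, fun d => ?_, fun d => ?_⟩
    · have := hxs d
      linarith
    · have htd : 0 < t d := by linarith [ht1 d]
      rw [← div_eq_mul_inv, le_div_iff₀ htd]
      cases d with
      | zero => linarith
      | succ d =>
        have htd' : 0 < t d := by linarith [ht1 d]
        have h1 := (hnext d).2
        rw [← he] at h1
        have e1 : t d ^ (-(1 + κ + κ / 2)) * t (d + 1) ≤ 1 := by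
          rw [ht, smoothingParam_succ ht₀, ← ht, ← Real.rpow_add htd']
          exact Real.rpow_le_one_of_one_le_of_nonpos (ht1 d).le (by linarith)
        have e2 := mul_le_mul_of_nonneg_right h1 htd.le
        have e3 := mul_le_mul_of_nonneg_left e1 hC'0
        linarith
    · refine (hsmall d).1.trans (mul_le_mul_of_nonneg_right (by linarith)
        (Real.rpow_nonneg (by linarith [ht1 d]) _))
  have all : ∀ k, l ≤ k → ∃ M : ℝ, (∀ d, T.nrm (k + 1) (r d) (e d : T.carrier (r d)) ≤ M) ∧
      (∀ d, T.nrm k (r d) (π.zeta (r d) (e d)) ≤ M * (t d)⁻¹) := by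
    intro k hk
    induction k, hk using Nat.le_induction with
    | base => exact ⟨M₀, hx, hz⟩
    | succ k hk ih =>
      obtain ⟨M, h1, h2⟩ := ih
      obtain ⟨M', h3, h4, -⟩ := main k (hl.trans hk) M h1 h2
      exact ⟨M', h3, h4⟩
  obtain ⟨M, h3, h4⟩ := all (l + k) (by omega)
  obtain ⟨M', -, -, h5⟩ := main (l + k) (by omega) M h3 h4
  exact ⟨M', fun d => (W.nrm_le_nrm (by omega) _ _).trans (h5 d)⟩

/-- The Newton iteration with smoothing. For all large initial smoothing parameters `t₀` it can be
carried out indefinitely on the radii `R (3 / 4 + 2 ^ (-d) / 4)`, with errors converging to `0` and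
with group elements converging to the identity faster than any geometric sequence. -/
theorem exists_iterates {T : SCISpace.{u}} {F : SCISubspace T} {π : SCIProjection F}
    {I : ∀ r, Set (T.carrier r)} (hI : IsSCISubset T I) {W : SCISpace.{v}} {G : SCIGroup W}
    {A : SCIAction G T} {G₀ : ∀ r, Set (W.carrier r)}
    (hG₀I : ∀ (r r' : Radius) (φ : W.carrier r) (ε : T.carrier r), φ ∈ G₀ r → ε ∈ I r →
      Radius.Shrink A.c (W.nrm 1 r φ) r r' → A.act r r' φ ε ∈ I r')
    {E : SCISpace.{w}} {V : ∀ r, I r → E.carrier r}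
    {Φ : ∀ r, E.carrier r → G₀ r} {b L : ℕ} {κ a : ℝ} (hκ : 0 < κ) (ha : 0 < a)
    (hab : κ * a = b + 1) (hL : 5 ≤ L)
    (hstep : ∀ k, L ≤ k → ∃ K : ℕ, K + 1 ≤ 2 * k ∧ ∀ (ρ : Radius) (M : ℝ), ∃ C : ℝ, 0 ≤ C ∧
        StepEstimates π I A V Φ k K b κ a ρ M C) (R₀ : Radius) :
    ∃ C : ℝ, 0 ≤ C ∧ ∀ᶠ t₀ : ℝ in atTop, ∀ R : Radius, R₀ ≤ R → ∀ ε ∈ I R,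
      T.nrm (2 * L - 1) R ε < 1 → T.nrm L R (π.zeta R ε) < t₀⁻¹ →
      ∃ (e : ∀ d : ℕ, T.carrier (R.interp ((1 / 2) ^ d)))
        (φ : ∀ d : ℕ, W.carrier (R.interp ((1 / 2) ^ d))),
        e 0 = T.res (R.interp_le _) ε ∧
        (∀ d, φ d ∈ G₀ _) ∧
        (∀ d, e (d + 1) = A.act (R.interp ((1 / 2) ^ d)) (R.interp ((1 / 2) ^ (d + 1)))
          (φ d) (e d)) ∧
        (∀ d, W.nrm 5 _ (φ d) ≤ C * smoothingParam t₀ κ d ^ (-1 / 2 : ℝ)) ∧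
        (∀ k, ∃ M : ℝ, ∀ d, W.nrm k _ (φ d) ≤ M * smoothingParam t₀ κ d ^ (-1 / 2 : ℝ)) ∧
        (∀ d, T.nrm L _ (π.zeta _ (e d)) ≤ (smoothingParam t₀ κ d)⁻¹) := by
  obtain ⟨K, hK1, hK⟩ := hstep L le_rfl
  obtain ⟨C, hC0, hC⟩ := hK R₀.half 2
  refine ⟨C, hC0, ?_⟩
  have lim1 : Tendsto (fun t₀ : ℝ => t₀ ^ (κ / 4)) atTop atTop := tendsto_rpow_atTop (by positivity)
  have lim2 : Tendsto (fun t₀ : ℝ => t₀ ^ (κ / 2)) atTop atTop := tendsto_rpow_atTop (by positivity)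
  have lim3 : Tendsto (fun t₀ : ℝ => A.c * (C * t₀ ^ (-1 / 4 : ℝ))) atTop (𝓝 0) := by
    have : Tendsto (fun t₀ : ℝ => t₀ ^ (-(1 / 4) : ℝ)) atTop (𝓝 0) :=
      tendsto_rpow_neg_atTop (by norm_num)
    simpa [neg_div] using (this.const_mul C).const_mul A.c
  filter_upwards [eventually_gt_atTop 1, eventually_ge_atTop C, lim1.eventually_ge_atTop 2,
    lim2.eventually_ge_atTop C, lim3.eventually (ge_mem_nhds (show (0 : ℝ) < 1 / 32 by norm_num))]
    with t₀ ht₀ htC h2 hκC hsmallC R hR ε hεI hε hζ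
  set t := smoothingParam t₀ κ with ht
  have ht1 : ∀ d, 1 < t d := one_lt_smoothingParam ht₀ hκ
  have htt : ∀ d, t₀ ≤ t d := le_smoothingParam ht₀ hκ
  set q : ℝ := t₀ ^ (-1 / 4 : ℝ) with hq
  have hq0 : 0 ≤ q := Real.rpow_nonneg (by linarith) _
  have hCq0 : 0 ≤ C * q := mul_nonneg hC0 hq0
  have hCq : C * q ≤ 1 / 32 := by nlinarith [A.one_lt_c]
  have hthalf : ∀ d, C * t d ^ (-1 / 2 : ℝ) ≤ C * q * (1 / 2) ^ d := fun d => by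
    rw [mul_assoc]
    exact mul_le_mul_of_nonneg_left (smoothingParam_neg_half_le ht₀ hκ h2 d) hC0
  set r : ℕ → Radius := fun d => R.interp ((1 / 2) ^ d) with hrdef
  have hρ : ∀ d, R₀.half ≤ r d := fun d => (Radius.half_mono hR).trans (R.half_le_interp _)
  have hr : ∀ d, r (d + 1) ≤ r d := fun d => R.interp_mono (by
    rw [pow_succ]
    have : (0 : ℝ) ≤ (1 / 2) ^ d := by positivity
    linarith)
  have hshrink : ∀ d (x : W.carrier (r d)), W.nrm (L + 2) (r d) x ≤ C * t d ^ (-1 / 2 : ℝ) →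
      Radius.Shrink A.c (W.nrm 1 (r d) x) (r d) (r (d + 1)) := fun d x hx => by
    have hp : (0 : ℝ) < (1 / 2) ^ d := by positivity
    have hp1 : ((1 : ℝ) / 2) ^ d ≤ 1 := pow_le_one₀ (by norm_num) (by norm_num)
    refine R.shrink_interp (by positivity) hp1 ?_ (by rw [pow_succ]; linarith)
    have h1 : W.nrm 1 (r d) x ≤ C * q * (1 / 2) ^ d :=
      (W.nrm_le_nrm (by omega) _ x).trans (hx.trans (hthalf d))
    have h3 := mul_le_mul_of_nonneg_left h1 (show 0 ≤ A.c by linarith [A.one_lt_c])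
    have h4 := mul_le_mul_of_nonneg_right hsmallC hp.le
    rw [pow_succ]
    nlinarith
  -- the invariant of the iteration
  let P : ∀ d, I (r d) → Prop := fun d x =>
    T.nrm (L + 1) (r d) (x : T.carrier (r d)) ≤ 2 - (1 / 2) ^ d ∧
    T.nrm L (r d) (π.zeta (r d) x) ≤ (t d)⁻¹ ∧
    1 + T.nrm K (r d) (x : T.carrier (r d)) ≤ 2 * t d ^ a
  let φ : ∀ d, I (r d) → G₀ (r d) := fun d x => Φ (r d) (E.smooth (r d) (t d) (V (r d) x))
  let Q : ∀ d, I (r d) → I (r (d + 1)) → Prop := fun d x y =>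
    (y : T.carrier (r (d + 1))) = A.act (r d) (r (d + 1)) (φ d x : W.carrier (r d)) x ∧
    W.nrm (L + 2) (r d) (φ d x : W.carrier (r d)) ≤ C * t d ^ (-1 / 2 : ℝ) ∧
    W.nrm (L + 2) (r d) (Φ (r d) (V (r d) x) : W.carrier (r d)) ≤ C * t d ^ (-1 / 2 : ℝ)
  have h00 : t 0 = t₀ := by simp [ht, smoothingParam]
  have hn : ∀ k f, k ≤ 2 * L - 1 → T.nrm k R f ≤ T.nrm (2 * L - 1) R f := fun k f hk =>
    T.nrm_le_nrm hk R f
  have hP0 : P 0 ⟨T.res (R.interp_le _) ε, hI _ ε hεI⟩ := by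
    refine ⟨?_, ?_, ?_⟩
    · have h1 := (T.nrm_res_le (L + 1) (R.interp_le ((1 / 2) ^ 0)) ε).trans (hn _ ε (by omega))
      refine h1.trans ?_
      rw [pow_zero]
      linarith
    · have h1 : π.zeta (r 0) (T.res (R.interp_le _) ε) = T.res (R.interp_le _) (π.zeta R ε) := by
        simp only [SCIProjection.zeta, map_sub, π.proj_res]
      show T.nrm L (r 0) (π.zeta (r 0) (T.res _ ε)) ≤ (t 0)⁻¹
      rw [h1, h00]
      exact (T.nrm_res_le L _ _).trans hζ.le
    · have h1 := (T.nrm_res_le K (R.interp_le ((1 / 2) ^ 0)) ε).trans (hn _ ε (by omega))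
      have h3 : 1 ≤ t 0 ^ a := Real.one_le_rpow (ht1 0).le ha.le
      show 1 + T.nrm K _ (T.res _ ε) ≤ 2 * t 0 ^ a
      linarith
  obtain ⟨e, he0, he⟩ := exists_seq_of_exists_step P Q _ hP0 (fun d x hx => by
    obtain ⟨hx1, hx2, hx3⟩ := hx
    have htd : 0 < t d := by linarith [ht1 d]
    have hp : (0 : ℝ) < (1 / 2) ^ d := by positivity
    have hz2 : T.nrm L (r d) (π.zeta (r d) x) ≤ 2 * (t d)⁻¹ := by
      have : 0 < (t d)⁻¹ := inv_pos.2 htd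
      linarith
    have hx1' : T.nrm (L + 1) (r d) (x : T.carrier (r d)) ≤ 2 := by linarith
    obtain ⟨hw, hv, hnext⟩ := hC.small (r d) (hρ d) (t d) (ht1 d) x hx1' hz2 hx3
    have hsw := hshrink d _ hw
    have hsv := hshrink d _ hv
    have hgr := hC.growth (r d) (r (d + 1)) (hρ d) (hρ _) (t d) (ht1 d) x hx1' hz2 hsw
    obtain ⟨hn1, hn2⟩ := hnext (r (d + 1)) (hr d) (hρ _) hsw hsv
    refine ⟨⟨A.act (r d) (r (d + 1)) (φ d x : W.carrier (r d)) x,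
      hG₀I _ _ _ _ (φ d x).2 x.2 hsw⟩, ⟨?_, ?_, ?_⟩, rfl, hw, hv⟩
    · have h3 := map_add_le_add (T.nrm (L + 1) (r (d + 1)))
        (A.act (r d) (r (d + 1)) (φ d x : W.carrier (r d)) x - T.res (hr d) x) (T.res (hr d) x)
      rw [sub_add_cancel] at h3
      have h4 := T.nrm_res_le (L + 1) (hr d) (x : T.carrier (r d))
      have h5 := (T.nrm_le_nrm (show L + 1 ≤ L + 2 by omega) _ _).trans hn1
      have h6 := hthalf d
      have h7 := mul_le_mul_of_nonneg_right hCq hp.le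
      show T.nrm (L + 1) (r (d + 1)) (A.act (r d) (r (d + 1)) (φ d x : W.carrier (r d)) x) ≤
        2 - (1 / 2) ^ (d + 1)
      have h8 : T.nrm (L + 1) (r (d + 1)) (A.act (r d) (r (d + 1)) (φ d x : W.carrier (r d)) x -
        T.res (hr d) x) ≤ C * t d ^ (-1 / 2 : ℝ) := h5
      rw [pow_succ]
      linarith
    · refine (T.nrm_le_nrm (show L ≤ L + 1 by omega) _ _).trans (hn2.trans ?_)
      have h3 : C ≤ t d ^ (κ / 2) :=
        hκC.trans (Real.rpow_le_rpow (by linarith) (htt d) (by positivity))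
      calc C * t d ^ (-(1 + κ + κ / 2)) ≤ t d ^ (κ / 2) * t d ^ (-(1 + κ + κ / 2)) :=
            mul_le_mul_of_nonneg_right h3 (by positivity)
        _ = (t (d + 1))⁻¹ := by
            rw [ht, smoothingParam_succ ht₀, ← ht, ← Real.rpow_neg htd.le, ← Real.rpow_add htd]
            ring_nf
    · refine hgr.trans ?_
      have h3 : C ≤ t d := htC.trans (htt d)
      calc C * t d ^ b * (1 + T.nrm K (r d) (x : T.carrier (r d)))
          ≤ t d * t d ^ b * (2 * t d ^ a) := by
            have := T.nrm_nonneg K (r d) (x : T.carrier (r d))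
            gcongr
        _ = 2 * (t d ^ ((b : ℝ) + 1) * t d ^ a) := by
            rw [Real.rpow_add_one htd.ne', Real.rpow_natCast]; ring
        _ = 2 * t (d + 1) ^ a := by
            rw [ht, smoothingParam_succ ht₀, ← ht, ← Real.rpow_mul htd.le, ← Real.rpow_add htd,
              ← hab]
            ring_nf)
  have hL1 : ∀ d, T.nrm (L + 1) (r d) (e d : T.carrier (r d)) ≤ 2 := fun d => by
    have h1 := (he d).1.1
    have : (0 : ℝ) < (1 / 2) ^ d := by positivity
    linarith
  have hZ : ∀ d, T.nrm L (r d) (π.zeta (r d) (e d)) ≤ 2 * (t d)⁻¹ := fun d => by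
    have h1 := (he d).1.2.1
    have : 0 < (t d)⁻¹ := inv_pos.2 (by linarith [ht1 d])
    linarith
  refine ⟨fun d => e d, fun d => φ d (e d), ?_, fun d => (φ d (e d)).2, fun d => (he d).2.1,
    fun d => (W.nrm_le_nrm (by omega) _ _).trans (he d).2.2.1, ?_, fun d => (he d).1.2.1⟩
  · exact congrArg Subtype.val he0
  · exact exists_bound_of_iterates hκ hab hstep ht₀ h2 hρ hr
      (fun d => hshrink d _ (he d).2.2.1) (fun d => hshrink d _ (he d).2.2.2)
      (fun d => (he d).2.1) le_rfl hL1 hZ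

/-! ### Infinite products in a scaled group -/

namespace SCIGroup

variable {W : SCISpace.{v}} (G : SCIGroup W)

theorem exists_mul_le (ρ : Radius) {k : ℕ} (hk : 1 ≤ k) (M : ℝ) :
    ∃ C : ℝ, 0 ≤ C ∧ ∀ j, k / 2 + 1 ≤ j → ∀ r r', ρ ≤ r → ρ ≤ r' → ∀ φ ψ : W.carrier r,
      Radius.Shrink G.c (W.nrm 1 r ψ) r r' → W.nrm j r φ ≤ M → W.nrm j r ψ ≤ M →
      W.nrm k r' (G.mul r r' φ ψ) ≤ C * (W.nrm k r ψ + W.nrm k r φ) := by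
  obtain ⟨P, hP⟩ := G.mul_bound k hk
  obtain ⟨C, hC0, hC⟩ := exists_leibniz_one_le P ρ (2 * M)
  refine ⟨C, hC0, fun j hj r r' hr hr' φ ψ hψ hφM hψM => (hP r r' φ ψ hψ).trans ?_⟩
  refine hC r' r hr' hr k _ (fun j => add_nonneg (W.nrm_nonneg j r _) (W.nrm_nonneg j r _)) ?_
  have h1 := W.nrm_le_nrm hj r φ
  have h2 := W.nrm_le_nrm hj r ψ
  show W.nrm _ r ψ + W.nrm _ r φ ≤ 2 * M
  linarith

theorem exists_mul_sub_le (ρ : Radius) {k : ℕ} (hk : 1 ≤ k) (M : ℝ) :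
    ∃ C : ℝ, 0 ≤ C ∧ ∀ j, (k + 1) / 2 + 1 ≤ j → ∀ (r r') (h : r' ≤ r), ρ ≤ r → ρ ≤ r' →
      ∀ φ ψ : W.carrier r,
      Radius.Shrink G.c (W.nrm 1 r ψ) r r' → W.nrm j r φ ≤ M → W.nrm j r ψ ≤ M →
      W.nrm k r' (G.mul r r' φ ψ - W.res h φ) ≤
        C * (W.nrm k r ψ * (1 + W.nrm (k + 1) r φ)) := by
  obtain ⟨P, hP⟩ := G.mul_sub k hk
  obtain ⟨C, hC0, hC⟩ := exists_leibniz_two_le_mul P ρ (1 + M)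
  refine ⟨C, hC0, fun j hj r r' h hr hr' φ ψ hψ hφM hψM => (hP r r' h φ ψ hψ).trans ?_⟩
  have h1 := W.nrm_le_nrm hj r φ
  have h2 := W.nrm_le_nrm (show k / 2 + 1 ≤ j by omega) r ψ
  exact hC r' r hr' hr k (k + 1) (fun j => W.nrm j r ψ) (fun j => 1 + W.nrm j r φ) hk (by omega)
    (fun j => W.nrm_nonneg j r _)
    (fun j => add_nonneg zero_le_one (W.nrm_nonneg j r _)) (W.nrm_monotone r ψ)
    (fun a b hab => add_le_add le_rfl (W.nrm_monotone r φ hab)) (by linarith) (by linarith)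

theorem exists_inv_sub_inv_le (ρ : Radius) {k : ℕ} (hk : 1 ≤ k) (M : ℝ) :
    ∃ C : ℝ, 0 ≤ C ∧ ∀ j, k / 2 + 1 ≤ j → ∀ r r', ρ ≤ r → ρ ≤ r' → ∀ ψ φ : W.carrier r,
      Radius.Shrink G.c (W.nrm 1 r ψ) r r' → Radius.Shrink G.c (W.nrm 1 r φ) r r' →
      W.nrm j r (ψ - φ) ≤ M → W.nrm j r φ ≤ M →
      W.nrm k r' (G.inv r r' ψ - G.inv r r' φ) ≤ C * (W.nrm k r (ψ - φ) * (1 + W.nrm k r φ)) := by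
  obtain ⟨P, hP⟩ := G.inv_sub_inv k hk
  obtain ⟨C, hC0, hC⟩ := exists_leibniz_two_le_mul P ρ (1 + M)
  refine ⟨C, hC0, fun j hj r r' hr hr' ψ φ hψ hφ hdM hφM => (hP r r' ψ φ hψ hφ).trans ?_⟩
  have h1 := W.nrm_le_nrm hj r φ
  have h2 := W.nrm_le_nrm hj r (ψ - φ)
  exact hC r' r hr' hr k k (fun j => W.nrm j r (ψ - φ)) (fun j => 1 + W.nrm j r φ) hk hk
    (fun j => W.nrm_nonneg j r _)
    (fun j => add_nonneg zero_le_one (W.nrm_nonneg j r _)) (W.nrm_monotone r _)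
    (fun a b hab => add_le_add le_rfl (W.nrm_monotone r φ hab)) (by linarith) (by linarith)

theorem mul_one {r r' : Radius} (h : r' ≤ r) (φ : W.carrier r) :
    G.mul r r' φ 0 = W.res h φ := by
  obtain ⟨C, -, hC⟩ := G.exists_mul_sub_le r' (le_refl 1) (W.nrm 2 r φ)
  have h1 := hC 2 (by norm_num) r r' h h le_rfl φ 0
    (by rw [map_zero]; exact Radius.shrink_zero _ h) le_rfl
    (by rw [map_zero]; exact W.nrm_nonneg _ _ _)
  rw [map_zero, zero_mul, mul_zero] at h1
  exact sub_eq_zero.1 (W.eq_zero_of_nrm 1 r' _ (le_antisymm h1 (W.nrm_nonneg _ _ _)))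

theorem inv_one {r r' : Radius} (h : r' ≤ r) : G.inv r r' 0 = 0 := by
  have hs : ∀ {x y : Radius}, y ≤ x → Radius.Shrink G.c (W.nrm 1 r 0) x y := fun hxy => by
    rw [map_zero]; exact Radius.shrink_zero _ hxy
  have h1 := G.inv_mul h 0 (hs h) (hs (le_refl r'))
  rwa [map_zero, G.mul_one le_rfl, W.res_refl] at h1

theorem exists_inv_le (ρ : Radius) {k : ℕ} (hk : 1 ≤ k) (M : ℝ) :
    ∃ C : ℝ, 0 ≤ C ∧ ∀ j, k / 2 + 1 ≤ j → ∀ r r', ρ ≤ r → ρ ≤ r' → ∀ φ : W.carrier r,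
      Radius.Shrink G.c (W.nrm 1 r φ) r r' → W.nrm j r φ ≤ M →
      W.nrm k r' (G.inv r r' φ) ≤ C * W.nrm k r φ := by
  obtain ⟨C, hC0, hC⟩ := G.exists_inv_sub_inv_le ρ hk M
  refine ⟨C, hC0, fun j hj r r' hr hr' φ hφ hφM => ?_⟩
  have hr'r : r' ≤ r := Radius.le_of_shrink (by linarith [G.one_lt_c]) (W.nrm_nonneg _ _ _) hφ
  have h := hC j hj r r' hr hr' φ 0 hφ (by rw [map_zero]; exact Radius.shrink_zero _ hr'r)
    (by rwa [sub_zero]) (by rw [map_zero]; exact (W.nrm_nonneg _ _ _).trans hφM)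
  rw [G.inv_one hr'r, sub_zero, sub_zero, map_zero, add_zero, _root_.mul_one] at h
  exact h

/-- The partial products `ψ (d + 1) = ψ d · θ d` of a rapidly converging sequence of factors. The
norms of the partial products grow at most geometrically, which is slower than any power of the
smoothing parameter, so that the small size of the factors makes the increments summable. -/
theorem exists_partialProduct_bound (ρ : Radius) {κ : ℝ} (hκ : 0 < κ) {C : ℝ} (hC : 0 ≤ C) :
    ∃ D : ℝ, 0 ≤ D ∧ ∀ᶠ t₀ : ℝ in atTop, ∀ (r b : ℕ → Radius) (hbr : ∀ d, b d ≤ r d)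
      (hrb : ∀ d, r (d + 1) ≤ b d) (_ : ∀ d, ρ ≤ r d) (θ : ∀ d, W.carrier (b d))
      (ψ : ∀ d, W.carrier (r d)), (∀ d, Radius.Shrink G.c (W.nrm 1 (b d) (θ d)) (b d) (r (d + 1))) →
      ψ 0 = 0 → (∀ d, ψ (d + 1) = G.mul (b d) (r (d + 1)) (W.res (hbr d) (ψ d)) (θ d)) →
      (∀ d, W.nrm 4 (b d) (θ d) ≤ C * smoothingParam t₀ κ d ^ (-1 / 2 : ℝ)) →
      (∀ k, ∃ M : ℝ, ∀ d, W.nrm k (b d) (θ d) ≤ M * smoothingParam t₀ κ d ^ (-1 / 2 : ℝ)) →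
      (∀ d, W.nrm 3 (r d) (ψ d) ≤ D * t₀ ^ (-1 / 4 : ℝ)) ∧
      ∀ k, ∃ M : ℝ, ∀ d, W.nrm k (r (d + 1)) (ψ (d + 1) - W.res ((hrb d).trans (hbr d)) (ψ d)) ≤
        M * (1 / 2) ^ d := by
  obtain ⟨C₃, hC₃0, hC₃⟩ := G.exists_mul_sub_le ρ (show 1 ≤ 3 by norm_num) 1
  obtain ⟨C₄, hC₄0, hC₄⟩ := G.exists_mul_le ρ (show 1 ≤ 4 by norm_num) 1
  refine ⟨2 * (C₃ * C), by positivity, ?_⟩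
  have lim1 : Tendsto (fun t₀ : ℝ => t₀ ^ (κ / 4)) atTop atTop := tendsto_rpow_atTop (by positivity)
  have lim3 : Tendsto (fun t₀ : ℝ => (C + 2 * (C₃ * C)) * t₀ ^ (-1 / 4 : ℝ)) atTop (𝓝 0) := by
    have : Tendsto (fun t₀ : ℝ => t₀ ^ (-(1 / 4) : ℝ)) atTop (𝓝 0) :=
      tendsto_rpow_neg_atTop (by norm_num)
    simpa [neg_div] using this.const_mul (C + 2 * (C₃ * C))
  filter_upwards [eventually_gt_atTop 1, lim1.eventually_ge_atTop 2,
    lim1.eventually_ge_atTop (1 + C₄ + C₄ * C),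
    lim3.eventually (ge_mem_nhds (show (0 : ℝ) < 1 by norm_num))]
    with t₀ ht₀ h2 hκC hq1 r b hbr hrb hρ θ ψ hsh hψ0 hψ hθ4 hθ
  set t := smoothingParam t₀ κ with ht
  have ht1 : ∀ d, 1 < t d := one_lt_smoothingParam ht₀ hκ
  have htpos : ∀ d, 0 < t d := fun d => by linarith [ht1 d]
  have htt : ∀ d, t₀ ≤ t d := le_smoothingParam ht₀ hκ
  set q : ℝ := t₀ ^ (-1 / 4 : ℝ) with hq
  have hq0 : 0 ≤ q := Real.rpow_nonneg (by linarith) _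
  have hqle1 : q ≤ 1 := Real.rpow_le_one_of_one_le_of_nonpos ht₀.le (by norm_num)
  have hρb : ∀ d, ρ ≤ b d := fun d => (hρ (d + 1)).trans (hrb d)
  have hquarter : ∀ d, t d ^ (-1 / 2 : ℝ) * t d ^ (1 / 4 : ℝ) ≤ q * (1 / 2) ^ d := fun d => by
    rw [← Real.rpow_add (htpos d)]
    have := smoothingParam_rpow_le ht₀ hκ h2 d
    rw [← ht] at this
    convert this using 2
    norm_num
  have hhalf1 : ∀ d, t d ^ (-1 / 2 : ℝ) ≤ 1 := fun d =>
    Real.rpow_le_one_of_one_le_of_nonpos (ht1 d).le (by norm_num)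
  have hhalfq : ∀ d, t d ^ (-1 / 2 : ℝ) ≤ q := fun d =>
    (smoothingParam_neg_half_le ht₀ hκ h2 d).trans
      (mul_le_of_le_one_right hq0 (pow_le_one₀ (by norm_num) (by norm_num)))
  have hres : ∀ k d, W.nrm k (b d) (W.res (hbr d) (ψ d)) ≤ W.nrm k (r d) (ψ d) := fun k d =>
    W.nrm_res_le k _ _
  have hdiff : ∀ k d, W.nrm k (r (d + 1)) (ψ (d + 1)) ≤ W.nrm k (r (d + 1))
      (ψ (d + 1) - W.res ((hrb d).trans (hbr d)) (ψ d)) + W.nrm k (r d) (ψ d) := fun k d => by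
    have h3 := map_add_le_add (W.nrm k (r (d + 1)))
      (ψ (d + 1) - W.res ((hrb d).trans (hbr d)) (ψ d)) (W.res ((hrb d).trans (hbr d)) (ψ d))
    rw [sub_add_cancel] at h3
    have h4 := W.nrm_res_le k ((hrb d).trans (hbr d)) (ψ d)
    linarith
  have hCC₃ : 0 ≤ C₃ * C := by positivity
  -- the increments in degree `k` are controlled by the growth in degree `k + 1`
  have hincr : ∀ (k : ℕ) (B M Y : ℝ), 0 ≤ B → 0 ≤ M → 0 ≤ Y → ∀ d,
      W.nrm k (r (d + 1)) (ψ (d + 1) - W.res ((hrb d).trans (hbr d)) (ψ d)) ≤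
        B * (W.nrm k (b d) (θ d) * (1 + W.nrm (k + 1) (b d) (W.res (hbr d) (ψ d)))) →
      W.nrm k (b d) (θ d) ≤ M * t d ^ (-1 / 2 : ℝ) →
      1 + W.nrm (k + 1) (r d) (ψ d) ≤ Y * t d ^ (1 / 4 : ℝ) →
      W.nrm k (r (d + 1)) (ψ (d + 1) - W.res ((hrb d).trans (hbr d)) (ψ d)) ≤
        B * M * Y * q * (1 / 2) ^ d := by
    intro k B M Y hB hM hY d h1 h3 h4
    have := htpos d
    have h5 := hres (k + 1) d
    calc _ ≤ B * ((M * t d ^ (-1 / 2 : ℝ)) * (Y * t d ^ (1 / 4 : ℝ))) := by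
          refine h1.trans (mul_le_mul_of_nonneg_left (mul_le_mul h3 (by linarith) ?_
            (by positivity)) hB)
          linarith [W.nrm_nonneg (k + 1) (b d) (W.res (hbr d) (ψ d))]
      _ = B * M * Y * (t d ^ (-1 / 2 : ℝ) * t d ^ (1 / 4 : ℝ)) := by ring
      _ ≤ B * M * Y * (q * (1 / 2) ^ d) := by
          have := hquarter d
          gcongr
      _ = _ := by ring
  have base : ∀ d, W.nrm 3 (r d) (ψ d) ≤ 2 * (C₃ * C * q) * (1 - (1 / 2) ^ d) ∧
      1 + W.nrm 4 (r d) (ψ d) ≤ t d ^ (1 / 4 : ℝ) := by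
    intro d
    induction d with
    | zero =>
      rw [hψ0, map_zero, map_zero]
      exact ⟨by norm_num, by
        rw [add_zero]; exact Real.one_le_rpow (ht1 0).le (by norm_num)⟩
    | succ d ih =>
      obtain ⟨ih3, ih4⟩ := ih
      have hp : (0 : ℝ) ≤ (1 / 2) ^ d := by positivity
      have hψ3 : W.nrm 3 (b d) (W.res (hbr d) (ψ d)) ≤ 1 := by
        have h1 := hres 3 d
        have h3 : 2 * (C₃ * C * q) * (1 - (1 / 2) ^ d) ≤ 2 * (C₃ * C * q) :=
          mul_le_of_le_one_right (by positivity) (by linarith)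
        have h4 : 0 ≤ C * q := mul_nonneg hC hq0
        linarith
      have hθ41 : W.nrm 4 (b d) (θ d) ≤ 1 := by
        have h3 := mul_le_mul_of_nonneg_left (hhalfq d) hC
        have h4 : 0 ≤ C₃ * C * q := mul_nonneg hCC₃ hq0
        linarith [hθ4 d]
      have hθ31 : W.nrm 3 (b d) (θ d) ≤ 1 := (W.nrm_le_nrm (by norm_num) _ _).trans hθ41
      constructor
      · have h1 := hC₃ 3 (by norm_num) (b d) (r (d + 1)) (hrb d) (hρb d) (hρ _)
          (W.res (hbr d) (ψ d)) (θ d) (hsh d) hψ3 hθ31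
        rw [← hψ, W.res_res] at h1
        have h5 := hincr 3 C₃ C 1 hC₃0 hC zero_le_one d h1
          ((W.nrm_le_nrm (by norm_num) _ _).trans (hθ4 d)) (by rwa [one_mul])
        have h6 := hdiff 3 d
        rw [pow_succ]
        linarith
      · have h1 := hC₄ 3 (by norm_num) (b d) (r (d + 1)) (hρb d) (hρ _)
          (W.res (hbr d) (ψ d)) (θ d) (hsh d) hψ3 hθ31
        rw [← hψ] at h1
        have h5 := hres 4 d
        have h6 : W.nrm 4 (b d) (θ d) ≤ C :=
          (hθ4 d).trans (mul_le_of_le_one_right hC (hhalf1 d))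
        have n4 := W.nrm_nonneg 4 (r d) (ψ d)
        have htd := htpos d
        calc 1 + W.nrm 4 (r (d + 1)) (ψ (d + 1)) ≤ 1 + C₄ * (C + W.nrm 4 (r d) (ψ d)) := by
              have := mul_le_mul_of_nonneg_left (add_le_add h6 h5) hC₄0
              linarith
          _ ≤ (1 + C₄ + C₄ * C) * (1 + W.nrm 4 (r d) (ψ d)) := by
              nlinarith [mul_nonneg hC₄0 n4, mul_nonneg (mul_nonneg hC₄0 hC) n4]
          _ ≤ t d ^ (κ / 4) * t d ^ (1 / 4 : ℝ) := by
              have := hκC.trans (Real.rpow_le_rpow (by linarith) (htt d)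
                (show 0 ≤ κ / 4 by positivity))
              exact mul_le_mul this ih4 (by linarith) (by positivity)
          _ = t (d + 1) ^ (1 / 4 : ℝ) := by
              rw [ht, smoothingParam_succ ht₀, ← ht, ← Real.rpow_mul htd.le, ← Real.rpow_add htd]
              ring_nf
  have step : ∀ k, 3 ≤ k → ∀ M : ℝ, (∀ d, W.nrm k (r d) (ψ d) ≤ M) → ∃ M' : ℝ, 0 ≤ M' ∧ ∀ d,
      W.nrm (k + 1) (r (d + 1)) (ψ (d + 1) - W.res ((hrb d).trans (hbr d)) (ψ d)) ≤
        M' * (1 / 2) ^ d := by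
    intro k hk M hM
    obtain ⟨N, hN⟩ := hθ (k + 2)
    have hNθ : ∀ d, W.nrm (k + 2) (b d) (θ d) ≤ |N| * t d ^ (-1 / 2 : ℝ) := fun d =>
      (hN d).trans (mul_le_mul_of_nonneg_right (le_abs_self N)
        (Real.rpow_nonneg (htpos d).le _))
    have hN1 : ∀ d, W.nrm (k + 2) (b d) (θ d) ≤ |N| := fun d =>
      (hNθ d).trans (mul_le_of_le_one_right (abs_nonneg N) (hhalf1 d))
    obtain ⟨B₁, hB₁0, hB₁⟩ := G.exists_mul_le ρ (show 1 ≤ k + 2 by omega) (max M |N|)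
    obtain ⟨B₂, hB₂0, hB₂⟩ := G.exists_mul_sub_le ρ (show 1 ≤ k + 1 by omega) (max M |N|)
    have hψk : ∀ d, W.nrm k (b d) (W.res (hbr d) (ψ d)) ≤ max M |N| := fun d =>
      ((hres k d).trans (hM d)).trans (le_max_left _ _)
    have hθk : ∀ d, W.nrm k (b d) (θ d) ≤ max M |N| := fun d =>
      ((W.nrm_le_nrm (by omega) _ _).trans (hN1 d)).trans (le_max_right _ _)
    obtain ⟨Y, hY0, hY⟩ := exists_le_smoothingParam_rpow ht₀ hκ (a := 1 / 4) (b := 0)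
      (by rw [Nat.cast_zero]; positivity) (C := 1 + B₁ + B₁ * |N|)
      (y := fun d => 1 + W.nrm (k + 2) (r d) (ψ d))
      (fun d => by linarith [W.nrm_nonneg (k + 2) (r d) (ψ d)])
      (fun d => by
        have h1 := hB₁ k (by omega) (b d) (r (d + 1)) (hρb d) (hρ _)
          (W.res (hbr d) (ψ d)) (θ d) (hsh d) (hψk d) (hθk d)
        rw [← hψ] at h1
        have h5 := hres (k + 2) d
        have n4 := W.nrm_nonneg (k + 2) (r d) (ψ d)
        have := mul_le_mul_of_nonneg_left (add_le_add (hN1 d) h5) hB₁0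
        show 1 + W.nrm (k + 2) (r (d + 1)) (ψ (d + 1)) ≤
          (1 + B₁ + B₁ * |N|) * _ ^ 0 * (1 + W.nrm (k + 2) (r d) (ψ d))
        rw [pow_zero, _root_.mul_one]
        nlinarith [mul_nonneg hB₁0 n4, mul_nonneg (mul_nonneg hB₁0 (abs_nonneg N)) n4])
    refine ⟨B₂ * |N| * Y * q, by positivity, fun d => ?_⟩
    have h1 := hB₂ k (by omega) (b d) (r (d + 1)) (hrb d) (hρb d) (hρ _)
      (W.res (hbr d) (ψ d)) (θ d) (hsh d) (hψk d) (hθk d)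
    rw [← hψ, W.res_res] at h1
    exact hincr (k + 1) B₂ |N| Y hB₂0 (abs_nonneg N) hY0 d h1
      ((W.nrm_le_nrm (by omega) _ _).trans (hNθ d)) (hY d)
  have all : ∀ k, 3 ≤ k → ∃ M : ℝ, ∀ d, W.nrm k (r d) (ψ d) ≤ M := by
    intro k hk
    induction k, hk using Nat.le_induction with
    | base =>
      refine ⟨2 * (C₃ * C * q), fun d => (base d).1.trans ?_⟩
      have hp : (0 : ℝ) ≤ (1 / 2) ^ d := by positivity
      exact mul_le_of_le_one_right (by positivity) (by linarith)
    | succ k hk ih =>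
      obtain ⟨M, hM⟩ := ih
      obtain ⟨M', hM'0, hM'⟩ := step k hk M hM
      refine ⟨W.nrm (k + 1) (r 0) (ψ 0) + 2 * M', fun d => ?_⟩
      have h := le_add_of_increment_le (x := fun d => W.nrm (k + 1) (r d) (ψ d)) (c := M')
        (fun d => by linarith [hdiff (k + 1) d, hM' d]) d
      have hp : (0 : ℝ) ≤ (1 / 2) ^ d := by positivity
      refine h.trans (add_le_add le_rfl (mul_le_of_le_one_right (by positivity) (by linarith)))
  refine ⟨fun d => (base d).1.trans ?_, fun k => ?_⟩
  · have hp : (0 : ℝ) ≤ (1 / 2) ^ d := by positivity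
    rw [_root_.mul_assoc 2 (C₃ * C) q]
    exact mul_le_of_le_one_right (by positivity) (by linarith)
  · obtain ⟨M, hM⟩ := all (k + 3) (by omega)
    obtain ⟨M', -, hM'⟩ := step (k + 3) (by omega) M hM
    exact ⟨M', fun d => (W.nrm_le_nrm (by omega) _ _).trans (hM' d)⟩

end SCIGroup

/-- Elements on shrinking radii with summable increments converge on every common smaller
radius. -/
theorem SCISpace.exists_tendsto_of_increment (H : SCISpace.{u}) {r : ℕ → Radius}
    (hr : ∀ d, r (d + 1) ≤ r d) {σ : Radius} (hσ : ∀ d, σ ≤ r d) (f : ∀ d, H.carrier (r d))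
    (hf : ∀ k, ∃ M : ℝ, ∀ d, H.nrm k (r (d + 1)) (f (d + 1) - H.res (hr d) (f d)) ≤
      M * (1 / 2) ^ d) :
    ∃ g : H.carrier σ, ∀ k, Tendsto (fun d => H.nrm k σ (H.res (hσ d) (f d) - g)) atTop (𝓝 0) := by
  refine H.complete σ (fun d => H.res (hσ d) (f d)) fun k η hη => ?_
  obtain ⟨M, hM⟩ := hf k
  set F : ℕ → H.carrier σ := fun d => H.res (hσ d) (f d) with hF
  have hstep : ∀ d, H.nrm k σ (F (d + 1) - F d) ≤ |M| * (1 / 2) ^ d := fun d => by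
    have h1 : F (d + 1) - F d = H.res (hσ (d + 1)) (f (d + 1) - H.res (hr d) (f d)) := by
      rw [map_sub, H.res_res]
    rw [h1]
    refine (H.nrm_res_le k _ _).trans ((hM d).trans ?_)
    exact mul_le_mul_of_nonneg_right (le_abs_self M) (by positivity)
  have hdist : ∀ n i, H.nrm k σ (F (n + i) - F n) ≤ 2 * |M| * (1 / 2) ^ n := fun n i => by
    have h := le_add_of_increment_le (x := fun i => H.nrm k σ (F (n + i) - F n))
      (c := |M| * (1 / 2) ^ n) (fun i => by
        have h1 := map_add_le_add (H.nrm k σ) (F (n + i) - F n) (F (n + i + 1) - F (n + i))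
        rw [show F (n + i) - F n + (F (n + i + 1) - F (n + i)) = F (n + (i + 1)) - F n by
          rw [← add_assoc]; abel] at h1
        have h3 := hstep (n + i)
        rw [pow_add] at h3
        show H.nrm k σ (F (n + (i + 1)) - F n) ≤ _
        linarith) i
    have hp : (0 : ℝ) ≤ (1 / 2) ^ i := by positivity
    have h0 : H.nrm k σ (F (n + 0) - F n) = 0 := by simp
    refine h.trans ?_
    rw [h0, zero_add, mul_assoc 2 |M|]
    exact mul_le_of_le_one_right (by positivity) (by linarith)
  have hlim : Tendsto (fun n : ℕ => 2 * (2 * |M| * (1 / 2 : ℝ) ^ n)) atTop (𝓝 0) := by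
    have : Tendsto (fun n : ℕ => (1 / 2 : ℝ) ^ n) atTop (𝓝 0) :=
      tendsto_pow_atTop_nhds_zero_of_lt_one (by norm_num) (by norm_num)
    simpa using (this.const_mul (2 * |M|)).const_mul 2
  obtain ⟨N, hN⟩ := (hlim.eventually (gt_mem_nhds hη)).exists
  refine ⟨N, fun m hm n hn => ?_⟩
  obtain ⟨i, rfl⟩ := Nat.exists_eq_add_of_le hm
  obtain ⟨j, rfl⟩ := Nat.exists_eq_add_of_le hn
  have h1 := map_sub_le_add (H.nrm k σ) (F (N + i) - F N) (F (N + j) - F N)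
  rw [sub_sub_sub_cancel_right] at h1
  have h2 := hdist N i
  have h3 := hdist N j
  show H.nrm k σ (F (N + i) - F (N + j)) < η
  linarith

/-! ### The group action along the iteration -/

theorem Radius.Shrink.mono {c x c' x' : ℝ} {r r' : Radius} (h : Radius.Shrink c' x' r r')
    (hx : c * x ≤ c' * x') : Radius.Shrink c x r r' := by
  have h1 : (r' : ℝ) ≤ (r : ℝ) * (1 - c' * x') := h
  have h2 := mul_le_mul_of_nonneg_left hx r.2.1.le
  show (r' : ℝ) ≤ (r : ℝ) * (1 - c * x)
  linarith

theorem Radius.Shrink.trans_le {c x : ℝ} {r r' r'' : Radius} (h : Radius.Shrink c x r r')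
    (h' : r'' ≤ r') : Radius.Shrink c x r r'' :=
  le_trans (show (r'' : ℝ) ≤ r' from h') h

/-- Acting by `φ` and then by `φ⁻¹` gives back `f`, on smaller radii. Only the left action law is
used, in the intermediate radius `m`. -/
theorem SCIAction.inv_act_act {W : SCISpace.{v}} {G : SCIGroup W} {T : SCISpace.{u}}
    (A : SCIAction G T)
    (hA : ∀ {r r₁ r₂ r' : Radius} (h₁ : r₁ ≤ r) (h₂ : r₂ ≤ r) (ψ φ : W.carrier r) (f : T.carrier r),
      Radius.Shrink A.c (W.nrm 1 r φ) r r₁ →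
      Radius.Shrink A.c (W.nrm 1 r₁ (W.res h₁ ψ)) r₁ r' →
      Radius.Shrink G.c (W.nrm 1 r φ) r r₂ →
      Radius.Shrink A.c (W.nrm 1 r₂ (G.mul r r₂ ψ φ)) r₂ r' →
      A.act r₁ r' (W.res h₁ ψ) (A.act r r₁ φ f) = A.act r₂ r' (G.mul r r₂ ψ φ) (T.res h₂ f))
    {r b m r' : Radius} (hbr : b ≤ r) (hmb : m ≤ b) (hr'm : r' ≤ m) {z : ℝ}
    (hb : Radius.Shrink 1 z r b) (hm : Radius.Shrink 1 z b m) (hr' : Radius.Shrink 1 z m r')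
    (φ : W.carrier r) (f : T.carrier r)
    (hAφ : A.c * W.nrm 1 r φ ≤ z) (hGφ : G.c * W.nrm 1 r φ ≤ z)
    (hAθ : A.c * W.nrm 1 b (G.inv r b φ) ≤ z) :
    A.act b r' (G.inv r b φ) (A.act r b φ f) = T.res ((hr'm.trans hmb).trans hbr) f := by
  have hA0 : 0 ≤ A.c := by linarith [A.one_lt_c]
  have hG0 : 0 ≤ G.c := by linarith [G.one_lt_c]
  have hAφb : A.c * W.nrm 1 b (W.res hbr φ) ≤ z :=
    (mul_le_mul_of_nonneg_left (W.nrm_res_le 1 hbr φ) hA0).trans hAφ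
  have hGφb : G.c * W.nrm 1 b (W.res hbr φ) ≤ z :=
    (mul_le_mul_of_nonneg_left (W.nrm_res_le 1 hbr φ) hG0).trans hGφ
  have hAθm : A.c * W.nrm 1 m (W.res hmb (G.inv r b φ)) ≤ z :=
    (mul_le_mul_of_nonneg_left (W.nrm_res_le 1 hmb _) hA0).trans hAθ
  have hmul : G.mul b m (G.inv r b φ) (W.res hbr φ) = 0 :=
    G.inv_mul hbr φ (hb.mono (by linarith)) (hm.mono (by linarith))
  have law := hA hmb hmb (G.inv r b φ) (W.res hbr φ) (T.res hbr f) (r' := r')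
    (hm.mono (by linarith)) (hr'.mono (by linarith)) (hm.mono (by linarith))
    (by rw [hmul, map_zero]; exact Radius.shrink_zero _ hr'm)
  rw [hmul, A.one_act hr'm, T.res_res, T.res_res,
    A.act_res hbr φ f ((hb.mono (by linarith)).trans_le hmb) (hm.mono (by linarith)),
    ← A.res_act hmb φ f (hb.mono (by linarith)),
    A.act_res hmb _ _ ((hm.trans_le hr'm).mono (by linarith)) (hr'.mono (by linarith))] at law
  exact law

/-- An element which is a limit of elements that move `f` to elements with arbitrarily small error
moves `f` into the kernel of `ζ`. -/
theorem TameEstimates.act_mem_of_tendsto {T : SCISpace.{u}} {F : SCISubspace T}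
    {π : SCIProjection F}
    {I : ∀ r, Set (T.carrier r)} {W : SCISpace.{v}} {G : SCIGroup W} {A : SCIAction G T}
    {G₀ : ∀ r, Set (W.carrier r)} {E : SCISpace.{w}} {V : ∀ r, I r → E.carrier r}
    {Φ : ∀ r, E.carrier r → G₀ r} {s s' m k₁ : ℕ} {δ : ℝ} {ρ : Radius}
    (H : TameEstimates π I A V Φ s s' m k₁ δ ρ) (hk₁ : 1 ≤ k₁) {r r' : Radius} (hr : ρ ≤ r)
    (hr' : ρ ≤ r') {ψ : W.carrier r} {ψs : ℕ → W.carrier r} (f : T.carrier r)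
    (hψ : Radius.Shrink A.c (W.nrm 1 r ψ) r r')
    (hψs : ∀ d, Radius.Shrink A.c (W.nrm 1 r (ψs d)) r r')
    (hlim : ∀ k, Tendsto (fun d => W.nrm k r (ψs d - ψ)) atTop (𝓝 0))
    (hζ : Tendsto (fun d => T.nrm 1 r' (π.zeta r' (A.act r r' (ψs d) f))) atTop (𝓝 0)) :
    A.act r r' ψ f ∈ F.carrier r' := by
  set j := (k₁ + s') / 2 + 1 with hj
  set M : ℝ := 1 + T.nrm j r f + W.nrm j r ψ with hM
  have nf := T.nrm_nonneg j r f
  have nψ := W.nrm_nonneg j r ψ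
  obtain ⟨C, hC0, hC⟩ := H.sub_act_le k₁ le_rfl M
  obtain ⟨D, hD0, hD⟩ := H.zeta_le k₁ le_rfl 1
  set B : ℝ := C * ((1 + T.nrm (k₁ + s') r f) * (1 + W.nrm (k₁ + s') r ψ)) with hB
  have lim1 : Tendsto (fun d => B * W.nrm (k₁ + s') r (ψs d - ψ)) atTop (𝓝 0) := by
    simpa using (hlim (k₁ + s')).const_mul B
  have hev : ∀ᶠ d in atTop, T.nrm 1 r' (π.zeta r' (A.act r r' ψ f)) ≤
      T.nrm 1 r' (π.zeta r' (A.act r r' (ψs d) f)) +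
        D * (B * W.nrm (k₁ + s') r (ψs d - ψ)) := by
    filter_upwards [(hlim j).eventually (ge_mem_nhds one_pos),
      lim1.eventually (ge_mem_nhds one_pos)] with d hd1 hd2
    have h1 : T.nrm k₁ r' (A.act r r' (ψs d) f - A.act r r' ψ f) ≤
        B * W.nrm (k₁ + s') r (ψs d - ψ) := by
      refine (hC j le_rfl r r' hr hr' (ψs d) ψ f (hψs d) hψ (by linarith) (by linarith)
        (by linarith)).trans (le_of_eq ?_)
      rw [hB]; ring
    have h2 := hD k₁ (by omega) r' hr' _ (h1.trans hd2)
    have h3 : π.zeta r' (A.act r r' ψ f) = π.zeta r' (A.act r r' (ψs d) f) -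
        π.zeta r' (A.act r r' (ψs d) f - A.act r r' ψ f) := by
      simp only [SCIProjection.zeta, map_sub, Submodule.coe_sub]
      abel
    rw [h3]
    have h4 := map_sub_le_add (T.nrm 1 r') (π.zeta r' (A.act r r' (ψs d) f))
      (π.zeta r' (A.act r r' (ψs d) f - A.act r r' ψ f))
    have h5 := T.nrm_le_nrm hk₁ r' (π.zeta r' (A.act r r' (ψs d) f - A.act r r' ψ f))
    have h6 := mul_le_mul_of_nonneg_left h1 hD0
    linarith
  have hle : T.nrm 1 r' (π.zeta r' (A.act r r' ψ f)) ≤ 0 := by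
    refine ge_of_tendsto ?_ hev
    simpa using hζ.add (lim1.const_mul D)
  have hz := T.eq_zero_of_nrm 1 r' _ (le_antisymm hle (T.nrm_nonneg _ _ _))
  rw [SCIProjection.zeta, sub_eq_zero] at hz
  rw [hz]
  exact Submodule.coe_mem _

/-- A partial product `ψ d` of the iteration, for a right action, moves the initial element to the
`d`-th iterate. The radii on which this holds are a fixed proportion of those of the iterates. -/
theorem SCIAction.act_partialProduct_right {W : SCISpace.{v}} {G : SCIGroup W} {T : SCISpace.{u}}
    (A : SCIAction G T)
    (hA : ∀ {r r₁ r₂ r' : Radius} (h₁ : r₁ ≤ r) (h₂ : r₂ ≤ r) (ψ φ : W.carrier r) (f : T.carrier r),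
      Radius.Shrink A.c (W.nrm 1 r ψ) r r₁ →
      Radius.Shrink A.c (W.nrm 1 r₁ (W.res h₁ φ)) r₁ r' →
      Radius.Shrink G.c (W.nrm 1 r φ) r r₂ →
      Radius.Shrink A.c (W.nrm 1 r₂ (G.mul r r₂ ψ φ)) r₂ r' →
      A.act r₁ r' (W.res h₁ φ) (A.act r r₁ ψ f) = A.act r₂ r' (G.mul r r₂ ψ φ) (T.res h₂ f))
    {r ρ : ℕ → Radius} (hr : ∀ d, r (d + 1) ≤ r d) (hρr : ∀ d, ρ d ≤ r d)
    {φ ψ : ∀ d, W.carrier (r d)} {e : ∀ d, T.carrier (r d)}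
    (hAr : ∀ d, Radius.Shrink A.c (W.nrm 1 (r d) (φ d)) (r d) (r (d + 1)))
    (hGr : ∀ d, Radius.Shrink G.c (W.nrm 1 (r d) (φ d)) (r d) (r (d + 1)))
    (hAρ : ∀ d, Radius.Shrink A.c (W.nrm 1 (r d) (φ d)) (ρ d) (ρ (d + 1)))
    (hψr : ∀ d, Radius.Shrink A.c (W.nrm 1 (r d) (ψ d)) (r d) (ρ d))
    (he : ∀ d, e (d + 1) = A.act (r d) (r (d + 1)) (φ d) (e d))
    (hψ0 : ψ 0 = 0) (hψ : ∀ d, ψ (d + 1) = G.mul (r d) (r (d + 1)) (ψ d) (φ d))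
    (hr0 : ∀ d, r d ≤ r 0) (d : ℕ) :
    A.act (r d) (ρ d) (ψ d) (T.res (hr0 d) (e 0)) = T.res (hρr d) (e d) := by
  have hA0 : 0 ≤ A.c := by linarith [A.one_lt_c]
  induction d with
  | zero => rw [hψ0, A.one_act (hρr 0), T.res_refl]
  | succ d ih =>
    have hφρ : Radius.Shrink A.c (W.nrm 1 (ρ d) (W.res (hρr d) (φ d))) (ρ d) (ρ (d + 1)) :=
      (hAρ d).mono (mul_le_mul_of_nonneg_left (W.nrm_res_le 1 _ _) hA0)
    have law := hA (hρr d) (hr d) (ψ d) (φ d) (T.res (hr0 d) (e 0)) (r' := ρ (d + 1))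
      (hψr d) hφρ (hGr d) (by rw [← hψ]; exact hψr (d + 1))
    rw [ih, A.act_res (hρr d) (φ d) (e d) ((hAr d).trans_le (hρr (d + 1))) hφρ,
      ← A.res_act (hρr (d + 1)) (φ d) (e d) (hAr d), ← he, ← hψ, T.res_res] at law
    exact law.symm

/-- The partial products `χ (d + 1) = χ d · (φ d)⁻¹` of the inverses, for a left action, move the
`d`-th iterate back to the initial element. -/
theorem SCIAction.act_partialProduct_left {W : SCISpace.{v}} {G : SCIGroup W} {T : SCISpace.{u}}
    (A : SCIAction G T)
    (hA : ∀ {r r₁ r₂ r' : Radius} (h₁ : r₁ ≤ r) (h₂ : r₂ ≤ r) (ψ φ : W.carrier r) (f : T.carrier r),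
      Radius.Shrink A.c (W.nrm 1 r φ) r r₁ →
      Radius.Shrink A.c (W.nrm 1 r₁ (W.res h₁ ψ)) r₁ r' →
      Radius.Shrink G.c (W.nrm 1 r φ) r r₂ →
      Radius.Shrink A.c (W.nrm 1 r₂ (G.mul r r₂ ψ φ)) r₂ r' →
      A.act r₁ r' (W.res h₁ ψ) (A.act r r₁ φ f) = A.act r₂ r' (G.mul r r₂ ψ φ) (T.res h₂ f))
    {r b m ρ : ℕ → Radius} (hbr : ∀ d, b d ≤ r d) (hmb : ∀ d, m d ≤ b d)
    (hrm : ∀ d, r (d + 1) ≤ m d) (hρ : ∀ d, ρ (d + 1) ≤ ρ d)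
    (hρr : ∀ d, ρ d ≤ r d) {φ χ : ∀ d, W.carrier (r d)} {e : ∀ d, T.carrier (r d)} {z : ℕ → ℝ}
    (hb : ∀ d, Radius.Shrink 1 (z d) (r d) (b d)) (hm : ∀ d, Radius.Shrink 1 (z d) (b d) (m d))
    (hr' : ∀ d, Radius.Shrink 1 (z d) (m d) (r (d + 1)))
    (hAφ : ∀ d, A.c * W.nrm 1 (r d) (φ d) ≤ z d) (hGφ : ∀ d, G.c * W.nrm 1 (r d) (φ d) ≤ z d)
    (hAθ : ∀ d, A.c * W.nrm 1 (b d) (G.inv (r d) (b d) (φ d)) ≤ z d)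
    (hGθ : ∀ d, G.c * W.nrm 1 (b d) (G.inv (r d) (b d) (φ d)) ≤ z d)
    (hχr : ∀ d, Radius.Shrink A.c (W.nrm 1 (r d) (χ d)) (r d) (ρ d))
    (hχr' : ∀ d, Radius.Shrink A.c (W.nrm 1 (r d) (χ d)) (r (d + 1)) (ρ (d + 1)))
    (he : ∀ d, e (d + 1) = A.act (r d) (r (d + 1)) (φ d) (e d))
    (hχ0 : χ 0 = 0)
    (hχ : ∀ d, χ (d + 1) = G.mul (b d) (r (d + 1)) (W.res (hbr d) (χ d))
      (G.inv (r d) (b d) (φ d)))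
    (hρ0 : ∀ d, ρ d ≤ r 0) (d : ℕ) :
    A.act (r d) (ρ d) (χ d) (e d) = T.res (hρ0 d) (e 0) := by
  have hA0 : 0 ≤ A.c := by linarith [A.one_lt_c]
  induction d with
  | zero => rw [hχ0, A.one_act (hρr 0)]
  | succ d ih =>
    have hrb : r (d + 1) ≤ b d := (hrm d).trans (hmb d)
    have hbr' : Radius.Shrink 1 (z d) (b d) (r (d + 1)) := (hm d).trans_le (hrm d)
    have hχs : Radius.Shrink A.c (W.nrm 1 (r (d + 1)) (W.res (hrb.trans (hbr d)) (χ d)))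
        (r (d + 1)) (ρ (d + 1)) :=
      (hχr' d).mono (mul_le_mul_of_nonneg_left (W.nrm_res_le 1 _ _) hA0)
    have hrφ : Radius.Shrink A.c (W.nrm 1 (r d) (φ d)) (r d) (b d) :=
      (hb d).mono (by linarith [hAφ d])
    have law := hA hrb hrb (W.res (hbr d) (χ d)) (G.inv (r d) (b d) (φ d))
      (A.act (r d) (b d) (φ d) (e d)) (r' := ρ (d + 1))
      (hbr'.mono (by linarith [hAθ d])) (by rw [W.res_res]; exact hχs)
      (hbr'.mono (by linarith [hGθ d])) (by rw [← hχ]; exact hχr (d + 1))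
    rw [A.inv_act_act hA (hbr d) (hmb d) (hrm d) (hb d) (hm d) (hr' d) (φ d) (e d) (hAφ d) (hGφ d)
      (hAθ d), W.res_res, A.act_res (hrb.trans (hbr d)) (χ d) (e d)
      ((hχr d).trans_le (hρ d)) hχs, ← A.res_act (hρ d) (χ d) (e d) (hχr d), ih, T.res_res,
      A.res_act hrb (φ d) (e d) hrφ, ← he, ← hχ] at law
    exact law.symm

/-! ### The limit of the iteration -/

/-- The radius `9 R / 16`, at which the limit of the iteration is taken. It leaves room for a final
action at the radius `R / 2`. -/
noncomputable def Radius.inner (R : Radius) : Radius := (R.interp 0).interp 0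

theorem Radius.coe_inner (R : Radius) : (R.inner : ℝ) = (R : ℝ) * (9 / 16) := by
  rw [Radius.inner, Radius.coe_interp _ le_rfl zero_le_one, Radius.coe_interp _ le_rfl zero_le_one]
  ring

theorem Radius.half_le_inner (R : Radius) : R.half ≤ R.inner := by
  show (R : ℝ) / 2 ≤ (R.inner : ℝ)
  rw [R.coe_inner]
  linarith [R.2.1]

theorem Radius.inner_le (R : Radius) : R.inner ≤ R :=
  (Radius.interp_le _ _).trans (Radius.interp_le _ _)

theorem Radius.inner_le_interp (R : Radius) {y : ℝ} (hy : 0 ≤ y) : R.inner ≤ R.interp y :=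
  (Radius.interp_le _ _).trans (R.interp_mono hy)

theorem Radius.shrink_inner_half (R : Radius) {c z : ℝ} (h : c * z ≤ 1 / 20) :
    Radius.Shrink c z R.inner R.half := by
  show (R : ℝ) / 2 ≤ (R.inner : ℝ) * (1 - c * z)
  rw [R.coe_inner]
  nlinarith [R.2.1]

theorem Radius.shrink_interp_interp (R : Radius) {c z x y : ℝ} (h : c * z ≤ 1 / 4) (hy : 0 ≤ y)
    (hyx : y ≤ x) (hx : x ≤ 1) : Radius.Shrink c z (R.interp x) ((R.interp 0).interp y) := by
  show ((R.interp 0).interp y : ℝ) ≤ (R.interp x : ℝ) * (1 - c * z)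
  rw [Radius.coe_interp _ hy (hyx.trans hx), Radius.coe_interp _ (hy.trans hyx) hx,
    Radius.coe_interp _ le_rfl zero_le_one]
  have hR := R.2.1
  have h1 : 0 ≤ (R : ℝ) * (3 / 4 + x / 4) := mul_nonneg hR.le (by linarith)
  have h2 := mul_le_mul_of_nonneg_left h h1
  nlinarith [mul_le_mul_of_nonneg_left hyx hR.le]

theorem SCISpace.nrm_le_of_tendsto (H : SCISpace.{u}) {k : ℕ} {r : Radius} {f : ℕ → H.carrier r}
    {g : H.carrier r} {B : ℝ} (hf : ∀ d, H.nrm k r (f d) ≤ B)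
    (h : Tendsto (fun d => H.nrm k r (f d - g)) atTop (𝓝 0)) : H.nrm k r g ≤ B := by
  have h1 : Tendsto (fun d => H.nrm k r (f d - g) + B) atTop (𝓝 (0 + B)) := h.add_const B
  rw [zero_add] at h1
  refine ge_of_tendsto h1 (Eventually.of_forall fun d => ?_)
  have h2 := map_sub_le_add (H.nrm k r) (f d) (f d - g)
  rw [sub_sub_cancel] at h2
  linarith [hf d]

section limit

variable {W : SCISpace.{v}} {G : SCIGroup W} {T : SCISpace.{u}}

theorem half_pow_pos_le_one (d : ℕ) : (0 : ℝ) < (1 / 2) ^ d ∧ ((1 : ℝ) / 2) ^ d ≤ 1 :=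
  ⟨by positivity, pow_le_one₀ (by norm_num) (by norm_num)⟩

theorem Radius.interp_half_pow_succ_le (R : Radius) (d : ℕ) :
    R.interp ((1 / 2) ^ (d + 1)) ≤ R.interp ((1 / 2) ^ d) := R.interp_mono (by
  rw [pow_succ]
  linarith [(half_pow_pos_le_one d).1])

/-- For a right action the partial products of the iteration converge to an element of `G₀`. -/
theorem SCIAction.exists_limit_right (A : SCIAction G T)
    (hA : ∀ {r r₁ r₂ r' : Radius} (h₁ : r₁ ≤ r) (h₂ : r₂ ≤ r) (ψ φ : W.carrier r) (f : T.carrier r),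
      Radius.Shrink A.c (W.nrm 1 r ψ) r r₁ →
      Radius.Shrink A.c (W.nrm 1 r₁ (W.res h₁ φ)) r₁ r' →
      Radius.Shrink G.c (W.nrm 1 r φ) r r₂ →
      Radius.Shrink A.c (W.nrm 1 r₂ (G.mul r r₂ ψ φ)) r₂ r' →
      A.act r₁ r' (W.res h₁ φ) (A.act r r₁ ψ f) = A.act r₂ r' (G.mul r r₂ ψ φ) (T.res h₂ f))
    {G₀ : ∀ r, Set (W.carrier r)} (hG₀ : G.IsClosedSubgroup G₀) (R₀ : Radius) {κ C : ℝ}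
    (hκ : 0 < κ) (hC : 0 ≤ C) :
    ∀ᶠ t₀ : ℝ in atTop, ∀ R : Radius, R₀ ≤ R →
      ∀ (e : ∀ d : ℕ, T.carrier (R.interp ((1 / 2) ^ d)))
        (φ : ∀ d : ℕ, W.carrier (R.interp ((1 / 2) ^ d))),
        (∀ d, φ d ∈ G₀ _) →
        (∀ d, e (d + 1) = A.act (R.interp ((1 / 2) ^ d)) (R.interp ((1 / 2) ^ (d + 1)))
          (φ d) (e d)) →
        (∀ d, W.nrm 5 _ (φ d) ≤ C * smoothingParam t₀ κ d ^ (-1 / 2 : ℝ)) →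
        (∀ k, ∃ M : ℝ, ∀ d, W.nrm k _ (φ d) ≤ M * smoothingParam t₀ κ d ^ (-1 / 2 : ℝ)) →
      ∃ ψ ∈ G₀ R.inner, ∃ ψs : ℕ → W.carrier R.inner,
        (∀ k, Tendsto (fun d => W.nrm k R.inner (ψs d - ψ)) atTop (𝓝 0)) ∧
        A.c * W.nrm 1 R.inner ψ ≤ 1 / 20 ∧ (∀ d, A.c * W.nrm 1 R.inner (ψs d) ≤ 1 / 20) ∧
        ∀ (d : ℕ) (h₀ : R.inner ≤ R.interp ((1 / 2) ^ 0)) (h : R.half ≤ R.interp ((1 / 2) ^ d)),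
          A.act R.inner R.half (ψs d) (T.res h₀ (e 0)) = T.res h (e d) := by
  have hA1 := A.one_lt_c
  have hG1 := G.one_lt_c
  obtain ⟨D, hD0, hD⟩ := G.exists_partialProduct_bound R₀.half hκ hC
  have lim1 : Tendsto (fun t₀ : ℝ => t₀ ^ (κ / 4)) atTop atTop := tendsto_rpow_atTop (by positivity)
  have lim3 : Tendsto (fun t₀ : ℝ => ((A.c + G.c) * (C + D)) * t₀ ^ (-1 / 4 : ℝ)) atTop (𝓝 0) := by
    have : Tendsto (fun t₀ : ℝ => t₀ ^ (-(1 / 4) : ℝ)) atTop (𝓝 0) :=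
      tendsto_rpow_neg_atTop (by norm_num)
    simpa [neg_div] using this.const_mul ((A.c + G.c) * (C + D))
  filter_upwards [hD, eventually_gt_atTop 1, lim1.eventually_ge_atTop 2,
    lim3.eventually (ge_mem_nhds (show (0 : ℝ) < 1 / 32 by norm_num))]
    with t₀ hprod ht₀ h2 hsmall R hR e φ hφG he hφ5 hφ
  set q : ℝ := t₀ ^ (-1 / 4 : ℝ) with hq
  have hq0 : 0 ≤ q := Real.rpow_nonneg (by linarith) _
  have hACq : (A.c + G.c) * (C * q) ≤ 1 / 32 := by
    have : 0 ≤ (A.c + G.c) * (D * q) := by positivity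
    linarith
  have hADq : A.c * (D * q) ≤ 1 / 32 := by
    have h1 : 0 ≤ (A.c + G.c) * (C * q) := by positivity
    have h3 : 0 ≤ G.c * (D * q) := by positivity
    linarith
  set r : ℕ → Radius := fun d => R.interp ((1 / 2) ^ d) with hrdef
  set ρ : ℕ → Radius := fun d => (R.interp 0).interp ((1 / 2) ^ d) with hρdef
  have hr : ∀ d, r (d + 1) ≤ r d := R.interp_half_pow_succ_le
  have hr0 : ∀ d, r d ≤ r 0 := fun d => R.interp_mono (by
    rw [pow_zero]; exact (half_pow_pos_le_one d).2)
  have hσr : ∀ d, R.interp 0 ≤ r d := fun d => R.interp_mono (half_pow_pos_le_one d).1.le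
  have hρr : ∀ d, ρ d ≤ r d := fun d => (Radius.interp_le _ _).trans (hσr d)
  have hβρ : ∀ d, R.inner ≤ ρ d := fun d => Radius.interp_mono _ (half_pow_pos_le_one d).1.le
  have hβr : ∀ d, R.inner ≤ r d := fun d => (hβρ d).trans (hρr d)
  have hR₀r : ∀ d, R₀.half ≤ r d := fun d => (Radius.half_mono hR).trans (R.half_le_interp _)
  have hφ1 : ∀ d, (A.c + G.c) * W.nrm 1 (r d) (φ d) ≤ (1 / 2) ^ d / 32 := fun d => by
    have h1 : W.nrm 1 (r d) (φ d) ≤ C * (q * (1 / 2) ^ d) :=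
      (W.nrm_le_nrm (by norm_num) _ _).trans ((hφ5 d).trans
        (mul_le_mul_of_nonneg_left (smoothingParam_neg_half_le ht₀ hκ h2 d) hC))
    have h3 := mul_le_mul_of_nonneg_left h1 (show 0 ≤ A.c + G.c by linarith)
    have h4 := mul_le_mul_of_nonneg_right hACq (half_pow_pos_le_one d).1.le
    linarith
  have hAφ : ∀ d, A.c * W.nrm 1 (r d) (φ d) ≤ (1 / 2) ^ d / 32 := fun d => by
    have := mul_nonneg (show 0 ≤ G.c by linarith) (W.nrm_nonneg 1 (r d) (φ d))
    linarith [hφ1 d]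
  have hGφ : ∀ d, G.c * W.nrm 1 (r d) (φ d) ≤ (1 / 2) ^ d / 32 := fun d => by
    have := mul_nonneg (show 0 ≤ A.c by linarith) (W.nrm_nonneg 1 (r d) (φ d))
    linarith [hφ1 d]
  have hshr : ∀ (R' : Radius) (d : ℕ) (c z : ℝ), c * z ≤ (1 / 2) ^ d / 32 →
      Radius.Shrink c z (R'.interp ((1 / 2) ^ d)) (R'.interp ((1 / 2) ^ (d + 1))) :=
    fun R' d c z h => by
      have := half_pow_pos_le_one d
      refine R'.shrink_interp (by positivity) this.2 ?_ ?_ <;> rw [pow_succ] <;> linarith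
  -- the partial products
  let ψ : ∀ d, W.carrier (r d) := fun d => Nat.rec (motive := fun d => W.carrier (r d)) 0
    (fun d x => G.mul (r d) (r (d + 1)) x (φ d)) d
  have hψ0 : ψ 0 = 0 := rfl
  have hψ : ∀ d, ψ (d + 1) = G.mul (r d) (r (d + 1)) (ψ d) (φ d) := fun d => rfl
  have hGr : ∀ d, Radius.Shrink G.c (W.nrm 1 (r d) (φ d)) (r d) (r (d + 1)) := fun d =>
    hshr R d _ _ (hGφ d)
  obtain ⟨hψ3, hincr⟩ := hprod r r (fun d => le_rfl) hr hR₀r φ ψ hGr hψ0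
    (fun d => by rw [W.res_refl, hψ]) (fun d => (W.nrm_le_nrm (by norm_num) _ _).trans (hφ5 d)) hφ
  have hAψ : ∀ d, A.c * W.nrm 1 (r d) (ψ d) ≤ 1 / 32 := fun d =>
    (mul_le_mul_of_nonneg_left ((W.nrm_le_nrm (by norm_num) _ _).trans (hψ3 d))
      (by linarith)).trans hADq
  have hψG : ∀ d, ψ d ∈ G₀ (r d) := fun d => by
    induction d with
    | zero => exact hG₀.one_mem _
    | succ d ih => exact hG₀.mul_mem _ _ ih (hφG d) (hGr d)
  have hψr : ∀ d, Radius.Shrink A.c (W.nrm 1 (r d) (ψ d)) (r d) (ρ d) := fun d =>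
    R.shrink_interp_interp (by linarith [hAψ d]) (half_pow_pos_le_one d).1.le le_rfl
      (half_pow_pos_le_one d).2
  obtain ⟨g, hg⟩ := W.exists_tendsto_of_increment hr hβr ψ hincr
  have hAs : ∀ d, W.nrm 1 R.inner (W.res (hβr d) (ψ d)) ≤ D * q := fun d =>
    (W.nrm_res_le 1 _ _).trans ((W.nrm_le_nrm (by norm_num) _ _).trans (hψ3 d))
  have hAs' : ∀ x : W.carrier R.inner, W.nrm 1 R.inner x ≤ D * q →
      A.c * W.nrm 1 R.inner x ≤ 1 / 20 := fun x hx => by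
    have := mul_le_mul_of_nonneg_left hx (show 0 ≤ A.c by linarith)
    linarith
  refine ⟨g, hG₀.closed _ _ g (fun d => hG₀.res_mem (hβr d) _ (hψG d)) hg,
    fun d => W.res (hβr d) (ψ d), hg, hAs' g (W.nrm_le_of_tendsto hAs (hg 1)),
    fun d => hAs' _ (hAs d), fun d h₀ h => ?_⟩
  have key := A.act_partialProduct_right hA hr hρr (fun d => hshr R d _ _ (hAφ d)) hGr
    (fun d => hshr (R.interp 0) d _ _ (hAφ d)) hψr he hψ0 hψ hr0 d
  have hhalf : R.half ≤ ρ d := R.half_le_inner.trans (hβρ d)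
  have e1 : T.res h₀ (e 0) = T.res (hβr d) (T.res (hr0 d) (e 0)) := (T.res_res _ _ _).symm
  rw [e1, A.act_res (hβr d) (ψ d) _ ((hψr d).trans_le hhalf)
    (R.shrink_inner_half (hAs' _ (hAs d))), ← A.res_act hhalf (ψ d) _ (hψr d), key, T.res_res]

/-- For a left action the partial products of the inverses converge, and the inverse of their limit
is the element of `G₀` wanted. -/
theorem SCIAction.exists_limit_left (A : SCIAction G T)
    (hA : ∀ {r r₁ r₂ r' : Radius} (h₁ : r₁ ≤ r) (h₂ : r₂ ≤ r) (ψ φ : W.carrier r) (f : T.carrier r),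
      Radius.Shrink A.c (W.nrm 1 r φ) r r₁ →
      Radius.Shrink A.c (W.nrm 1 r₁ (W.res h₁ ψ)) r₁ r' →
      Radius.Shrink G.c (W.nrm 1 r φ) r r₂ →
      Radius.Shrink A.c (W.nrm 1 r₂ (G.mul r r₂ ψ φ)) r₂ r' →
      A.act r₁ r' (W.res h₁ ψ) (A.act r r₁ φ f) = A.act r₂ r' (G.mul r r₂ ψ φ) (T.res h₂ f))
    {G₀ : ∀ r, Set (W.carrier r)} (hG₀ : G.IsClosedSubgroup G₀) (R₀ : Radius) {κ C : ℝ}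
    (hκ : 0 < κ) (hC : 0 ≤ C) :
    ∀ᶠ t₀ : ℝ in atTop, ∀ R : Radius, R₀ ≤ R →
      ∀ (e : ∀ d : ℕ, T.carrier (R.interp ((1 / 2) ^ d)))
        (φ : ∀ d : ℕ, W.carrier (R.interp ((1 / 2) ^ d))),
        (∀ d, φ d ∈ G₀ _) →
        (∀ d, e (d + 1) = A.act (R.interp ((1 / 2) ^ d)) (R.interp ((1 / 2) ^ (d + 1)))
          (φ d) (e d)) →
        (∀ d, W.nrm 5 _ (φ d) ≤ C * smoothingParam t₀ κ d ^ (-1 / 2 : ℝ)) →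
        (∀ k, ∃ M : ℝ, ∀ d, W.nrm k _ (φ d) ≤ M * smoothingParam t₀ κ d ^ (-1 / 2 : ℝ)) →
      ∃ ψ ∈ G₀ R.inner, ∃ ψs : ℕ → W.carrier R.inner,
        (∀ k, Tendsto (fun d => W.nrm k R.inner (ψs d - ψ)) atTop (𝓝 0)) ∧
        A.c * W.nrm 1 R.inner ψ ≤ 1 / 20 ∧ (∀ d, A.c * W.nrm 1 R.inner (ψs d) ≤ 1 / 20) ∧
        ∀ (d : ℕ) (h₀ : R.inner ≤ R.interp ((1 / 2) ^ 0)) (h : R.half ≤ R.interp ((1 / 2) ^ d)),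
          A.act R.inner R.half (ψs d) (T.res h₀ (e 0)) = T.res h (e d) := by
  have hA1 := A.one_lt_c
  have hG1 := G.one_lt_c
  obtain ⟨B, hB0, hB⟩ := G.exists_inv_le R₀.half (show 1 ≤ 4 by norm_num) 1
  obtain ⟨B₁, hB₁0, hB₁⟩ := G.exists_inv_le R₀.half (le_refl 1) 1
  obtain ⟨D, hD0, hD⟩ := G.exists_partialProduct_bound R₀.half hκ (mul_nonneg hB0 hC)
  have lim1 : Tendsto (fun t₀ : ℝ => t₀ ^ (κ / 4)) atTop atTop := tendsto_rpow_atTop (by positivity)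
  have lim3 : Tendsto (fun t₀ : ℝ => ((A.c + G.c) * (C + D + B * C + B₁ * D)) *
      t₀ ^ (-1 / 4 : ℝ)) atTop (𝓝 0) := by
    have : Tendsto (fun t₀ : ℝ => t₀ ^ (-(1 / 4) : ℝ)) atTop (𝓝 0) :=
      tendsto_rpow_neg_atTop (by norm_num)
    simpa [neg_div] using this.const_mul ((A.c + G.c) * (C + D + B * C + B₁ * D))
  filter_upwards [hD, eventually_gt_atTop 1, lim1.eventually_ge_atTop 2,
    lim3.eventually (ge_mem_nhds (show (0 : ℝ) < 1 / 32 by norm_num))]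
    with t₀ hprod ht₀ h2 hsmall R hR e φ hφG he hφ5 hφ
  set q : ℝ := t₀ ^ (-1 / 4 : ℝ) with hq
  have hq0 : 0 ≤ q := Real.rpow_nonneg (by linarith) _
  have hAG : 0 ≤ A.c + G.c := by linarith
  have s1 : 0 ≤ (A.c + G.c) * (C * q) := by positivity
  have s2 : 0 ≤ (A.c + G.c) * (D * q) := by positivity
  have s3 : 0 ≤ (A.c + G.c) * (B * C * q) := by positivity
  have s4 : 0 ≤ (A.c + G.c) * (B₁ * D * q) := by positivity
  have hcA : ∀ {x : ℝ}, 0 ≤ x → A.c * x ≤ (A.c + G.c) * x := fun hx =>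
    mul_le_mul_of_nonneg_right (by linarith) hx
  have hcG : ∀ {x : ℝ}, 0 ≤ x → G.c * x ≤ (A.c + G.c) * x := fun hx =>
    mul_le_mul_of_nonneg_right (by linarith) hx
  set r : ℕ → Radius := fun d => R.interp ((1 / 2) ^ d) with hrdef
  set b : ℕ → Radius := fun d => R.interp (7 / 8 * (1 / 2) ^ d) with hbdef
  set m : ℕ → Radius := fun d => R.interp (3 / 4 * (1 / 2) ^ d) with hmdef
  set σ : Radius := R.interp 0 with hσdef
  set ρ : ℕ → Radius := fun d => σ.interp ((1 / 2) ^ d) with hρdef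
  have hp := half_pow_pos_le_one
  have hr : ∀ d, r (d + 1) ≤ r d := R.interp_half_pow_succ_le
  have hbr : ∀ d, b d ≤ r d := fun d => R.interp_mono (by linarith [(hp d).1])
  have hmb : ∀ d, m d ≤ b d := fun d => R.interp_mono (by linarith [(hp d).1])
  have hrm : ∀ d, r (d + 1) ≤ m d := fun d => R.interp_mono (by
    rw [pow_succ]; linarith [(hp d).1])
  have hrb : ∀ d, r (d + 1) ≤ b d := fun d => (hrm d).trans (hmb d)
  have hr0 : ∀ d, r d ≤ r 0 := fun d => R.interp_mono (by
    rw [pow_zero]; exact (hp d).2)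
  have hσr : ∀ d, σ ≤ r d := fun d => R.interp_mono (hp d).1.le
  have hρσ : ∀ d, ρ d ≤ σ := fun d => Radius.interp_le _ _
  have hρr : ∀ d, ρ d ≤ r d := fun d => (hρσ d).trans (hσr d)
  have hβρ : ∀ d, R.inner ≤ ρ d := fun d => Radius.interp_mono _ (hp d).1.le
  have hβσ : R.inner ≤ σ := Radius.interp_le _ _
  have hR₀ : ∀ y, R₀.half ≤ R.interp y := fun y =>
    (Radius.half_mono hR).trans (R.half_le_interp _)
  have hR₀β : R₀.half ≤ R.inner := (Radius.half_mono hR).trans R.half_le_inner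
  have ht1 := one_lt_smoothingParam ht₀ hκ
  have hhalf1 : ∀ d, smoothingParam t₀ κ d ^ (-1 / 2 : ℝ) ≤ 1 := fun d =>
    Real.rpow_le_one_of_one_le_of_nonpos (ht1 d).le (by norm_num)
  have hCq : ∀ d, C * smoothingParam t₀ κ d ^ (-1 / 2 : ℝ) ≤ C * q * (1 / 2) ^ d := fun d => by
    rw [mul_assoc]
    exact mul_le_mul_of_nonneg_left (smoothingParam_neg_half_le ht₀ hκ h2 d) hC
  have hφ1 : ∀ d, (A.c + G.c) * W.nrm 1 (r d) (φ d) ≤ (1 / 2) ^ d / 32 := fun d => by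
    have h1 : W.nrm 1 (r d) (φ d) ≤ C * q * (1 / 2) ^ d :=
      (W.nrm_le_nrm (by norm_num) _ _).trans ((hφ5 d).trans (hCq d))
    have h3 := mul_le_mul_of_nonneg_left h1 hAG
    have h4 := mul_le_mul_of_nonneg_right
      (show (A.c + G.c) * (C * q) ≤ 1 / 32 by linarith) (hp d).1.le
    linarith
  have hAφ : ∀ d, A.c * W.nrm 1 (r d) (φ d) ≤ (1 / 2) ^ d / 32 := fun d =>
    (hcA (W.nrm_nonneg _ _ _)).trans (hφ1 d)
  have hGφ : ∀ d, G.c * W.nrm 1 (r d) (φ d) ≤ (1 / 2) ^ d / 32 := fun d =>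
    (hcG (W.nrm_nonneg _ _ _)).trans (hφ1 d)
  have hb : ∀ d, Radius.Shrink 1 ((1 / 2) ^ d / 32) (r d) (b d) := fun d =>
    R.shrink_interp (by linarith [(hp d).1]) (hp d).2 (by linarith) (by linarith [(hp d).1])
  have hm : ∀ d, Radius.Shrink 1 ((1 / 2) ^ d / 32) (b d) (m d) := fun d =>
    R.shrink_interp (by linarith [(hp d).1]) (by linarith [(hp d).1, (hp d).2]) (by linarith)
      (by linarith [(hp d).1])
  have hmr : ∀ d, Radius.Shrink 1 ((1 / 2) ^ d / 32) (m d) (r (d + 1)) := fun d =>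
    R.shrink_interp (hp (d + 1)).1.le (by linarith [(hp d).1, (hp d).2])
      (by rw [pow_succ]; linarith [(hp d).1]) (by rw [pow_succ]; linarith [(hp d).1])
  -- the inverses
  set θ : ∀ d, W.carrier (b d) := fun d => G.inv (r d) (b d) (φ d) with hθdef
  have hGb : ∀ d, Radius.Shrink G.c (W.nrm 1 (r d) (φ d)) (r d) (b d) := fun d =>
    (hb d).mono (by linarith [hGφ d])
  have hφ41 : ∀ d, W.nrm 4 (r d) (φ d) ≤ 1 := fun d => by
    have h1 : W.nrm 4 (r d) (φ d) ≤ C * q * (1 / 2) ^ d :=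
      (W.nrm_le_nrm (by norm_num) _ _).trans ((hφ5 d).trans (hCq d))
    have h3 : C * q * (1 / 2) ^ d ≤ C * q := mul_le_of_le_one_right (by positivity) (hp d).2
    have h4 : C * q ≤ (A.c + G.c) * (C * q) :=
      le_mul_of_one_le_left (by positivity) (by linarith)
    linarith
  have hθ4 : ∀ d, W.nrm 4 (b d) (θ d) ≤ B * C * smoothingParam t₀ κ d ^ (-1 / 2 : ℝ) := fun d => by
    rw [mul_assoc]
    exact (hB 4 (by norm_num) (r d) (b d) (hR₀ _) (hR₀ _) (φ d) (hGb d) (hφ41 d)).trans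
      (mul_le_mul_of_nonneg_left ((W.nrm_le_nrm (by norm_num) _ _).trans (hφ5 d)) hB0)
  have hθall : ∀ k, ∃ M : ℝ, ∀ d, W.nrm k (b d) (θ d) ≤
      M * smoothingParam t₀ κ d ^ (-1 / 2 : ℝ) := fun k => by
    obtain ⟨N, hN⟩ := hφ (k + 1)
    have hN' : ∀ d, W.nrm (k + 1) (r d) (φ d) ≤ |N| * smoothingParam t₀ κ d ^ (-1 / 2 : ℝ) :=
      fun d => (hN d).trans (mul_le_mul_of_nonneg_right (le_abs_self N)
        (Real.rpow_nonneg (by linarith [ht1 d]) _))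
    obtain ⟨B', hB'0, hB'⟩ := G.exists_inv_le R₀.half (show 1 ≤ k + 1 by omega) |N|
    refine ⟨B' * |N|, fun d => (W.nrm_le_nrm (show k ≤ k + 1 by omega) _ _).trans ?_⟩
    rw [mul_assoc]
    exact (hB' (k + 1) (by omega) (r d) (b d) (hR₀ _) (hR₀ _) (φ d) (hGb d)
      ((hN' d).trans (mul_le_of_le_one_right (abs_nonneg N) (hhalf1 d)))).trans
      (mul_le_mul_of_nonneg_left (hN' d) hB'0)
  have hθ1 : ∀ d, (A.c + G.c) * W.nrm 1 (b d) (θ d) ≤ (1 / 2) ^ d / 32 := fun d => by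
    have h1 : W.nrm 1 (b d) (θ d) ≤ B * (C * q * (1 / 2) ^ d) :=
      (W.nrm_le_nrm (by norm_num) _ _).trans ((hθ4 d).trans (by
        rw [mul_assoc]; exact mul_le_mul_of_nonneg_left (hCq d) hB0))
    have h3 := mul_le_mul_of_nonneg_left h1 hAG
    have h4 := mul_le_mul_of_nonneg_right
      (show (A.c + G.c) * (B * C * q) ≤ 1 / 32 by linarith) (hp d).1.le
    linarith
  have hAθ : ∀ d, A.c * W.nrm 1 (b d) (θ d) ≤ (1 / 2) ^ d / 32 := fun d =>
    (hcA (W.nrm_nonneg _ _ _)).trans (hθ1 d)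
  have hGθ : ∀ d, G.c * W.nrm 1 (b d) (θ d) ≤ (1 / 2) ^ d / 32 := fun d =>
    (hcG (W.nrm_nonneg _ _ _)).trans (hθ1 d)
  have hGθr : ∀ d, Radius.Shrink G.c (W.nrm 1 (b d) (θ d)) (b d) (r (d + 1)) := fun d =>
    ((hm d).trans_le (hrm d)).mono (by linarith [hGθ d])
  -- the partial products of the inverses
  let χ : ∀ d, W.carrier (r d) := fun d => Nat.rec (motive := fun d => W.carrier (r d)) 0
    (fun d x => G.mul (b d) (r (d + 1)) (W.res (hbr d) x) (θ d)) d
  have hχ0 : χ 0 = 0 := rfl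
  have hχ : ∀ d, χ (d + 1) = G.mul (b d) (r (d + 1)) (W.res (hbr d) (χ d)) (θ d) := fun d => rfl
  obtain ⟨hχ3, hincr⟩ := hprod r b hbr hrb (fun d => hR₀ _) θ χ hGθr hχ0 hχ hθ4 hθall
  have hχ1 : ∀ d, W.nrm 1 (r d) (χ d) ≤ D * q := fun d =>
    (W.nrm_le_nrm (by norm_num) _ _).trans (hχ3 d)
  have hsm : ∀ {x : ℝ}, 0 ≤ x → x ≤ D * q → A.c * x ≤ 1 / 32 ∧ G.c * x ≤ 1 / 32 := fun hx0 hx => by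
    have h1 := mul_le_mul_of_nonneg_left hx hAG
    exact ⟨by linarith [hcA hx0], by linarith [hcG hx0]⟩
  have hAχ : ∀ d, A.c * W.nrm 1 (r d) (χ d) ≤ 1 / 32 := fun d =>
    (hsm (W.nrm_nonneg _ _ _) (hχ1 d)).1
  have hχG : ∀ d, χ d ∈ G₀ (r d) := fun d => by
    induction d with
    | zero => exact hG₀.one_mem _
    | succ d ih =>
      exact hG₀.mul_mem _ _ (hG₀.res_mem (hbr d) _ ih) (hG₀.inv_mem _ (hφG d) (hGb d)) (hGθr d)
  have hχr : ∀ d, Radius.Shrink A.c (W.nrm 1 (r d) (χ d)) (r d) (ρ d) := fun d =>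
    R.shrink_interp_interp (by linarith [hAχ d]) (hp d).1.le le_rfl (hp d).2
  obtain ⟨g, hg⟩ := W.exists_tendsto_of_increment hr hσr χ hincr
  have hgG : g ∈ G₀ σ := hG₀.closed _ _ g (fun d => hG₀.res_mem (hσr d) _ (hχG d)) hg
  have hs1 : ∀ d, W.nrm 1 σ (W.res (hσr d) (χ d)) ≤ D * q := fun d =>
    (W.nrm_res_le 1 _ _).trans (hχ1 d)
  have hg1 : W.nrm 1 σ g ≤ D * q := W.nrm_le_of_tendsto hs1 (hg 1)
  have hσβ : Radius.Shrink 1 (1 / 32) σ R.inner := by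
    have h := R.shrink_interp_interp (c := 1) (z := 1 / 32) (x := 0) (y := 0) (by norm_num)
      le_rfl le_rfl zero_le_one
    exact h
  have hGσβ : ∀ x : W.carrier σ, W.nrm 1 σ x ≤ D * q →
      Radius.Shrink G.c (W.nrm 1 σ x) σ R.inner := fun x hx =>
    hσβ.mono (by linarith [(hsm (W.nrm_nonneg _ _ _) hx).2])
  have hDq1 : D * q ≤ 1 := by
    have h4 : D * q ≤ (A.c + G.c) * (D * q) :=
      le_mul_of_one_le_left (by positivity) (by linarith)
    linarith
  have hinv : ∀ x : W.carrier σ, W.nrm 1 σ x ≤ D * q →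
      A.c * W.nrm 1 R.inner (G.inv σ R.inner x) ≤ 1 / 32 := fun x hx => by
    have h1 := hB₁ 1 (by norm_num) σ R.inner (hR₀ _) hR₀β x (hGσβ x hx) (hx.trans hDq1)
    have h3 := mul_le_mul_of_nonneg_left (h1.trans (mul_le_mul_of_nonneg_left hx hB₁0)) hAG
    have h4 := hcA (W.nrm_nonneg 1 R.inner (G.inv σ R.inner x))
    linarith
  refine ⟨G.inv σ R.inner g, hG₀.inv_mem g hgG (hGσβ g hg1),
    fun d => G.inv σ R.inner (W.res (hσr d) (χ d)), fun k => ?_, by linarith [hinv g hg1],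
    fun d => by linarith [hinv _ (hs1 d)], fun d h₀ h => ?_⟩
  · obtain ⟨N, hN0, hN⟩ := G.exists_inv_sub_inv_le R₀.half (show 1 ≤ k + 1 by omega)
      (1 + W.nrm (k + 1) σ g)
    have hlim : Tendsto (fun d => N * (W.nrm (k + 1) σ (W.res (hσr d) (χ d) - g) *
        (1 + W.nrm (k + 1) σ g))) atTop (𝓝 0) := by
      simpa using ((hg (k + 1)).mul_const (1 + W.nrm (k + 1) σ g)).const_mul N
    refine squeeze_zero' (Eventually.of_forall fun d => W.nrm_nonneg _ _ _) ?_ hlim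
    filter_upwards [(hg (k + 1)).eventually (ge_mem_nhds one_pos)] with d hd
    have ng := W.nrm_nonneg (k + 1) σ g
    exact (W.nrm_le_nrm (show k ≤ k + 1 by omega) _ _).trans
      (hN (k + 1) (by omega) σ R.inner (hR₀ _) hR₀β _ g (hGσβ _ (hs1 d)) (hGσβ g hg1)
        (by linarith) (by linarith))
  · have key := A.act_partialProduct_left hA hbr hmb hrm
      (fun d => σ.interp_half_pow_succ_le d) hρr hb hm hmr hAφ hGφ hAθ hGθ hχr
      (fun d => R.shrink_interp_interp (by linarith [hAχ d]) (hp (d + 1)).1.le le_rfl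
        (hp (d + 1)).2) he hχ0 hχ (fun d => (hρr d).trans (hr0 d)) d
    have hAσβ : Radius.Shrink A.c (W.nrm 1 σ (W.res (hσr d) (χ d))) σ R.inner :=
      hσβ.mono (by linarith [(hsm (W.nrm_nonneg _ _ _) (hs1 d)).1])
    have h1 : A.act σ R.inner (W.res (hσr d) (χ d)) (T.res (hσr d) (e d)) = T.res h₀ (e 0) := by
      rw [A.act_res (hσr d) (χ d) (e d) ((hχr d).trans_le (hβρ d)) hAσβ,
        ← A.res_act (hβρ d) (χ d) (e d) (hχr d), key, T.res_res]
    -- a radius between `9 R / 16` and `R / 2`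
    have hc : (R.inner.interp (4 / 5) : ℝ) = (R : ℝ) * (171 / 320) := by
      rw [Radius.coe_interp _ (by norm_num) (by norm_num), R.coe_inner]; ring
    have hR0 := R.2.1
    have hm1 : Radius.Shrink 1 (1 / 32) R.inner (R.inner.interp (4 / 5)) := by
      show (R.inner.interp (4 / 5) : ℝ) ≤ (R.inner : ℝ) * (1 - 1 * (1 / 32))
      rw [hc, R.coe_inner]; linarith
    have hm2 : Radius.Shrink 1 (1 / 32) (R.inner.interp (4 / 5)) R.half := by
      show (R : ℝ) / 2 ≤ (R.inner.interp (4 / 5) : ℝ) * (1 - 1 * (1 / 32))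
      rw [hc]; linarith
    have hm3 : R.half ≤ R.inner.interp (4 / 5) := by
      show (R : ℝ) / 2 ≤ (R.inner.interp (4 / 5) : ℝ)
      rw [hc]; linarith
    have h3 := A.inv_act_act hA hβσ (R.inner.interp_le (4 / 5)) hm3 hσβ hm1 hm2
      (W.res (hσr d) (χ d)) (T.res (hσr d) (e d)) (hsm (W.nrm_nonneg _ _ _) (hs1 d)).1
      (hsm (W.nrm_nonneg _ _ _) (hs1 d)).2 (hinv _ (hs1 d))
    rw [h1, T.res_res] at h3
    exact h3

end limit

theorem theorem4p17
    (T : SCISpace.{u}) (F : SCISubspace T)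
    (I : ∀ r, Set (T.carrier r)) (hI : IsSCISubset T I) (hI0 : ∀ r, (0 : T.carrier r) ∈ I r)
    (π : SCIProjection F)
    (h_zeta : ∀ᶠ k : ℕ in atTop, ∃ P : RadPoly 1, ∀ (r : Radius) (ε : T.carrier r),
      T.nrm k r (π.zeta r ε) ≤ leibniz P r r ![k] ![fun j => T.nrm j r ε])
    (W : SCISpace.{v}) (G : SCIGroup W) (A : SCIAction G T)
    (G₀ : ∀ r, Set (W.carrier r)) (hG₀ : G.IsClosedSubgroup G₀)
    (hG₀I : ∀ (r r' : Radius) (φ : W.carrier r) (ε : T.carrier r), φ ∈ G₀ r → ε ∈ I r →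
      Radius.Shrink A.c (W.nrm 1 r φ) r r' → A.act r r' φ ε ∈ I r')
    (E : SCISpace.{w})
    (V : ∀ r, I r → E.carrier r) (Φ : ∀ r, E.carrier r → G₀ r) (s : ℕ)
    (h_V : ∀ᶠ k : ℕ in atTop, ∃ P : RadPoly 2, ∀ (r : Radius) (ε : I r),
      E.nrm k r (V r ε) ≤ leibniz P r r ![k + s, k + s]
        ![fun j => T.nrm j r (π.zeta r ε), fun j => 1 + T.nrm j r (ε : T.carrier r)])
    (h_Phi : ∀ᶠ k : ℕ in atTop, ∃ P : RadPoly 1, ∀ (r : Radius) (v : E.carrier r),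
      W.nrm k r (Φ r v : W.carrier r) ≤ leibniz P r r ![k + s] ![fun j => E.nrm j r v])
    (h_act : ∀ᶠ k : ℕ in atTop, ∃ P Q : RadPoly 2, ∀ (r r' : Radius) (ε : I r)
      (v w : E.carrier r),
      Radius.Shrink A.c (W.nrm 1 r (Φ r v : W.carrier r)) r r' →
      Radius.Shrink A.c (W.nrm 1 r (Φ r w : W.carrier r)) r r' →
      T.nrm k r' (A.act r r' (Φ r v) ε - A.act r r' (Φ r w) ε) ≤
        leibniz P r' r ![k + s, k + s] ![fun j => E.nrm j r (v - w),
          fun j => 1 + E.nrm j r v + E.nrm j r w + T.nrm j r (ε : T.carrier r)] +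
        leibniz Q r' r ![k + s, k + s] ![fun j => (E.nrm j r v + E.nrm j r w) ^ 2,
          fun j => 1 + T.nrm j r (ε : T.carrier r)])
    (δ : ℝ) (hδ : 0 < δ)
    (h_quad : ∃ m : ℕ, ∀ᶠ k : ℕ in atTop, ∃ P : RadPoly 4, P.poly.degreeOf 0 ≤ m ∧
      ∀ (r r' : Radius) (ε : I r),
        Radius.Shrink A.c (W.nrm 1 r (Φ r (V r ε) : W.carrier r)) r r' →
        T.nrm k r' (π.zeta r' (A.act r r' (Φ r (V r ε)) ε)) ≤
          T.nrm (k + s) r (π.zeta r ε) ^ (1 + δ) *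
            P.eval r' r ![T.nrm (k + s) r (ε : T.carrier r),
              W.nrm (k + s) r (Φ r (V r ε) : W.carrier r),
              T.nrm (k + s) r (π.zeta r ε), T.nrm k r (ε : T.carrier r)]) :
    ∃ l : ℕ, 1 ≤ l ∧ ∀ R₀ : Radius, ∃ α : ℝ, 0 < α ∧ ∃ β : ℝ, 0 < β ∧
      ∀ R : Radius, R₀ ≤ R → ∀ ε ∈ I R,
        T.nrm (2 * l - 1) R ε < α → T.nrm l R (π.zeta R ε) < β →
        ∃ (r : Radius) (hr : r ≤ R) (ψ : W.carrier r), R.half ≤ r ∧ ψ ∈ G₀ r ∧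
          Radius.Shrink A.c (W.nrm 1 r ψ) r R.half ∧
          A.act r R.half ψ (T.res hr ε) ∈ F.carrier R.half ∧
          A.act r R.half ψ (T.res hr ε) ∈ I R.half := by
  obtain ⟨s', m, k₁, hk₁, H⟩ := exists_tameEstimates T F I π h_zeta W G A G₀ E V Φ s h_V h_Phi
    h_act δ h_quad
  obtain ⟨b, L, κ, a, hκ, ha, hab, hL, hstep⟩ := exists_stepEstimates H hk₁ hδ
  refine ⟨L, by omega, fun R₀ => ?_⟩
  obtain ⟨C, hC0, hiter⟩ := exists_iterates hI hG₀I hκ ha hab hL hstep R₀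
  have hlimit := A.act_mul.elim (fun hA => A.exists_limit_left hA hG₀ R₀ hκ hC0)
    (fun hA => A.exists_limit_right hA hG₀ R₀ hκ hC0)
  obtain ⟨t₀, ⟨ht₀, hiter⟩, hlimit⟩ := (((eventually_gt_atTop 1).and hiter).and hlimit).exists
  refine ⟨1, one_pos, t₀⁻¹, inv_pos.2 (by linarith), fun R hR ε hε hα hβ => ?_⟩
  obtain ⟨e, φ, he0, hφG, he, hφ5, hφ, hζ⟩ := hiter R hR ε hε hα hβ
  obtain ⟨ψ, hψG, ψs, hlim, hψ, hψs, hact⟩ := hlimit R hR e φ hφG he hφ5 hφ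
  have hR₀ : R₀.half ≤ R.half := Radius.half_mono hR
  have hsh := R.shrink_inner_half hψ
  have h₀ : R.inner ≤ R.interp ((1 / 2) ^ 0) :=
    Radius.inner_le_interp R (by positivity)
  have hε0 : T.res h₀ (e 0) = T.res R.inner_le ε := by rw [he0, T.res_res]
  refine ⟨R.inner, R.inner_le, ψ, R.half_le_inner, hψG, hsh, ?_,
    hG₀I _ _ ψ _ hψG (hI _ ε hε) hsh⟩
  refine (H R₀.half).act_mem_of_tendsto hk₁ (hR₀.trans R.half_le_inner) hR₀ _ hsh
    (fun d => R.shrink_inner_half (hψs d)) hlim ?_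
  refine squeeze_zero (fun d => T.nrm_nonneg _ _ _) (fun d => ?_)
    (tendsto_smoothingParam ht₀ hκ).inv_tendsto_atTop
  have hhalf : R.half ≤ R.interp ((1 / 2) ^ d) := R.half_le_interp _
  have hres : π.zeta R.half (T.res hhalf (e d)) = T.res hhalf (π.zeta _ (e d)) := by
    simp only [SCIProjection.zeta, map_sub, π.proj_res]
  rw [← hε0, hact d h₀ hhalf, hres]
  exact ((T.nrm_res_le 1 _ _).trans (T.nrm_le_nrm (by omega) _ _)).trans (hζ d)
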